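/- Let $\Lambda\subset\mathbb C$ be a lattice (with $\mathbb R$-linearly independent generators $2\omega_1,2\omega_2$), let $\wp,\zeta,\sigma$ be its Weierstrass functions, $g_2,g_3$ its invariants, and let $a_n$ be defined by $\wp(z)=z^{-2}+\sum_{n\ge 0}a_nz^n$ near $z=0$. Let $\mathcal A$ be the algebra of holomorphic functions of $x\in\mathbb C\setminus\Lambda$ and $\mathcal E$ the ring of formal pseudo-differential operators $\sum_{n\ll+\infty}b_n\partial_x^n$, $b_n\in\mathcal A$, with product given by the generalized Leibniz rule $(b\,\partial_x^i)(c\,\partial_x^j)=\sum_{r\ge0}\binom{i}{r}\,b\,\partial_x^r(c)\,\partial_x^{i+j-r}$; let $(\cdot)_{\ge 0}$ denote the projection that keeps the terms with $n\ge 0$. There is exactly one sequence $(v_n)_{n\ge0}$ in $\mathcal A$ such that for every $x\in\mathbb C\setminus\Lambda$ and all sufficiently large $|\lambda|$ $$\frac{\sigma(x-\lambda^{-1})}{\sigma(x)}\,e^{(\zeta(\lambda^{-1})-\lambda)x}=\sum_{n\ge0}v_n(x)\lambda^{-n},$$ and $v_0=1$. The operator $V_0=1+\sum_{n\ge1}v_n\partial_x^{-n}$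 is invertible in $\mathcal E$, and $L_0=V_0\,\partial_x\,V_0^{-1}$ is a stationary solution of the KP hierarchy: it has the form $L_0=\partial_x+\sum_{j\ge1}u_{j+1}\partial_x^{-j}$ and $$\left[(L_0^{n+2})_{\ge0},\,L_0\right]=0\qquad(n=0,1,2,\dots).$$ Moreover, for all $n\ge0$, $$(L_0^{n+2})_{\ge0}=\tilde P_{n+2}-\frac{a_n}{n+1}=V_0U_{n+2}V_0^{-1}-\frac{a_n}{n+1},$$ where $$U_{n+2}=\partial_x^{n+2}+\frac{a_n}{n+1}+\sum_{m\ge1}\frac{(-1)^m(m+n)!}{m!\,(n+1)!}\,a_{m+n}\,\partial_x^{-m}$$ has constant coefficients, and the differential operators $\tilde P_n$ $(n\ge2)$ are defined for $m\ge0$ by $$\tilde P_{2m+2}=P_{2m+2}+\sum_{j=1}^{m-1}r_{m,j}P_{2j}+r_{m,0},\qquad \tilde P_{2m+3}=P_{2m+3}+\sum_{j=1}^{m-1}\frac{j\,r_{m,j}}{m+1}P_{2j+1}.$$ Here $P_2=\partial_x^2-2\wp$, $Q_1=\wp\,\partial_x-\tfrac12\wp'$, $P_{n+1}=P_n\partial_x+P_n'-Q_{n-1}$,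 $Q_n=2\wp P_n-Q_{n-1}\partial_x-Q_{n-1}'$ for $n\ge2$ (a prime on an operator differentiates its coefficients), and $r_{m,j}$ is the coefficient of $X^j$ in $R_m/(2m+1)!$, where $R_0=X$ and $R_{m+1}=(6X^2-\tfrac{g_2}{2})R_m'+(4X^3-g_2X-g_3)R_m''$. -/

import Mathlib

noncomputable section

/-! ## Formal pseudo-differential operators -/

/-- Formal pseudo-differential operators `∑_{n ≪ +∞} a_n ∂ⁿ` over a commutative differential
algebra `(A, D)`: families of coefficients `a_n`, `n ∈ ℤ`, vanishing for all large `n`. -/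
structure PseudoDiffOp {k A : Type*} [CommRing k] [CommRing A] [Algebra k A]
    (D : Derivation k A A) where
  /-- the coefficient of `∂ⁿ`, written to the left of `∂ⁿ` -/
  coeff : ℤ → A
  bounded : ∃ N : ℤ, ∀ n, N < n → coeff n = 0

namespace PseudoDiffOp

variable {k A : Type*} [CommRing k] [CommRing A] [Algebra k A] {D : Derivation k A A}

theorem ext_coeff {P Q : PseudoDiffOp D} (h : ∀ n, P.coeff n = Q.coeff n) : P = Q := by
  cases P; cases Q; congr; exact funext h

instance : Zero (PseudoDiffOp D) := ⟨⟨fun _ => 0, 0, fun _ _ => rfl⟩⟩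

instance : Add (PseudoDiffOp D) := ⟨fun P Q => ⟨fun n => P.coeff n + Q.coeff n, by
  obtain ⟨N, hN⟩ := P.bounded
  obtain ⟨M, hM⟩ := Q.bounded
  exact ⟨max N M, fun n hn => by
    rw [hN n (lt_of_le_of_lt (le_max_left _ _) hn), hM n (lt_of_le_of_lt (le_max_right _ _) hn),
      add_zero]⟩⟩⟩

instance : Neg (PseudoDiffOp D) := ⟨fun P => ⟨fun n => -P.coeff n, by
  obtain ⟨N, hN⟩ := P.bounded
  exact ⟨N, fun n hn => by rw [hN n hn, neg_zero]⟩⟩⟩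

/-- The operator `a ∂ⁿ`. -/
def monomial (D : Derivation k A A) (a : A) (n : ℤ) : PseudoDiffOp D :=
  ⟨fun m => if m = n then a else 0, n, fun _ h => if_neg (ne_of_gt h)⟩

/-- The operator of multiplication by `a`. -/
def mulBy (D : Derivation k A A) (a : A) : PseudoDiffOp D := monomial D a 0

/-- The operator `∂`. -/
def del (D : Derivation k A A) : PseudoDiffOp D := monomial D 1 1

instance : One (PseudoDiffOp D) := ⟨mulBy D 1⟩

/-- The terms of the product of two operators of order at most `N` and `M` in degree `n` are
all of the form below. -/
theorem mul_support (P Q : PseudoDiffOp D) {N M : ℤ} (hN : ∀ n, N < n → P.coeff n = 0)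
    (hM : ∀ n, M < n → Q.coeff n = 0) (n : ℤ) (p : ℤ × ℕ)
    (hp : Ring.choose p.1 p.2 • (P.coeff p.1 * D^[p.2] (Q.coeff (n - p.1 + p.2))) ≠ 0) :
    p.1 ≤ N ∧ n - p.1 + p.2 ≤ M := by
  constructor
  · by_contra h
    apply hp
    rw [hN _ (not_le.mp h), zero_mul, smul_zero]
  · by_contra h
    apply hp
    rw [hM _ (not_le.mp h), iterate_map_zero, mul_zero, smul_zero]

/-- The product given by the generalized Leibniz rule
`(a ∂ⁱ) (b ∂ʲ) = ∑_r (i choose r) a D^r(b) ∂^(i+j-r)`: in degree `n`, the sum runs over all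
`(i, r)` with `j = n - i + r`, and only finitely many terms are nonzero. -/
instance : Mul (PseudoDiffOp D) := ⟨fun P Q =>
  ⟨fun n => ∑ᶠ p : ℤ × ℕ,
      Ring.choose p.1 p.2 • (P.coeff p.1 * D^[p.2] (Q.coeff (n - p.1 + p.2))), by
    obtain ⟨N, hN⟩ := P.bounded
    obtain ⟨M, hM⟩ := Q.bounded
    refine ⟨N + M, fun n hn => finsum_eq_zero_of_forall_eq_zero fun p => ?_⟩
    by_contra hp
    have := mul_support P Q hN hM n p hp
    omega⟩⟩

theorem coeff_mul (P Q : PseudoDiffOp D) (n : ℤ) : (P * Q).coeff n = ∑ᶠ p : ℤ × ℕ,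
    Ring.choose p.1 p.2 • (P.coeff p.1 * D^[p.2] (Q.coeff (n - p.1 + p.2))) := rfl

theorem coeff_zero (n : ℤ) : (0 : PseudoDiffOp D).coeff n = 0 := rfl

theorem coeff_add (P Q : PseudoDiffOp D) (n : ℤ) :
    (P + Q).coeff n = P.coeff n + Q.coeff n := rfl

theorem coeff_neg (P : PseudoDiffOp D) (n : ℤ) : (-P).coeff n = -P.coeff n := rfl

theorem coeff_one (n : ℤ) : (1 : PseudoDiffOp D).coeff n = if n = 0 then 1 else 0 := rfl

theorem coeff_monomial (a : A) (m n : ℤ) :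
    (monomial D a n).coeff m = if m = n then a else 0 := rfl

theorem coeff_mul_of_lt (P Q : PseudoDiffOp D) {N M : ℤ} (hN : ∀ n, N < n → P.coeff n = 0)
    (hM : ∀ n, M < n → Q.coeff n = 0) (n : ℤ) (hn : N + M < n) : (P * Q).coeff n = 0 := by
  rw [coeff_mul]
  refine finsum_eq_zero_of_forall_eq_zero fun p => ?_
  by_contra hp
  have := mul_support P Q hN hM n p hp
  omega

/-- The product in terms of the depth below the leading order. -/
theorem coeff_mul_depth (P Q : PseudoDiffOp D) {N M : ℤ} (hN : ∀ n, N < n → P.coeff n = 0)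
    (hM : ∀ n, M < n → Q.coeff n = 0) (d : ℕ) : (P * Q).coeff (N + M - d) =
      ∑ x ∈ Finset.HasAntidiagonal.antidiagonal d, ∑ y ∈ Finset.HasAntidiagonal.antidiagonal x.2,
        Ring.choose (N - x.1) y.2 • (P.coeff (N - x.1) * D^[y.2] (Q.coeff (M - y.1))) := by
  rw [coeff_mul, Finset.sum_sigma']
  set S := (Finset.HasAntidiagonal.antidiagonal d).sigma fun x : ℕ × ℕ => Finset.HasAntidiagonal.antidiagonal x.2 with hS
  have hinj : Set.InjOn (fun z : (Σ _ : ℕ × ℕ, ℕ × ℕ) => ((N - z.1.1, z.2.2) : ℤ × ℕ)) S := by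
    rintro ⟨⟨a, b⟩, c, e⟩ h ⟨⟨a', b'⟩, c', e'⟩ h' heq
    simp only [hS, Finset.coe_sigma, Set.mem_sigma_iff, Finset.mem_coe,
      Finset.HasAntidiagonal.mem_antidiagonal, Prod.mk.injEq] at h h' heq
    have h1 : a = a' := by omega
    have h2 : b = b' := by omega
    have h3 : e = e' := by omega
    have h4 : c = c' := by omega
    subst h1 h2 h3 h4
    rfl
  rw [finsum_eq_sum_of_support_subset (s := S.image fun z => ((N - z.1.1, z.2.2) : ℤ × ℕ)),
    Finset.sum_image hinj]
  · refine Finset.sum_congr rfl ?_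
    rintro ⟨⟨a, b⟩, c, e⟩ h
    simp only [hS, Finset.mem_sigma, Finset.HasAntidiagonal.mem_antidiagonal] at h
    have : N + M - (d : ℤ) - (N - a) + e = M - c := by omega
    simp only [this]
  · rintro ⟨i, r⟩ hp
    have h := mul_support P Q hN hM _ _ hp
    simp only at h
    simp only [Finset.coe_image, Set.mem_image, hS, Finset.mem_coe, Finset.mem_sigma,
      Finset.HasAntidiagonal.mem_antidiagonal]
    refine ⟨⟨((N - i).toNat, d - (N - i).toNat), (d - (N - i).toNat - r, r)⟩, ?_, ?_⟩
    · constructor <;> simp only <;> omega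
    · simp only [Prod.mk.injEq, and_true]; omega

theorem iterate_mul (D : Derivation k A A) (n : ℕ) (a b : A) : D^[n] (a * b) =
    ∑ z ∈ Finset.HasAntidiagonal.antidiagonal n, (n.choose z.1 : ℤ) • (D^[z.1] a * D^[z.2] b) := by
  induction n with
  | zero => simp
  | succ n ih =>
    have key := Finset.sum_antidiagonal_choose_succ_nsmul (fun i j => D^[i] a * D^[j] b) n
    simp only [natCast_zsmul]
    rw [key, Function.iterate_succ_apply', ih]
    simp only [natCast_zsmul, map_sum, map_nsmul, Derivation.leibniz, smul_eq_mul, smul_add,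
      Finset.sum_add_distrib, Function.iterate_succ_apply']
    congr 1
    refine Finset.sum_congr rfl fun z hz => ?_
    rw [Nat.choose_symm_of_eq_add (Finset.HasAntidiagonal.mem_antidiagonal.mp hz).symm, mul_comm]

theorem choose_mul_choose (x : ℤ) (r b : ℕ) :
    Ring.choose x (r + b) * ((r + b).choose r : ℤ) = Ring.choose x r * Ring.choose (x - r) b := by
  have h := Ring.choose_add_smul_choose (x - r) b r
  rw [sub_add_cancel, nsmul_eq_mul, add_comm b r] at h
  rw [← h, mul_comm]

theorem iterate_zsmul (D : Derivation k A A) (n : ℕ) (c : ℤ) (a : A) :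
    D^[n] (c • a) = c • D^[n] a := by
  induction n with
  | zero => rfl
  | succ n ih => rw [Function.iterate_succ_apply', ih, map_zsmul, Function.iterate_succ_apply']

theorem iterate_sum {ι : Type*} (D : Derivation k A A) (n : ℕ) (s : Finset ι) (f : ι → A) :
    D^[n] (∑ i ∈ s, f i) = ∑ i ∈ s, D^[n] (f i) := by
  induction n with
  | zero => rfl
  | succ n ih => simp only [Function.iterate_succ_apply', ih, map_sum]

theorem assoc_aux (D : Derivation k A A) (p q r : ℕ → A) (N M : ℤ) (d : ℕ) :
    ∑ x ∈ Finset.HasAntidiagonal.antidiagonal d, ∑ y ∈ Finset.HasAntidiagonal.antidiagonal x.2,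
      Ring.choose (N + M - x.1) y.2 • ((∑ z ∈ Finset.HasAntidiagonal.antidiagonal x.1,
        ∑ w ∈ Finset.HasAntidiagonal.antidiagonal z.2,
          Ring.choose (N - z.1) w.2 • (p z.1 * D^[w.2] (q w.1))) * D^[y.2] (r y.1)) =
    ∑ x ∈ Finset.HasAntidiagonal.antidiagonal d, ∑ y ∈ Finset.HasAntidiagonal.antidiagonal x.2,
      Ring.choose (N - x.1) y.2 • (p x.1 * D^[y.2] (∑ z ∈ Finset.HasAntidiagonal.antidiagonal y.1,
        ∑ w ∈ Finset.HasAntidiagonal.antidiagonal z.2,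
          Ring.choose (M - z.1) w.2 • (q z.1 * D^[w.2] (r w.1)))) := by
  have hL : ∀ x ∈ Finset.HasAntidiagonal.antidiagonal d, ∀ y ∈ Finset.HasAntidiagonal.antidiagonal x.2,
      Ring.choose (N + M - x.1) y.2 • ((∑ z ∈ Finset.HasAntidiagonal.antidiagonal x.1,
        ∑ w ∈ Finset.HasAntidiagonal.antidiagonal z.2,
          Ring.choose (N - z.1) w.2 • (p z.1 * D^[w.2] (q w.1))) * D^[y.2] (r y.1)) =
      ∑ z ∈ Finset.HasAntidiagonal.antidiagonal x.1, ∑ w ∈ Finset.HasAntidiagonal.antidiagonal z.2,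
        ∑ v ∈ Finset.HasAntidiagonal.antidiagonal y.2,
          (Ring.choose (N - z.1) w.2 * Ring.choose (N - z.1 - w.2) v.1 *
            Ring.choose (M - w.1) v.2) •
            (p z.1 * D^[w.2] (q w.1) * D^[v.1 + v.2] (r y.1)) := by
    intro x _ y _
    rw [Finset.sum_mul, Finset.smul_sum]
    refine Finset.sum_congr rfl fun z hz => ?_
    rw [Finset.sum_mul, Finset.smul_sum]
    refine Finset.sum_congr rfl fun w hw => ?_
    rw [Finset.HasAntidiagonal.mem_antidiagonal] at hz hw
    have e : N + M - (x.1 : ℤ) = (N - z.1 - w.2) + (M - w.1) := by omega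
    rw [e, Ring.add_choose_eq _ (Commute.all _ _), Finset.sum_smul]
    refine Finset.sum_congr rfl fun v hv => ?_
    rw [Finset.HasAntidiagonal.mem_antidiagonal] at hv
    rw [hv, smul_mul_assoc, smul_smul]
    congr 1
    ring
  have hR : ∀ x ∈ Finset.HasAntidiagonal.antidiagonal d, ∀ y ∈ Finset.HasAntidiagonal.antidiagonal x.2,
      Ring.choose (N - x.1) y.2 • (p x.1 * D^[y.2] (∑ z ∈ Finset.HasAntidiagonal.antidiagonal y.1,
        ∑ w ∈ Finset.HasAntidiagonal.antidiagonal z.2,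
          Ring.choose (M - z.1) w.2 • (q z.1 * D^[w.2] (r w.1)))) =
      ∑ z ∈ Finset.HasAntidiagonal.antidiagonal y.1, ∑ w ∈ Finset.HasAntidiagonal.antidiagonal z.2,
        ∑ v ∈ Finset.HasAntidiagonal.antidiagonal y.2,
          (Ring.choose (N - x.1) v.1 * Ring.choose (N - x.1 - v.1) v.2 *
            Ring.choose (M - z.1) w.2) •
            (p x.1 * D^[v.1] (q z.1) * D^[v.2 + w.2] (r w.1)) := by
    intro x _ y _
    rw [iterate_sum, Finset.mul_sum, Finset.smul_sum]
    refine Finset.sum_congr rfl fun z _ => ?_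
    rw [iterate_sum, Finset.mul_sum, Finset.smul_sum]
    refine Finset.sum_congr rfl fun w _ => ?_
    rw [iterate_zsmul, iterate_mul, Finset.smul_sum, Finset.mul_sum, Finset.smul_sum]
    refine Finset.sum_congr rfl fun v hv => ?_
    rw [Finset.HasAntidiagonal.mem_antidiagonal] at hv
    rw [← choose_mul_choose, hv, Function.iterate_add_apply, mul_smul_comm, mul_smul_comm,
      smul_smul, smul_smul, mul_assoc (p x.1)]
    congr 1
    ring
  rw [Finset.sum_congr rfl fun x hx => Finset.sum_congr rfl (hL x hx),
    Finset.sum_congr rfl fun x hx => Finset.sum_congr rfl (hR x hx)]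
  simp only [Finset.sum_sigma']
  refine Finset.sum_bij'
    (fun t _ => ⟨(t.2.2.1.1, d - t.2.2.1.1),
      ⟨(d - t.2.2.1.1 - (t.2.2.2.1.2 + t.2.2.2.2.1), t.2.2.2.1.2 + t.2.2.2.2.1),
      ⟨(t.2.2.2.1.1, t.2.1.1 + t.2.2.2.2.2),
      ⟨(t.2.1.1, t.2.2.2.2.2), (t.2.2.2.1.2, t.2.2.2.2.1)⟩⟩⟩⟩)
    (fun t _ => ⟨(t.1.1 + t.2.2.1.1 + t.2.2.2.2.1,
      t.2.2.2.1.1 + (t.2.2.2.2.2 + t.2.2.2.1.2)),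
      ⟨(t.2.2.2.1.1, t.2.2.2.2.2 + t.2.2.2.1.2),
      ⟨(t.1.1, t.2.2.1.1 + t.2.2.2.2.1),
      ⟨(t.2.2.1.1, t.2.2.2.2.1), (t.2.2.2.2.2, t.2.2.2.1.2)⟩⟩⟩⟩)
    ?_ ?_ ?_ ?_ ?_
  · rintro ⟨⟨a, b⟩, ⟨c, e⟩, ⟨f, g⟩, ⟨h, i⟩, j, l⟩ ht
    simp only [Finset.mem_sigma, Finset.HasAntidiagonal.mem_antidiagonal, and_true] at ht ⊢
    omega
  · rintro ⟨⟨a, b⟩, ⟨c, e⟩, ⟨f, g⟩, ⟨h, i⟩, j, l⟩ ht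
    simp only [Finset.mem_sigma, Finset.HasAntidiagonal.mem_antidiagonal, and_true, true_and] at ht ⊢
    omega
  · rintro ⟨⟨a, b⟩, ⟨c, e⟩, ⟨f, g⟩, ⟨h, i⟩, j, l⟩ ht
    simp only [Finset.mem_sigma, Finset.HasAntidiagonal.mem_antidiagonal] at ht
    simp only [Sigma.mk.injEq, Prod.mk.injEq, heq_eq_eq, and_true, true_and]
    omega
  · rintro ⟨⟨a, b⟩, ⟨c, e⟩, ⟨f, g⟩, ⟨h, i⟩, j, l⟩ ht
    simp only [Finset.mem_sigma, Finset.HasAntidiagonal.mem_antidiagonal] at ht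
    simp only [Sigma.mk.injEq, Prod.mk.injEq, heq_eq_eq, and_true, true_and]
    omega
  · rintro ⟨⟨a, b⟩, ⟨c, e⟩, ⟨f, g⟩, ⟨h, i⟩, j, l⟩ ht
    rfl

theorem coeff_eq_of_bounded {P Q : PseudoDiffOp D} {N : ℤ} (hP : ∀ n, N < n → P.coeff n = 0)
    (hQ : ∀ n, N < n → Q.coeff n = 0) (h : ∀ d : ℕ, P.coeff (N - d) = Q.coeff (N - d)) :
    P = Q := by
  refine ext_coeff fun n => ?_
  by_cases hn : N < n
  · rw [hP n hn, hQ n hn]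
  · have : n = N - ((N - n).toNat : ℕ) := by omega
    rw [this, h]

theorem mul_assoc_op (P Q R : PseudoDiffOp D) : P * Q * R = P * (Q * R) := by
  obtain ⟨N, hN⟩ := P.bounded
  obtain ⟨M, hM⟩ := Q.bounded
  obtain ⟨K, hK⟩ := R.bounded
  have hPQ := coeff_mul_of_lt P Q hN hM
  have hQR := coeff_mul_of_lt Q R hM hK
  refine coeff_eq_of_bounded (coeff_mul_of_lt _ _ hPQ hK)
    (fun n hn => coeff_mul_of_lt _ _ hN hQR n (by omega)) fun d => ?_
  rw [coeff_mul_depth _ _ hPQ hK, add_assoc N M K, coeff_mul_depth _ _ hN hQR]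
  simp only [coeff_mul_depth _ _ hN hM, coeff_mul_depth _ _ hM hK]
  exact assoc_aux D (fun i => P.coeff (N - i)) (fun i => Q.coeff (M - i))
    (fun i => R.coeff (K - i)) N M d

theorem exists_bound₂ (P Q : PseudoDiffOp D) :
    ∃ N : ℤ, (∀ n, N < n → P.coeff n = 0) ∧ ∀ n, N < n → Q.coeff n = 0 := by
  obtain ⟨N, hN⟩ := P.bounded
  obtain ⟨M, hM⟩ := Q.bounded
  exact ⟨max N M, fun n hn => hN n (lt_of_le_of_lt (le_max_left _ _) hn),
    fun n hn => hM n (lt_of_le_of_lt (le_max_right _ _) hn)⟩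

theorem coeff_add_of_lt {P Q : PseudoDiffOp D} {N : ℤ} (hP : ∀ n, N < n → P.coeff n = 0)
    (hQ : ∀ n, N < n → Q.coeff n = 0) (n : ℤ) (hn : N < n) : (P + Q).coeff n = 0 := by
  rw [coeff_add, hP n hn, hQ n hn, add_zero]

theorem iterate_add (D : Derivation k A A) (n : ℕ) (a b : A) :
    D^[n] (a + b) = D^[n] a + D^[n] b := by
  induction n with
  | zero => rfl
  | succ n ih => simp only [Function.iterate_succ_apply', ih, map_add]

theorem left_distrib_op (P Q R : PseudoDiffOp D) : P * (Q + R) = P * Q + P * R := by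
  obtain ⟨N, hN⟩ := P.bounded
  obtain ⟨M, hQ, hR⟩ := exists_bound₂ Q R
  have hQR := coeff_add_of_lt hQ hR
  refine coeff_eq_of_bounded (coeff_mul_of_lt _ _ hN hQR)
    (coeff_add_of_lt (coeff_mul_of_lt _ _ hN hQ) (coeff_mul_of_lt _ _ hN hR)) fun d => ?_
  rw [coeff_add, coeff_mul_depth _ _ hN hQR, coeff_mul_depth _ _ hN hQ, coeff_mul_depth _ _ hN hR]
  simp only [coeff_add, iterate_add, mul_add, smul_add, Finset.sum_add_distrib]

theorem right_distrib_op (P Q R : PseudoDiffOp D) : (P + Q) * R = P * R + Q * R := by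
  obtain ⟨M, hM⟩ := R.bounded
  obtain ⟨N, hP, hQ⟩ := exists_bound₂ P Q
  have hPQ := coeff_add_of_lt hP hQ
  refine coeff_eq_of_bounded (coeff_mul_of_lt _ _ hPQ hM)
    (coeff_add_of_lt (coeff_mul_of_lt _ _ hP hM) (coeff_mul_of_lt _ _ hQ hM)) fun d => ?_
  rw [coeff_add, coeff_mul_depth _ _ hPQ hM, coeff_mul_depth _ _ hP hM, coeff_mul_depth _ _ hQ hM]
  simp only [coeff_add, add_mul, smul_add, Finset.sum_add_distrib]

theorem iterate_one (D : Derivation k A A) {r : ℕ} (hr : r ≠ 0) : D^[r] (1 : A) = 0 := by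
  obtain ⟨r, rfl⟩ := Nat.exists_eq_succ_of_ne_zero hr
  rw [Function.iterate_succ_apply, Derivation.map_one_eq_zero, iterate_map_zero]

theorem one_mul_op (P : PseudoDiffOp D) : 1 * P = P := by
  refine ext_coeff fun n => ?_
  rw [coeff_mul, finsum_eq_single _ ((0, 0) : ℤ × ℕ)]
  · simp [coeff_one]
  · rintro ⟨i, r⟩ h
    by_cases hi : i = 0
    · subst hi
      have hr : r ≠ 0 := by rintro rfl; exact h rfl
      obtain ⟨r, rfl⟩ := Nat.exists_eq_succ_of_ne_zero hr
      simp only [Nat.succ_eq_add_one, Ring.choose_zero_succ, zero_smul]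
    · simp [coeff_one, hi]

theorem mul_one_op (P : PseudoDiffOp D) : P * 1 = P := by
  refine ext_coeff fun n => ?_
  rw [coeff_mul, finsum_eq_single _ ((n, 0) : ℤ × ℕ)]
  · simp [coeff_one]
  · rintro ⟨i, r⟩ h
    by_cases hr : r = 0
    · subst hr
      have hi : n - i ≠ 0 := fun h0 => h (by rw [sub_eq_zero.mp h0])
      simp [coeff_one, hi]
    · simp only [coeff_one]
      split_ifs
      · rw [iterate_one D hr, mul_zero, smul_zero]
      · rw [iterate_map_zero, mul_zero, smul_zero]

/-- The (noncommutative) ring of formal pseudo-differential operators. -/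
instance : Ring (PseudoDiffOp D) where
  add_assoc P Q R := ext_coeff fun n => add_assoc _ _ _
  zero_add P := ext_coeff fun n => zero_add _
  add_zero P := ext_coeff fun n => add_zero _
  add_comm P Q := ext_coeff fun n => add_comm _ _
  neg_add_cancel P := ext_coeff fun n => neg_add_cancel _
  mul_assoc := mul_assoc_op
  left_distrib := left_distrib_op
  right_distrib := right_distrib_op
  one_mul := one_mul_op
  mul_one := mul_one_op
  zero_mul P := ext_coeff fun n => by simp [coeff_mul, coeff_zero]
  mul_zero P := ext_coeff fun n => by simp [coeff_mul, coeff_zero]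
  nsmul := nsmulRec
  zsmul := zsmulRec

/-- The projection `(·)_{≥0}` onto differential operators. -/
def nonnegPart (P : PseudoDiffOp D) : PseudoDiffOp D :=
  ⟨fun n => if 0 ≤ n then P.coeff n else 0, by
    obtain ⟨N, hN⟩ := P.bounded
    exact ⟨N, fun n hn => by rw [hN n hn, ite_self]⟩⟩

/-- `P′ = ∑ D(a_n) ∂ⁿ` for `P = ∑ a_n ∂ⁿ`. -/
def coeffDeriv (P : PseudoDiffOp D) : PseudoDiffOp D :=
  ⟨fun n => D (P.coeff n), by
    obtain ⟨N, hN⟩ := P.bounded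
    exact ⟨N, fun n hn => by rw [hN n hn, map_zero]⟩⟩

/-- The operator `∑_{n ≥ 0} v_n ∂⁻ⁿ` with symbol `∑_{n ≥ 0} v_n λ⁻ⁿ`. -/
def ofSymbol (D : Derivation k A A) (v : ℕ → A) : PseudoDiffOp D :=
  ⟨fun n => if n ≤ 0 then v (-n).toNat else 0, 0, fun _ hn => if_neg (not_le.mpr hn)⟩

/-- `P` has the form `∂ + ∑_{j ≥ 1} u_{j+1} ∂⁻ʲ`. -/
def IsLaxOperator (P : PseudoDiffOp D) : Prop :=
  (∀ n : ℤ, 1 < n → P.coeff n = 0) ∧ P.coeff 1 = 1 ∧ P.coeff 0 = 0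

/-- `P` is a stationary (time-independent) solution of the KP hierarchy
`∂P/∂t_m = [(P^m)_{≥0}, P]`, `m = 2, 3, …`. -/
def IsStationaryKP (P : PseudoDiffOp D) : Prop :=
  P.IsLaxOperator ∧ ∀ n : ℕ, ⁅(P ^ (n + 2)).nonnegPart, P⁆ = 0

end PseudoDiffOp

/-! ## Weierstrass functions and holomorphic coefficients -/

namespace PeriodPair

variable (L : PeriodPair)

/-- The Weierstrass zeta function `1/z + ∑_{l ≠ 0} (1/(z - l) + 1/l + z/l²)`; since `1/0 = 0`,
the term `l = 0` of the sum below is `1/z`. -/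
def weierstrassZeta (z : ℂ) : ℂ :=
  ∑' l : L.lattice, (1 / (z - l) + 1 / (l : ℂ) + z / (l : ℂ) ^ 2)

/-- The Weierstrass sigma function `z ∏_{l ≠ 0} (1 - z/l) exp(z/l + z²/(2l²))`; since `z/0 = 0`,
the factor `l = 0` of the product below is `1`. -/
def weierstrassSigma (z : ℂ) : ℂ :=
  z * ∏' l : L.lattice,
    (1 - z / (l : ℂ)) * Complex.exp (z / (l : ℂ) + z ^ 2 / (2 * (l : ℂ) ^ 2))

/-- The coefficient `a_n` of the Laurent expansion `℘(z) = 1/z² + ∑_{n ≥ 0} a_n zⁿ` at `0`.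
Here `L.weierstrassPExcept 0` is the function `℘(z) - 1/z²`, which is analytic at `0`. -/
def laurentCoeff (n : ℕ) : ℂ := iteratedDeriv n (L.weierstrassPExcept 0) 0 / (n.factorial : ℂ)

/-- Extension by zero of a function on the complement of the lattice. -/
def extendZero (f : ((L.lattice : Set ℂ)ᶜ : Set ℂ) → ℂ) : ℂ → ℂ :=
  Function.extend Subtype.val f 0

variable {L} in
theorem extendZero_apply (f : ((L.lattice : Set ℂ)ᶜ : Set ℂ) → ℂ)
    (z : ((L.lattice : Set ℂ)ᶜ : Set ℂ)) : L.extendZero f z = f z :=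
  Subtype.val_injective.extend_apply f 0 z

theorem extendZero_eqOn {f : ((L.lattice : Set ℂ)ᶜ : Set ℂ) → ℂ} {F : ℂ → ℂ}
    (h : ∀ z : ((L.lattice : Set ℂ)ᶜ : Set ℂ), f z = F z) :
    Set.EqOn (L.extendZero f) F ((L.lattice : Set ℂ)ᶜ) := fun z hz =>
  (extendZero_apply f ⟨z, hz⟩).trans (h ⟨z, hz⟩)

theorem differentiableOn_extendZero {f : ((L.lattice : Set ℂ)ᶜ : Set ℂ) → ℂ} {F : ℂ → ℂ}
    (h : ∀ z : ((L.lattice : Set ℂ)ᶜ : Set ℂ), f z = F z)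
    (hF : DifferentiableOn ℂ F ((L.lattice : Set ℂ)ᶜ)) :
    DifferentiableOn ℂ (L.extendZero f) ((L.lattice : Set ℂ)ᶜ) :=
  hF.congr (L.extendZero_eqOn h)

/-- The algebra of holomorphic functions on the complement of the lattice. -/
def holomorphicFun : Subalgebra ℂ (((L.lattice : Set ℂ)ᶜ : Set ℂ) → ℂ) where
  carrier := {f | DifferentiableOn ℂ (L.extendZero f) ((L.lattice : Set ℂ)ᶜ)}
  mul_mem' {f g} hf hg := L.differentiableOn_extendZero
    (F := fun z => L.extendZero f z * L.extendZero g z)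
    (fun z => by rw [extendZero_apply, extendZero_apply, Pi.mul_apply]) (hf.fun_mul hg)
  add_mem' {f g} hf hg := L.differentiableOn_extendZero
    (F := fun z => L.extendZero f z + L.extendZero g z)
    (fun z => by rw [extendZero_apply, extendZero_apply, Pi.add_apply]) (hf.fun_add hg)
  algebraMap_mem' c := L.differentiableOn_extendZero (F := fun _ => c) (fun _ => rfl)
    (differentiableOn_const c)

/-- The restriction to the complement of the lattice of a function holomorphic there. -/
def toHolomorphicFun (F : ℂ → ℂ) (hF : DifferentiableOn ℂ F ((L.lattice : Set ℂ)ᶜ)) :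
    L.holomorphicFun :=
  ⟨fun z => F z, L.differentiableOn_extendZero (fun _ => rfl) hF⟩

theorem hasDerivAt_extendZero (f : L.holomorphicFun) (z : ((L.lattice : Set ℂ)ᶜ : Set ℂ)) :
    HasDerivAt (L.extendZero f.1) (deriv (L.extendZero f.1) z) z :=
  (f.2.differentiableAt (L.isClosed_lattice.isOpen_compl.mem_nhds z.2)).hasDerivAt

theorem deriv_extendZero {f : ((L.lattice : Set ℂ)ᶜ : Set ℂ) → ℂ} {F : ℂ → ℂ}
    (h : ∀ z : ((L.lattice : Set ℂ)ᶜ : Set ℂ), f z = F z)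
    (z : ((L.lattice : Set ℂ)ᶜ : Set ℂ)) : deriv (L.extendZero f) z = deriv F z :=
  ((L.extendZero_eqOn h).eventuallyEq_of_mem
    (L.isClosed_lattice.isOpen_compl.mem_nhds z.2)).deriv_eq

/-- The derivation `d/dx` of the algebra of holomorphic functions. -/
def derivation : Derivation ℂ L.holomorphicFun L.holomorphicFun :=
  Derivation.mk'
    { toFun := fun f => L.toHolomorphicFun (deriv (L.extendZero f.1))
        (DifferentiableOn.deriv f.2 L.isClosed_lattice.isOpen_compl)
      map_add' := fun f g => Subtype.ext <| funext fun z =>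
        (L.deriv_extendZero (F := fun w => L.extendZero f.1 w + L.extendZero g.1 w)
          (fun w => by rw [extendZero_apply, extendZero_apply]; rfl) z).trans
          ((L.hasDerivAt_extendZero f z).fun_add (L.hasDerivAt_extendZero g z)).deriv
      map_smul' := fun c f => Subtype.ext <| funext fun z =>
        (L.deriv_extendZero (F := fun w => c * L.extendZero f.1 w)
          (fun w => by rw [extendZero_apply]; rfl) z).trans
          ((L.hasDerivAt_extendZero f z).const_mul c).deriv }
    (fun f g => Subtype.ext <| funext fun z => by
      refine (L.deriv_extendZero (F := fun w => L.extendZero f.1 w * L.extendZero g.1 w)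
          (fun w => by rw [extendZero_apply, extendZero_apply]; rfl) z).trans
          (((L.hasDerivAt_extendZero f z).fun_mul (L.hasDerivAt_extendZero g z)).deriv.trans ?_)
      rw [extendZero_apply, extendZero_apply, add_comm, mul_comm (deriv _ _)]
      rfl)

/-- Pseudo-differential operators in `x` with coefficients holomorphic off the lattice. -/
abbrev PDO := PseudoDiffOp L.derivation

/-- A complex constant as an operator. -/
def constOp (c : ℂ) : L.PDO := PseudoDiffOp.mulBy L.derivation (algebraMap ℂ L.holomorphicFun c)

/-- The function `σ(x - λ⁻¹) / σ(x) · exp((ζ(λ⁻¹) - λ) x)`. -/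
def vHat (x lam : ℂ) : ℂ :=
  L.weierstrassSigma (x - lam⁻¹) / L.weierstrassSigma x *
    Complex.exp ((L.weierstrassZeta lam⁻¹ - lam) * x)

/-- The sequence `v` of functions of `x` is the coefficient sequence of the expansion
`vHat(x, λ) = ∑_{n ≥ 0} v_n(x) λ⁻ⁿ` around `λ = ∞`. -/
def IsExpansionOfVHat (v : ℕ → L.holomorphicFun) : Prop :=
  ∀ x : ((L.lattice : Set ℂ)ᶜ : Set ℂ), ∀ᶠ lam in Bornology.cobounded ℂ,
    HasSum (fun n : ℕ => (v n).1 x * (lam⁻¹) ^ n) (L.vHat x lam)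

/-- The operator `U_{n+2} = ∂^{n+2} + a_n/(n+1) + ∑_{m ≥ 1} (-1)^m (m+n)!/(m! (n+1)!) a_{m+n} ∂^{-m}`;
it has constant coefficients, and the term `a_n/(n+1)` is the one for `m = 0`. -/
def opU (n : ℕ) : L.PDO :=
  PseudoDiffOp.del L.derivation ^ (n + 2) +
    PseudoDiffOp.ofSymbol L.derivation fun m => algebraMap ℂ L.holomorphicFun
      ((-1) ^ m * ((m + n).factorial : ℂ) / ((m.factorial : ℂ) * ((n + 1).factorial : ℂ)) *
        L.laurentCoeff (m + n))

/-- The function `℘` as a coefficient. -/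
def wp : L.holomorphicFun := L.toHolomorphicFun L.weierstrassP L.differentiableOn_weierstrassP

/-- The pair `(P_{n+2}, Q_{n+1})`, where `P_2 = ∂² - 2℘`, `Q_1 = ℘ ∂ - ℘′/2`,
`P_{n+1} = P_n ∂ + P_n′ - Q_{n-1}` and `Q_n = 2℘ P_n - Q_{n-1} ∂ - Q_{n-1}′`. -/
def lamePQ : ℕ → L.PDO × L.PDO
  | 0 => (PseudoDiffOp.del L.derivation ^ 2 - PseudoDiffOp.mulBy L.derivation (2 * L.wp),
      PseudoDiffOp.mulBy L.derivation L.wp * PseudoDiffOp.del L.derivation -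
        PseudoDiffOp.mulBy L.derivation ((1 / 2 : ℂ) • L.derivation L.wp))
  | n + 1 =>
      ((lamePQ n).1 * PseudoDiffOp.del L.derivation + (lamePQ n).1.coeffDeriv - (lamePQ n).2,
        PseudoDiffOp.mulBy L.derivation (2 * L.wp) * (lamePQ n).1 -
          (lamePQ n).2 * PseudoDiffOp.del L.derivation - (lamePQ n).2.coeffDeriv)

/-- The operator `P_n`, for `n ≥ 2`. -/
def lameP (n : ℕ) : L.PDO := (L.lamePQ (n - 2)).1

/-- The polynomials `R_n` with `R_0 = X` and
`R_{n+1} = (6X² - g₂/2) R_n′ + (4X³ - g₂X - g₃) R_n″`, for which `℘^{(2n)} = R_n(℘)`. -/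
def polyR : ℕ → Polynomial ℂ
  | 0 => Polynomial.X
  | n + 1 =>
      (6 * Polynomial.X ^ 2 - Polynomial.C (L.g₂ / 2)) * Polynomial.derivative (polyR n) +
      (4 * Polynomial.X ^ 3 - Polynomial.C L.g₂ * Polynomial.X - Polynomial.C L.g₃) *
        Polynomial.derivative (Polynomial.derivative (polyR n))

/-- The numbers `r_{n,j}` with `R_n = (2n+1)! (X^{n+1} + ∑_{j=0}^{n-1} r_{n,j} X^j)`. -/
def coeffR (n j : ℕ) : ℂ := (L.polyR n).coeff j / ((2 * n + 1).factorial : ℂ)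

/-- The differential operators `P̃_n`, for `n ≥ 2`:
`P̃_{2m+2} = P_{2m+2} + ∑_{j=1}^{m-1} r_{m,j} P_{2j} + r_{m,0}` and
`P̃_{2m+3} = P_{2m+3} + ∑_{j=1}^{m-1} (j r_{m,j}/(m+1)) P_{2j+1}`. -/
def tildeP (n : ℕ) : L.PDO :=
  let m := n / 2 - 1
  if Even n then
    L.lameP n + ∑ j ∈ Finset.Ico 1 m, L.constOp (L.coeffR m j) * L.lameP (2 * j) +
      L.constOp (L.coeffR m 0)
  else
    L.lameP n + ∑ j ∈ Finset.Ico 1 m,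
      L.constOp ((j : ℂ) * L.coeffR m j / ((m : ℂ) + 1)) * L.lameP (2 * j + 1)

end PeriodPair

end

/-! ### Operators of order at most zero as power series in the symbol X of ∂⁻¹. -/

noncomputable section

namespace PseudoDiffOp

variable {k A : Type*} [CommRing k] [CommRing A] [Algebra k A] {D : Derivation k A A}

open PowerSeries

/-! Write X = λ⁻¹ for the symbol of ∂⁻¹, V = ∑ vₙXⁿ and ψ = V e^{x/X}. Formally, an operator acting
on ψ corresponds to left multiplication on V₀, and multiplying ψ by a function of X alone
corresponds to right multiplication of V₀ by a constant-coefficient operator. Since σ'/σ = ζ, V is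
the formal solution of a linear equation ∂_X V = wV with V(0) = 1. This gives existence and
uniqueness of the expansion (`isExpansionOfVHat_iff`). It also gives ∂ₓV = ZV with Z = ζ(x - X) -
ζ(x) + ζ(X) - 1/X.

The heart of the proof is the family of intertwining relations P̃_{n+2} V₀ = V₀ U_{n+2}
(`tildeP_mul_ofSeries`). By evenness of ℘, the symbol of U_{n+2} is (-1)ⁿ ℘⁽ⁿ⁾(X)/(n+1)!. The
addition theorem for ζ, proved here on formal series (`addition_series`), yields Lamé's equation ψ''
- 2℘(x)ψ = ℘(X)ψ and the first-order relation ℘(x)ψ' - ½℘'(x)ψ = ℘(X)ψ' + ½℘'(X)ψ. These are the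
cases of P₂ and Q₁. The recursion for (Pₙ, Qₙ) then gives P_{2m+2} V₀ = V₀ U₂^{m+1} and P_{2m+3} V₀
= V₀ U₂^m U₃ (`lamePQ_mul`). Finally ℘⁽²ᵐ⁾ = R_m(℘) and its derivative ℘⁽²ᵐ⁺¹⁾ = R_m'(℘)℘' express
U_{n+2} through these products. On operators, differentiation in X is the commutator with x, so
these identities follow from the differential equation of ℘ (`aeval_polyR`).

Given the intertwining, V₀U_{n+2}V₀⁻¹ = P̃_{n+2} is a differential operator. It differs from
L₀^{n+2} = V₀∂^{n+2}V₀⁻¹ by an operator of order at most zero with leading coefficient aₙ/(n+1),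
which determines the nonnegative part. It commutes with L₀ because U_{n+2} commutes with ∂
(`stationary_of_series`). -/

theorem coeff_sub (P Q : PseudoDiffOp D) (n : ℤ) :
    (P - Q).coeff n = P.coeff n - Q.coeff n := by
  rw [sub_eq_add_neg, coeff_add, coeff_neg, sub_eq_add_neg]

theorem coeff_mulBy_mul (a : A) (P : PseudoDiffOp D) (n : ℤ) :
    (mulBy D a * P).coeff n = a * P.coeff n := by
  rw [coeff_mul, finsum_eq_single _ ((0, 0) : ℤ × ℕ)]
  · simp [mulBy, coeff_monomial]
  · rintro ⟨i, r⟩ h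
    by_cases hi : i = 0
    · subst hi
      have hr : r ≠ 0 := by rintro rfl; exact h rfl
      obtain ⟨r, rfl⟩ := Nat.exists_eq_succ_of_ne_zero hr
      simp only [Nat.succ_eq_add_one, Ring.choose_zero_succ, zero_smul]
    · simp [mulBy, coeff_monomial, hi]

theorem del_mul (P : PseudoDiffOp D) : del D * P = P * del D + P.coeffDeriv := by
  refine ext_coeff fun n => ?_
  have h1 : (P * del D).coeff n = P.coeff (n - 1) := by
    rw [coeff_mul, finsum_eq_single _ ((n - 1, 0) : ℤ × ℕ)]
    · simp [del, coeff_monomial]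
    · rintro ⟨i, r⟩ h
      by_cases hr : r = 0
      · subst hr
        have hi : ¬ n - i = 1 := fun h0 => h (by rw [← h0]; simp)
        simp [del, coeff_monomial, hi]
      · simp only [del, coeff_monomial]
        split_ifs
        · rw [iterate_one D hr, mul_zero, smul_zero]
        · rw [iterate_map_zero, mul_zero, smul_zero]
  rw [coeff_add, h1, coeff_mul, finsum_eq_sum_of_support_subset (s := {(1, 0), (1, 1)})]
  · rw [Finset.sum_pair (by simp)]
    simp [del, coeff_monomial, coeffDeriv]
  · rintro ⟨i, r⟩ h
    simp only [Function.mem_support] at h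
    have hi : i = 1 := by
      by_contra hi
      simp [del, coeff_monomial, hi] at h
    subst hi
    have hr : r ≤ 1 := by
      by_contra hr
      have : Ring.choose (1 : ℤ) r = 0 := by
        have := Ring.choose_natCast (R := ℤ) 1 r
        rw [Nat.choose_eq_zero_of_lt (by omega)] at this
        simpa using this
      simp [this] at h
    interval_cases r <;> simp

/-- The operator `∑ s_n ∂⁻ⁿ` attached to a power series. -/
def ofSeries (D : Derivation k A A) (s : A⟦X⟧) : PseudoDiffOp D :=
  ofSymbol D fun n => PowerSeries.coeff n s

theorem coeff_ofSeries_of_pos (s : A⟦X⟧) {n : ℤ} (hn : 0 < n) : (ofSeries D s).coeff n = 0 :=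
  if_neg (not_le.mpr hn)

/-- The index is written `0 - d` because this is the shape `coeff_mul_depth` produces for order
bound 0. -/
theorem coeff_ofSeries_neg (s : A⟦X⟧) (d : ℕ) :
    (ofSeries D s).coeff (0 - d) = PowerSeries.coeff d s := by
  simp [ofSeries, ofSymbol]

theorem coeff_ofSeries_zero (s : A⟦X⟧) : (ofSeries D s).coeff 0 = constantCoeff s := by
  simp [ofSeries, ofSymbol]

theorem eq_ofSeries {P : PseudoDiffOp D} {s : A⟦X⟧} (hP : ∀ n, 0 < n → P.coeff n = 0)
    (h : ∀ d : ℕ, P.coeff (0 - d) = PowerSeries.coeff d s) : P = ofSeries D s :=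
  coeff_eq_of_bounded hP (fun _ hn => coeff_ofSeries_of_pos s hn)
    fun d => by rw [h, coeff_ofSeries_neg]

theorem ofSeries_add (s t : A⟦X⟧) : ofSeries D (s + t) = ofSeries D s + ofSeries D t := by
  refine (eq_ofSeries (fun n hn => ?_) fun d => ?_).symm
  · rw [coeff_add, coeff_ofSeries_of_pos _ hn, coeff_ofSeries_of_pos _ hn, add_zero]
  · rw [coeff_add, coeff_ofSeries_neg, coeff_ofSeries_neg, map_add]

theorem ofSeries_sub (s t : A⟦X⟧) : ofSeries D (s - t) = ofSeries D s - ofSeries D t := by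
  rw [eq_sub_iff_add_eq, ← ofSeries_add, sub_add_cancel]

theorem ofSeries_C (a : A) : ofSeries D (C a) = mulBy D a := by
  refine (eq_ofSeries (fun n hn => if_neg hn.ne') fun d => ?_).symm
  simp [mulBy, coeff_monomial, coeff_C]

theorem ofSeries_one : ofSeries D (1 : A⟦X⟧) = 1 := by
  rw [← map_one (C (R := A)), ofSeries_C]; rfl

/-- The product of two operators of order at most zero, as an operation on power series. -/
def seriesMul (D : Derivation k A A) (s t : A⟦X⟧) : A⟦X⟧ := PowerSeries.mk fun d =>
  ∑ x ∈ Finset.HasAntidiagonal.antidiagonal d, ∑ y ∈ Finset.HasAntidiagonal.antidiagonal x.2,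
    Ring.choose (0 - x.1 : ℤ) y.2 • (PowerSeries.coeff x.1 s * D^[y.2] (PowerSeries.coeff y.1 t))

theorem ofSeries_mul_ofSeries (s t : A⟦X⟧) :
    ofSeries D s * ofSeries D t = ofSeries D (seriesMul D s t) := by
  have hs := fun n (hn : (0 : ℤ) < n) => coeff_ofSeries_of_pos (D := D) s hn
  have ht := fun n (hn : (0 : ℤ) < n) => coeff_ofSeries_of_pos (D := D) t hn
  refine eq_ofSeries (fun n hn => coeff_mul_of_lt _ _ hs ht n (by omega)) fun d => ?_
  have := coeff_mul_depth _ _ hs ht d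
  rw [add_zero] at this
  simp only [this, coeff_ofSeries_neg, seriesMul, coeff_mk]

theorem constantCoeff_seriesMul (s t : A⟦X⟧) :
    constantCoeff (seriesMul D s t) = constantCoeff s * constantCoeff t := by
  rw [← coeff_zero_eq_constantCoeff_apply, seriesMul, coeff_mk]
  simp

/-- Every Leibniz term with r > 0 differentiates a constant, so only the Cauchy product remains. -/
theorem ofSeries_mul_of_const (s : A⟦X⟧) {t : A⟦X⟧} (ht : ∀ n, D (PowerSeries.coeff n t) = 0) :
    ofSeries D s * ofSeries D t = ofSeries D (s * t) := by
  rw [ofSeries_mul_ofSeries]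
  congr 1
  ext d
  rw [seriesMul, coeff_mk, PowerSeries.coeff_mul]
  refine Finset.sum_congr rfl fun x _ => ?_
  rw [Finset.sum_eq_single (x.2, 0)]
  · simp
  · rintro ⟨i, r⟩ h1 h2
    obtain rfl | hr := r.eq_zero_or_pos
    · simp at h1; subst h1; exact absurd rfl h2
    · obtain ⟨r, rfl⟩ := Nat.exists_eq_succ_of_ne_zero hr.ne'
      simp only [Function.iterate_succ_apply, ht]
      rw [iterate_map_zero, mul_zero, smul_zero]
  · simp

theorem mulBy_mul_ofSeries (a : A) (s : A⟦X⟧) :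
    mulBy D a * ofSeries D s = ofSeries D (C a * s) := by
  refine eq_ofSeries (fun n hn => ?_) fun d => ?_
  · rw [coeff_mulBy_mul, coeff_ofSeries_of_pos _ hn, mul_zero]
  · rw [coeff_mulBy_mul, coeff_ofSeries_neg, coeff_C_mul]

/-- Coefficientwise derivative of a power series. -/
def mapSeries (D : Derivation k A A) (s : A⟦X⟧) : A⟦X⟧ :=
  PowerSeries.mk fun n => D (PowerSeries.coeff n s)

theorem coeffDeriv_ofSeries (s : A⟦X⟧) :
    (ofSeries D s).coeffDeriv = ofSeries D (mapSeries D s) := by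
  refine eq_ofSeries (fun n hn => ?_) fun d => ?_
  · simp [coeffDeriv, coeff_ofSeries_of_pos _ hn]
  · simp only [coeffDeriv, coeff_ofSeries_neg, mapSeries, coeff_mk]

theorem del_mul_ofSeries (s : A⟦X⟧) :
    del D * ofSeries D s = ofSeries D s * del D + ofSeries D (mapSeries D s) := by
  rw [del_mul, coeffDeriv_ofSeries]

theorem mapSeries_of_const {t : A⟦X⟧} (ht : ∀ n, D (PowerSeries.coeff n t) = 0) :
    mapSeries D t = 0 := by
  ext n; simp [mapSeries, ht]

theorem del_mul_of_const {t : A⟦X⟧} (ht : ∀ n, D (PowerSeries.coeff n t) = 0) :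
    del D * ofSeries D t = ofSeries D t * del D := by
  rw [del_mul_ofSeries, mapSeries_of_const ht, ← sub_self (0 : A⟦X⟧), ofSeries_sub, sub_self,
    add_zero]

theorem deriv_coeff_X (n : ℕ) : D (PowerSeries.coeff n (X : A⟦X⟧)) = 0 := by
  rw [coeff_X]; split_ifs <;> simp

theorem ofSeries_X_eq : ofSeries D (X : A⟦X⟧) = monomial D 1 (-1) := by
  refine (eq_ofSeries (fun n hn => if_neg (by omega)) fun d => ?_).symm
  rw [coeff_monomial, coeff_X]
  exact if_congr (by omega) rfl rfl

theorem ofSeries_X_mul_del : ofSeries D (X : A⟦X⟧) * del D = 1 := by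
  refine ext_coeff fun n => ?_
  rw [ofSeries_X_eq, coeff_mul, finsum_eq_single _ ((-1, 0) : ℤ × ℕ)]
  · simp only [coeff_monomial, coeff_one, del]
    simp [show n + 1 = 1 ↔ n = 0 by omega]
  · rintro ⟨i, r⟩ h
    by_cases hi : i = -1
    · subst hi
      have hr : r ≠ 0 := by rintro rfl; exact h rfl
      simp only [coeff_monomial, del, if_true]
      split_ifs
      · rw [iterate_one D hr, mul_zero, smul_zero]
      · rw [iterate_map_zero, mul_zero, smul_zero]
    · simp [coeff_monomial, hi]

theorem ofSeries_mul_X (s : A⟦X⟧) : ofSeries D (s * X) * del D = ofSeries D s := by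
  rw [← ofSeries_mul_of_const s deriv_coeff_X, mul_assoc, ofSeries_X_mul_del, mul_one]

theorem ofSeries_mul_X_pow (s : A⟦X⟧) (n : ℕ) :
    ofSeries D (s * X ^ n) * del D ^ n = ofSeries D s := by
  induction n with
  | zero => simp
  | succ n ih => rw [pow_succ X, ← mul_assoc, pow_succ', ← mul_assoc, ofSeries_mul_X, ih]

/-- Course-of-values recursion: Φ n receives a whole sequence but reads only its entries up to n. -/
theorem exists_causal {B : Type*} (a : B) (Φ : ℕ → (ℕ → B) → B)
    (hΦ : ∀ n s t, (∀ i ≤ n, s i = t i) → Φ n s = Φ n t) :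
    ∃ t : ℕ → B, t 0 = a ∧ ∀ n, t (n + 1) = Φ n t := by
  -- T n is correct up to index n; the diagonal is the required sequence.
  let T : ℕ → ℕ → B := fun n => Nat.rec (fun _ => a)
    (fun n s => Function.update s (n + 1) (Φ n s)) n
  have hT : ∀ n, T (n + 1) = Function.update (T n) (n + 1) (Φ n (T n)) := fun _ => rfl
  have h : ∀ n i, i ≤ n → T n i = T i i := by
    intro n
    induction n with
    | zero => intro i hi; obtain rfl : i = 0 := by omega
              rfl
    | succ n ih =>
      intro i hi
      obtain rfl | hi := hi.eq_or_lt
      · rfl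
      · rw [hT, Function.update_of_ne (by omega), ih i (by omega)]
  refine ⟨fun n => T n n, rfl, fun n => ?_⟩
  simp only [hT, Function.update_self]
  exact hΦ n _ _ (h n)

/-- As the leading coefficient of s is 1, the equation in degree d + 1 reads t_{d+1} + (terms in
t_0, …, t_d) = 0 and is solved recursively. -/
theorem exists_seriesMul_eq_one {s : A⟦X⟧} (hs : constantCoeff s = 1) :
    ∃ t : A⟦X⟧, constantCoeff t = 1 ∧ seriesMul D s t = 1 := by
  obtain ⟨t, h0, h⟩ := exists_causal (1 : A) (fun d t =>
    -∑ x ∈ Finset.HasAntidiagonal.antidiagonal d, ∑ y ∈ Finset.HasAntidiagonal.antidiagonal x.2,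
      Ring.choose (0 - (x.1 + 1 : ℕ) : ℤ) y.2 • (PowerSeries.coeff (x.1 + 1) s * D^[y.2] (t y.1)))
    (fun n t t' htt => by
      congr 1
      refine Finset.sum_congr rfl fun x hx => Finset.sum_congr rfl fun y hy => ?_
      rw [Finset.HasAntidiagonal.mem_antidiagonal] at hx hy
      rw [htt _ (by omega)])
  refine ⟨PowerSeries.mk t, by rw [← coeff_zero_eq_constantCoeff_apply, coeff_mk, h0], ?_⟩
  ext d
  rw [seriesMul, coeff_mk]
  cases d with
  | zero => simp [h0, hs]
  | succ d =>
    -- The split-off terms carry s₀ and the binomials of 0 over r, so only r = 0 survives and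
    -- contributes t_{d+1}.
    rw [Finset.Nat.antidiagonal_succ, Finset.sum_cons, Finset.sum_map,
      Finset.sum_eq_single (d + 1, 0)]
    · simp [hs, h]
    · rintro ⟨i, r⟩ h1 h2
      obtain rfl | hr := r.eq_zero_or_pos
      · simp at h1; subst h1; exact absurd rfl h2
      · obtain ⟨r, rfl⟩ := Nat.exists_eq_succ_of_ne_zero hr.ne'
        simp [Ring.choose_zero_succ]
    · simp

theorem exists_ofSeries_inverse {s : A⟦X⟧} (hs : constantCoeff s = 1) :
    ∃ t : A⟦X⟧, constantCoeff t = 1 ∧ ofSeries D s * ofSeries D t = 1 ∧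
      ofSeries D t * ofSeries D s = 1 := by
  obtain ⟨t, ht, hst⟩ := exists_seriesMul_eq_one (D := D) hs
  obtain ⟨r, hr, htr⟩ := exists_seriesMul_eq_one (D := D) ht
  have h1 : ofSeries D s * ofSeries D t = 1 := by rw [ofSeries_mul_ofSeries, hst, ofSeries_one]
  have h2 : ofSeries D t * ofSeries D r = 1 := by rw [ofSeries_mul_ofSeries, htr, ofSeries_one]
  -- The right inverse t has a right inverse r of its own, and associativity forces r to coincide
  -- with s as an operator.
  exact ⟨t, ht, h1, by rwa [left_inv_eq_right_inv h1 h2]⟩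

/-- `P` has no terms of negative degree. -/
def IsDifferential (P : PseudoDiffOp D) : Prop := ∀ n < 0, P.coeff n = 0

theorem IsDifferential.nonnegPart {P : PseudoDiffOp D} (h : P.IsDifferential) :
    P.nonnegPart = P := by
  refine ext_coeff fun n => ?_
  simp only [PseudoDiffOp.nonnegPart]
  split_ifs with hn
  · rfl
  · rw [h n (not_le.mp hn)]

theorem nonnegPart_sub (P Q : PseudoDiffOp D) :
    (P - Q).nonnegPart = P.nonnegPart - Q.nonnegPart := by
  refine ext_coeff fun n => ?_
  simp only [nonnegPart, coeff_sub]
  split_ifs <;> simp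

theorem nonnegPart_ofSeries (s : A⟦X⟧) :
    (ofSeries D s).nonnegPart = mulBy D (constantCoeff s) := by
  refine ext_coeff fun n => ?_
  simp only [nonnegPart, mulBy, coeff_monomial]
  obtain hn | rfl | hn := lt_trichotomy n 0
  · rw [if_neg (by omega), if_neg (by omega)]
  · rw [if_pos le_rfl, if_pos rfl, coeff_ofSeries_zero]
  · rw [if_pos hn.le, if_neg (by omega), coeff_ofSeries_of_pos _ hn]

namespace IsDifferential

variable {P Q : PseudoDiffOp D}

theorem add (hP : P.IsDifferential) (hQ : Q.IsDifferential) : (P + Q).IsDifferential :=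
  fun n hn => by rw [coeff_add, hP n hn, hQ n hn, add_zero]

theorem sub (hP : P.IsDifferential) (hQ : Q.IsDifferential) : (P - Q).IsDifferential :=
  fun n hn => by rw [coeff_sub, hP n hn, hQ n hn, sub_zero]

theorem mul (hP : P.IsDifferential) (hQ : Q.IsDifferential) : (P * Q).IsDifferential := by
  intro n hn
  rw [coeff_mul]
  refine finsum_eq_zero_of_forall_eq_zero ?_
  rintro ⟨i, r⟩
  by_cases hi : i < 0
  · rw [hP i hi, zero_mul, smul_zero]
  by_cases hj : n - i + r < 0
  · simp only
    rw [hQ _ hj, iterate_map_zero, mul_zero, smul_zero]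
  · lift i to ℕ using by omega
    -- With n < 0 and n - i + r ≥ 0 one has r > i ≥ 0.
    have : Ring.choose (i : ℤ) r = 0 := by
      rw [Ring.choose_natCast, Nat.choose_eq_zero_of_lt (by omega), Nat.cast_zero]
    simp [this]

theorem coeffDeriv (hP : P.IsDifferential) : P.coeffDeriv.IsDifferential :=
  fun n hn => by simp [PseudoDiffOp.coeffDeriv, hP n hn]

theorem sum {ι : Type*} {s : Finset ι} {f : ι → PseudoDiffOp D}
    (h : ∀ i ∈ s, (f i).IsDifferential) : (∑ i ∈ s, f i).IsDifferential := by
  classical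
  induction s using Finset.induction_on with
  | empty => exact fun _ _ => rfl
  | insert i s hi ih =>
    rw [Finset.sum_insert hi]
    exact (h _ (by simp)).add (ih fun j hj => h j (by simp [hj]))

theorem mulBy (a : A) : (mulBy D a).IsDifferential := fun _ hn => if_neg hn.ne

theorem del : (del D).IsDifferential := fun _ hn => if_neg (by omega)

end IsDifferential

/-- Commutation with multiplication by `x`, where `D x = 1`, on operators with constant
coefficients. -/
theorem ofSeries_mul_mulBy {x : A} (hx : D x = 1) (s : A⟦X⟧) :
    ofSeries D s * mulBy D x =
      mulBy D x * ofSeries D s - ofSeries D (X ^ 2 * derivative A s) := by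
  rw [← ofSeries_C, ofSeries_mul_ofSeries, ofSeries_C, mulBy_mul_ofSeries, ← ofSeries_sub]
  congr 1
  ext d
  have key : ∀ y : ℕ × ℕ, y ≠ (0, 0) → y ≠ (0, 1) → D^[y.2] (PowerSeries.coeff y.1 (C x)) = 0 := by
    rintro ⟨i, r⟩ h0 h1
    rw [coeff_C]
    split_ifs with hi
    · obtain _ | _ | r := r
      · simp_all
      · simp_all
      · simp only [Function.iterate_succ_apply, hx]
        rw [Derivation.map_one_eq_zero, iterate_map_zero]
    · rw [iterate_map_zero]
  rw [seriesMul, coeff_mk, map_sub, coeff_C_mul]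
  cases d with
  | zero => simp [mul_comm]
  | succ d =>
    have hz : ∀ z : ℕ × ℕ, z ≠ (d + 1, 0) → z ≠ (d, 1) →
        z ∈ Finset.HasAntidiagonal.antidiagonal (d + 1) →
        ∑ y ∈ Finset.HasAntidiagonal.antidiagonal z.2,
          Ring.choose (0 - z.1 : ℤ) y.2 • (PowerSeries.coeff z.1 s *
            D^[y.2] (PowerSeries.coeff y.1 (C x))) = 0 := by
      rintro ⟨i, j⟩ h0 h1 hz
      refine Finset.sum_eq_zero fun y hy => ?_
      simp only [Finset.HasAntidiagonal.mem_antidiagonal, ne_eq, Prod.mk.injEq] at *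
      rw [key y, mul_zero, smul_zero]
      · rintro rfl; apply h0; simp at hy; omega
      · rintro rfl; apply h1; simp at hy; omega
    -- Since Dx = 1 and D²x = 0, only r = 0 and r = 1 contribute: the first gives x s_{d+1}, the
    -- second gives -d s_d, which is the derivative term.
    rw [← Finset.sum_subset (s₁ := {(d + 1, 0), (d, 1)}), Finset.sum_pair (by simp)]
    · have h1 : Finset.HasAntidiagonal.antidiagonal 1 = {(0, 1), (1, 0)} := rfl
      rw [h1, Finset.sum_pair (by simp), key (1, 0) (by simp) (by simp)]
      cases d with
      | zero => simp [coeff_X_pow_mul', mul_comm]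
      | succ d =>
        rw [coeff_X_pow_mul', if_pos (by omega)]
        simp [hx, coeff_derivative, mul_comm, sub_eq_add_neg]
        ring
    · intro z; simp only [Finset.mem_insert, Finset.mem_singleton]
      rintro (rfl | rfl) <;> simp
    · intro z h1 h2
      simp only [Finset.mem_insert, Finset.mem_singleton, not_or] at h2
      exact hz z h2.1 h2.2 h1

end PseudoDiffOp

end

/-! ### Calculus on power series with two commuting derivations, ∂_X and D -/

noncomputable section

namespace PseudoDiffOp

open PowerSeries

theorem isUnit_of_constantCoeff_eq_neg_one {A : Type*} [CommRing A] {B : A⟦X⟧}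
    (hB : constantCoeff B = -1) : IsUnit B := by
  rw [PowerSeries.isUnit_iff_constantCoeff, hB]
  exact isUnit_one.neg

theorem derivative_ofNat {A : Type*} [CommRing A] (n : ℕ) [n.AtLeastTwo] :
    derivative A (OfNat.ofNat n : A⟦X⟧) = 0 := by
  rw [← Nat.cast_ofNat, Derivation.map_natCast]

section mapSeries

variable {k A : Type*} [CommRing k] [CommRing A] [Algebra k A] (D : Derivation k A A)

theorem coeff_mapSeries (s : A⟦X⟧) (n : ℕ) :
    PowerSeries.coeff n (mapSeries D s) = D (PowerSeries.coeff n s) := coeff_mk _ _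

theorem mapSeries_add (s t : A⟦X⟧) : mapSeries D (s + t) = mapSeries D s + mapSeries D t := by
  ext n; simp [coeff_mapSeries]

theorem mapSeries_sub (s t : A⟦X⟧) : mapSeries D (s - t) = mapSeries D s - mapSeries D t := by
  ext n; simp [coeff_mapSeries]

theorem mapSeries_neg (s : A⟦X⟧) : mapSeries D (-s) = -mapSeries D s := by
  ext n; simp [coeff_mapSeries]

theorem mapSeries_C (a : A) : mapSeries D (C a) = C (D a) := by
  ext n; rw [coeff_mapSeries, coeff_C, coeff_C]; split_ifs <;> simp

theorem mapSeries_mul (s t : A⟦X⟧) :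
    mapSeries D (s * t) = mapSeries D s * t + s * mapSeries D t := by
  ext n
  simp only [coeff_mapSeries, map_add, PowerSeries.coeff_mul, map_sum, Derivation.leibniz,
    smul_eq_mul, ← Finset.sum_add_distrib]
  exact Finset.sum_congr rfl fun _ _ => by ring

theorem mapSeries_X : mapSeries D (X : A⟦X⟧) = 0 := mapSeries_of_const deriv_coeff_X

theorem deriv_coeff_map (s : k⟦X⟧) (n : ℕ) :
    D (PowerSeries.coeff n (map (algebraMap k A) s)) = 0 := by
  rw [coeff_map, Derivation.map_algebraMap]

theorem mapSeries_map (s : k⟦X⟧) : mapSeries D (map (algebraMap k A) s) = 0 :=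
  mapSeries_of_const (deriv_coeff_map D s)

theorem mapSeries_derivative (s : A⟦X⟧) :
    mapSeries D (derivative A s) = derivative A (mapSeries D s) := by
  ext n
  rw [coeff_mapSeries, coeff_derivative, coeff_derivative, coeff_mapSeries, Derivation.leibniz]
  have : D ((n : A) + 1) = 0 := by
    rw [map_add, Derivation.map_natCast, Derivation.map_one_eq_zero, add_zero]
  rw [this, smul_zero, zero_add, smul_eq_mul, mul_comm]

theorem derivative_map (s : k⟦X⟧) :
    derivative A (map (algebraMap k A) s) = map (algebraMap k A) (derivative k s) := by
  ext n; simp [coeff_derivative]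

end mapSeries

variable {A : Type*} [CommRing A] [Algebra ℂ A] (D : Derivation ℂ A A)

theorem natCast_add_one_mul_cancel {a : A} (n : ℕ) (h : ((n : A) + 1) * a = 0) : a = 0 := by
  have h1 : ((n : ℂ) + 1) • a = 0 := by
    rw [Algebra.smul_def, map_add, map_natCast, map_one, h]
  have h2 : ((n : ℂ) + 1) ≠ 0 := Nat.cast_add_one_ne_zero n
  rw [← one_smul ℂ a, ← inv_mul_cancel₀ h2, mul_smul, h1, smul_zero]

/-- Uniqueness for a linear first-order equation: (n+1)Y_{n+1} is a combination of earlier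
coefficients, and n + 1 is invertible over ℂ. -/
theorem eq_zero_of_derivative_eq_mul {w Y : A⟦X⟧} (h : derivative A Y = w * Y)
    (h0 : constantCoeff Y = 0) : Y = 0 := by
  ext n
  rw [map_zero]
  induction n using Nat.strong_induction_on with
  | _ n ih =>
    cases n with
    | zero => simpa using h0
    | succ n =>
      have := congrArg (PowerSeries.coeff n) h
      rw [coeff_derivative, PowerSeries.coeff_mul, Finset.sum_eq_zero, mul_comm] at this
      · exact natCast_add_one_mul_cancel n this
      · intro x hx
        rw [Finset.HasAntidiagonal.mem_antidiagonal] at hx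
        rw [ih x.2 (by omega), mul_zero]

theorem exists_derivative_eq_mul (w : A⟦X⟧) :
    ∃ V : A⟦X⟧, derivative A V = w * V ∧ constantCoeff V = 1 := by
  obtain ⟨t, h0, h⟩ := exists_causal (1 : A) (fun n t => ((n : ℂ) + 1)⁻¹ •
    ∑ x ∈ Finset.HasAntidiagonal.antidiagonal n, PowerSeries.coeff x.1 w * t x.2)
    (fun n t t' htt => by
      congr 1
      refine Finset.sum_congr rfl fun x hx => ?_
      rw [Finset.HasAntidiagonal.mem_antidiagonal] at hx
      rw [htt _ (by omega)])
  refine ⟨PowerSeries.mk t, ?_, by rw [← coeff_zero_eq_constantCoeff_apply, coeff_mk, h0]⟩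
  ext n
  have h2 : ((n : ℂ) + 1) ≠ 0 := Nat.cast_add_one_ne_zero n
  have h3 : ((n : A) + 1) = algebraMap ℂ A (n + 1) := by simp
  rw [coeff_derivative, coeff_mk, h, PowerSeries.coeff_mul, h3, mul_comm, ← Algebra.smul_def,
    smul_smul, mul_inv_cancel₀ h2, one_smul]
  simp only [coeff_mk]

/-- The Taylor series `f(x - X) = ∑ (-1)ⁿ f⁽ⁿ⁾ Xⁿ / n!`. -/
def shiftSeries (f : A) : A⟦X⟧ :=
  PowerSeries.mk fun n => ((-1) ^ n / (n.factorial : ℂ)) • D^[n] f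

theorem mapSeries_shiftSeries (f : A) : mapSeries D (shiftSeries D f) = shiftSeries D (D f) := by
  ext n
  rw [coeff_mapSeries, shiftSeries, shiftSeries, coeff_mk, coeff_mk, Derivation.map_smul,
    ← Function.iterate_succ_apply' D, Function.iterate_succ_apply]

theorem derivative_shiftSeries (f : A) :
    derivative A (shiftSeries D f) = -shiftSeries D (D f) := by
  ext n
  have h3 : ((n : A) + 1) = algebraMap ℂ A (n + 1) := by simp
  rw [coeff_derivative, map_neg, shiftSeries, shiftSeries, coeff_mk, coeff_mk, h3, mul_comm,
    ← Algebra.smul_def, smul_smul, ← neg_smul, Function.iterate_succ_apply]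
  congr 1
  have h2 : ((n : ℂ) + 1) ≠ 0 := Nat.cast_add_one_ne_zero n
  have h4 : (n.factorial : ℂ) ≠ 0 := by exact_mod_cast n.factorial_ne_zero
  rw [Nat.factorial_succ]
  push_cast
  field_simp
  ring

theorem shiftSeries_neg (f : A) : shiftSeries D (-f) = -shiftSeries D f := by
  ext n
  rw [map_neg, shiftSeries, shiftSeries, coeff_mk, coeff_mk, ← smul_neg]
  congr 1
  rw [← neg_one_zsmul, iterate_zsmul, neg_one_zsmul]

theorem constantCoeff_shiftSeries (f : A) : constantCoeff (shiftSeries D f) = f := by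
  rw [← coeff_zero_eq_constantCoeff_apply, shiftSeries, coeff_mk]; simp

/-- Comparing coefficients of Xⁿ isolates -(n+1)Fₙ; every other term involves an earlier coefficient
of F or its D-derivative. In the addition theorem, F is the defect of the identity, cleared of its
poles. -/
theorem eq_zero_of_mul_eq_X_mul {B T F : A⟦X⟧} (hB : constantCoeff B = -1)
    (h : B * (X * (derivative A F + mapSeries D F) + F) = X * T * F) : F = 0 := by
  ext n
  rw [map_zero]
  induction n using Nat.strong_induction_on with
  | _ n ih =>
    have hY : ∀ m, PowerSeries.coeff m (X * (derivative A F + mapSeries D F) + F) =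
        (m + 1) * PowerSeries.coeff m F + if m = 0 then 0 else D (PowerSeries.coeff (m - 1) F) := by
      intro m
      cases m with
      | zero => simp
      | succ m =>
        rw [map_add, coeff_succ_X_mul, map_add, coeff_derivative, coeff_mapSeries]
        simp
        ring
    have hn := congrArg (PowerSeries.coeff n) h
    rw [PowerSeries.coeff_mul, PowerSeries.coeff_mul] at hn
    rw [Finset.sum_eq_single (0, n)] at hn
    · rw [Finset.sum_eq_zero, hY, coeff_zero_eq_constantCoeff_apply, hB] at hn
      · have h0 : (if n = 0 then 0 else D (PowerSeries.coeff (n - 1) F)) = 0 := by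
          split_ifs with h0
          · rfl
          · rw [ih _ (by omega), map_zero]
        rw [h0, add_zero, neg_one_mul, neg_eq_zero] at hn
        exact natCast_add_one_mul_cancel n hn
      · rintro ⟨i, j⟩ hx
        rw [Finset.HasAntidiagonal.mem_antidiagonal] at hx
        cases i with
        | zero => simp
        | succ i => simp only at hx ⊢; rw [ih j (by omega), mul_zero]
    · rintro ⟨i, j⟩ hx hne
      rw [Finset.HasAntidiagonal.mem_antidiagonal] at hx
      have hj : j < n := by
        by_contra hj
        exact hne (by simp only [Prod.mk.injEq]; omega)
      simp only
      rw [hY, ih j hj, mul_zero, zero_add]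
      split_ifs
      · rw [mul_zero]
      · rw [ih _ (by omega), map_zero, mul_zero]
    · simp

/-- Formal second order equation of `℘` at its pole from the first order one. -/
theorem second_order_of_first_order {e : ℂ⟦X⟧} {a b : ℂ}
    (h : (-2 + X ^ 3 * derivative ℂ e) ^ 2 = 4 * (1 + X ^ 2 * e) ^ 3 -
      C a * X ^ 4 * (1 + X ^ 2 * e) - C b * X ^ 6) :
    X ^ 4 * derivative ℂ (derivative ℂ e) = 6 * (1 + X ^ 2 * e) ^ 2 - 6 - C (a / 2) * X ^ 4 := by
  have hQ : (-2 + X ^ 3 * derivative ℂ e) ≠ 0 := fun h0 => by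
    have := congrArg (constantCoeff (R := ℂ)) h0
    rw [map_add, map_neg, map_ofNat, map_mul, map_pow, constantCoeff_X, map_zero] at this
    norm_num at this
  have hC : C a = 2 * C (a / 2) := by
    rw [show (2 : ℂ⟦X⟧) = C 2 from (map_ofNat C 2).symm, ← map_mul]; congr 1; ring
  have hd := congrArg (derivative ℂ) h
  have h2 : (2 : ℂ⟦X⟧) ≠ 0 := fun h0 => by
    have := congrArg (constantCoeff (R := ℂ)) h0
    rw [map_ofNat, map_zero] at this
    norm_num at this
  -- Differentiating the first-order equation produces the claim times 2X³℘'(X), a nonzero factor in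
  -- a domain.
  refine mul_left_cancel₀ (mul_ne_zero h2 hQ) ?_
  simp only [Derivation.leibniz, Derivation.leibniz_pow, map_add, map_sub, map_neg, derivative_C,
    derivative_X, smul_eq_mul, nsmul_eq_mul, Derivation.map_one_eq_zero] at hd
  push_cast at hd
  have d2 : derivative ℂ (2 : ℂ⟦X⟧) = 0 := derivative_ofNat 2
  have d4 : derivative ℂ (4 : ℂ⟦X⟧) = 0 := derivative_ofNat 4
  rw [hC] at hd h
  rw [d2, d4] at hd
  linear_combination X * hd - 6 * h

/-! ### The addition theorem for ζ and Lamé's equation as power series identities -/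

section Lame

variable {p z x : A} {ζ₀ : ℂ⟦X⟧} {a b : ℂ}

/-- The expansion of `ζ(x - X) - ζ(x) + ζ(X) - 1/X`. -/
def zetaSeries (z : A) (ζ₀ : ℂ⟦X⟧) : A⟦X⟧ :=
  shiftSeries D z - C z + map (algebraMap ℂ A) ζ₀

theorem constantCoeff_zetaSeries (hζ : constantCoeff ζ₀ = 0) :
    constantCoeff (zetaSeries D z ζ₀) = 0 := by
  rw [zetaSeries, map_add, map_sub, constantCoeff_shiftSeries, constantCoeff_C, sub_self, zero_add,
    ← coeff_zero_eq_constantCoeff_apply, coeff_map, coeff_zero_eq_constantCoeff_apply, hζ, map_zero]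

theorem derivative_zetaSeries (hz : D z = -p) : derivative A (zetaSeries D z ζ₀) =
    shiftSeries D p + map (algebraMap ℂ A) (derivative ℂ ζ₀) := by
  rw [zetaSeries, map_add, map_sub, derivative_shiftSeries, hz, shiftSeries_neg, neg_neg,
    derivative_C, sub_zero, derivative_map]

theorem mapSeries_zetaSeries (hz : D z = -p) : mapSeries D (zetaSeries D z ζ₀) =
    C p - shiftSeries D p := by
  rw [zetaSeries, mapSeries_add, mapSeries_sub, mapSeries_shiftSeries, hz, mapSeries_map,
    mapSeries_C, hz, shiftSeries_neg, map_neg]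
  ring

/-- The logarithmic `X`-derivative of `σ(x - X) / σ(x) * exp ((ζ(X) - 1/X) x)`. -/
def logDerivSeries (z x : A) (ζ₀ : ℂ⟦X⟧) : A⟦X⟧ :=
  -shiftSeries D z + C x * map (algebraMap ℂ A) (derivative ℂ ζ₀)

/-- Since ∂_X and D commute and Dw = ∂_X Z, the difference Y = DV - ZV satisfies ∂_X Y = wY. It has
zero constant term, hence vanishes. -/
theorem mapSeries_of_derivative_eq (hz : D z = -p) (hx : D x = 1) (hζ : constantCoeff ζ₀ = 0)
    {V : A⟦X⟧} (hV : derivative A V = logDerivSeries D z x ζ₀ * V) (hV0 : constantCoeff V = 1) :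
    mapSeries D V = zetaSeries D z ζ₀ * V := by
  rw [← sub_eq_zero]
  have hw : mapSeries D (logDerivSeries D z x ζ₀) = derivative A (zetaSeries D z ζ₀) := by
    rw [derivative_zetaSeries D hz, logDerivSeries, mapSeries_add, mapSeries_neg,
      mapSeries_shiftSeries, hz, shiftSeries_neg, mapSeries_mul, mapSeries_C, hx, mapSeries_map,
      map_one]
    ring
  refine eq_zero_of_derivative_eq_mul (w := logDerivSeries D z x ζ₀) ?_ ?_
  · rw [map_sub, ← mapSeries_derivative, hV, mapSeries_mul, hw, Derivation.leibniz, hV]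
    simp only [smul_eq_mul]
    ring
  · rw [map_sub, map_mul, constantCoeff_zetaSeries D hζ, zero_mul, sub_zero,
      ← coeff_zero_eq_constantCoeff_apply, coeff_mapSeries, coeff_zero_eq_constantCoeff_apply, hV0,
      Derivation.map_one_eq_zero]

/-- The addition theorem for `ζ`, expanded at `X = 0`. -/
theorem addition_series (hz : D z = -p)
    (hp : (D p) ^ 2 = 4 * p ^ 3 - algebraMap ℂ A a * p - algebraMap ℂ A b)
    (hp2 : D (D p) = 6 * p ^ 2 - algebraMap ℂ A (a / 2))
    (he : (-2 - X ^ 3 * derivative ℂ (derivative ℂ ζ₀)) ^ 2 =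
      4 * (1 - X ^ 2 * derivative ℂ ζ₀) ^ 3 - C a * X ^ 4 * (1 - X ^ 2 * derivative ℂ ζ₀) -
        C b * X ^ 6)
    {G : A⟦X⟧} (hG : zetaSeries D z ζ₀ = X * G) :
    2 * (C p + map (algebraMap ℂ A) (derivative ℂ ζ₀) - G) +
      X * (2 * (C p + map (algebraMap ℂ A) (derivative ℂ ζ₀)) * zetaSeries D z ζ₀ - C (D p) +
        map (algebraMap ℂ A) (derivative ℂ (derivative ℂ ζ₀))) = 0 := by
  have he2 := second_order_of_first_order (e := -derivative ℂ ζ₀) (a := a) (b := b)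
    (by rw [map_neg]; linear_combination he)
  rw [map_neg, map_neg] at he2
  have hd1 := congrArg (derivative A) hG
  have hd2 := congrArg (mapSeries D) hG
  rw [derivative_zetaSeries D hz, Derivation.leibniz, derivative_X, smul_eq_mul, smul_eq_mul,
    mul_one] at hd1
  rw [mapSeries_zetaSeries D hz, mapSeries_mul, mapSeries_X, zero_mul, zero_add] at hd2
  -- The derivation ∂_X + D annihilates ζ(x - X), so (∂_X + D)Z = ℘(x) + ζ₀'(X); dividing by X gives
  -- the equation for G.
  have hd3 : X * (derivative A G + mapSeries D G) =
      C p + map (algebraMap ℂ A) (derivative ℂ ζ₀) - G := by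
    linear_combination -hd1 - hd2
  have hh : algebraMap ℂ A a = 2 * algebraMap ℂ A (a / 2) := by
    rw [← map_ofNat (algebraMap ℂ A) 2, ← map_mul]; congr 1; ring
  have hh' : C a = 2 * C (a / 2) := by
    rw [show (2 : ℂ⟦X⟧) = C 2 from (map_ofNat C 2).symm, ← map_mul]; congr 1; ring
  have hp' := congrArg (C (R := A)) hp
  have hp2' := congrArg (C (R := A)) hp2
  have he' := congrArg (map (algebraMap ℂ A)) he
  have he2' := congrArg (map (algebraMap ℂ A)) he2
  have n2 : (map (algebraMap ℂ A)) (2 : ℂ⟦X⟧) = 2 := map_ofNat _ 2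
  have n4 : (map (algebraMap ℂ A)) (4 : ℂ⟦X⟧) = 4 := map_ofNat _ 4
  have n6 : (map (algebraMap ℂ A)) (6 : ℂ⟦X⟧) = 6 := map_ofNat _ 6
  have c2 : C (2 : A) = 2 := map_ofNat _ 2
  have c4 : C (4 : A) = 4 := map_ofNat _ 4
  have c6 : C (6 : A) = 6 := map_ofNat _ 6
  rw [hh] at hp'
  rw [hh'] at he'
  simp only [map_pow, map_sub, map_mul, map_neg, map_one, map_X, map_C, n2, n4, n6, c2, c4, c6,
    map_add] at hp' hp2' he' he2'
  have dm := derivative_map (A := A) (derivative ℂ ζ₀)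
  have dm' := derivative_map (A := A) (derivative ℂ (derivative ℂ ζ₀))
  have Dm := mapSeries_map D (derivative ℂ ζ₀)
  have Dm' := mapSeries_map D (derivative ℂ (derivative ℂ ζ₀))
  have d2 : derivative A (2 : A⟦X⟧) = 0 := derivative_ofNat 2
  have D2 : mapSeries D (2 : A⟦X⟧) = 0 := by
    rw [← c2, mapSeries_C, ← Nat.cast_ofNat (R := A), Derivation.map_natCast, map_zero]
  rw [hG]
  generalize map (algebraMap ℂ A) (derivative ℂ (derivative ℂ (derivative ℂ ζ₀))) = m₂ at *
  generalize map (algebraMap ℂ A) (derivative ℂ (derivative ℂ ζ₀)) = m₁ at *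
  generalize map (algebraMap ℂ A) (derivative ℂ ζ₀) = m at *
  -- Here B = X²(℘(x) - ℘(X)) and T = (∂_X + D)B. The hypothesis to check says that ∂_X + D kills
  -- XF/B, which is twice the difference of the two sides of ζ(x - X) - ζ(x) + ζ(X) = ½(℘'(x) +
  -- ℘'(X))/(℘(x) - ℘(X)).
  refine eq_zero_of_mul_eq_X_mul (D := D) (B := X ^ 2 * C p - 1 + X ^ 2 * m)
    (T := 2 * X * C p + X ^ 2 * C (D p) + 2 * X * m + X ^ 2 * m₁) (by simp) ?_
  simp only [map_add, map_sub, Derivation.leibniz, mapSeries_add, mapSeries_sub, mapSeries_mul,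
    mapSeries_X, mapSeries_C, derivative_X, derivative_C, dm, dm', Dm, Dm', d2, D2, smul_eq_mul]
  rw [← sub_eq_zero]
  have hX : ∀ s : A⟦X⟧, X ^ 2 * s = 0 → s = 0 := fun s hs => by
    ext n
    have := congrArg (PowerSeries.coeff (n + 2)) hs
    rwa [coeff_X_pow_mul] at this
  apply hX
  linear_combination X ^ 6 * hp' - he' -
    (X ^ 2 * C p - 1 + X ^ 2 * m) * (X ^ 4 * hp2' + he2') -
    2 * X ^ 2 * (X ^ 2 * C p - 1 + X ^ 2 * m) * (1 - X ^ 2 * (C p + m)) * hd3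

/-- Lamé's equation, expanded at `X = 0`. -/
theorem lame_series (hz : D z = -p)
    (hp : (D p) ^ 2 = 4 * p ^ 3 - algebraMap ℂ A a * p - algebraMap ℂ A b)
    (hp2 : D (D p) = 6 * p ^ 2 - algebraMap ℂ A (a / 2))
    (he : (-2 - X ^ 3 * derivative ℂ (derivative ℂ ζ₀)) ^ 2 =
      4 * (1 - X ^ 2 * derivative ℂ ζ₀) ^ 3 - C a * X ^ 4 * (1 - X ^ 2 * derivative ℂ ζ₀) -
        C b * X ^ 6)
    {G : A⟦X⟧} (hG : zetaSeries D z ζ₀ = X * G) :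
    2 * G + mapSeries D (zetaSeries D z ζ₀) + zetaSeries D z ζ₀ ^ 2 =
      2 * C p - map (algebraMap ℂ A) (derivative ℂ ζ₀) := by
  have hadd := addition_series D hz hp hp2 he hG
  have hDadd := congrArg (mapSeries D) hadd
  have hh : algebraMap ℂ A a = 2 * algebraMap ℂ A (a / 2) := by
    rw [← map_ofNat (algebraMap ℂ A) 2, ← map_mul]; congr 1; ring
  have hh' : C a = 2 * C (a / 2) := by
    rw [show (2 : ℂ⟦X⟧) = C 2 from (map_ofNat C 2).symm, ← map_mul]; congr 1; ring
  have hp' := congrArg (C (R := A)) hp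
  have hp2' := congrArg (C (R := A)) hp2
  have he' := congrArg (map (algebraMap ℂ A)) he
  have n2 : (map (algebraMap ℂ A)) (2 : ℂ⟦X⟧) = 2 := map_ofNat _ 2
  have n4 : (map (algebraMap ℂ A)) (4 : ℂ⟦X⟧) = 4 := map_ofNat _ 4
  have c2 : C (2 : A) = 2 := map_ofNat _ 2
  have c4 : C (4 : A) = 4 := map_ofNat _ 4
  have c6 : C (6 : A) = 6 := map_ofNat _ 6
  rw [hh] at hp'
  rw [hh'] at he'
  simp only [map_pow, map_sub, map_mul, map_neg, map_one, map_X, map_C, n2, n4, c2, c4, c6]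
    at hp' hp2' he'
  have Dm := mapSeries_map D (derivative ℂ ζ₀)
  have Dm' := mapSeries_map D (derivative ℂ (derivative ℂ ζ₀))
  have D2 : mapSeries D (2 : A⟦X⟧) = 0 := by
    rw [← c2, mapSeries_C, ← Nat.cast_ofNat (R := A), Derivation.map_natCast, map_zero]
  have hD0 : mapSeries D (0 : A⟦X⟧) = 0 := by rw [← map_zero C, mapSeries_C, map_zero]
  rw [hG] at hadd hDadd ⊢
  generalize map (algebraMap ℂ A) (derivative ℂ (derivative ℂ ζ₀)) = m₁ at *
  generalize map (algebraMap ℂ A) (derivative ℂ ζ₀) = m at *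
  simp only [mapSeries_add, mapSeries_sub, mapSeries_mul, mapSeries_X, mapSeries_C, Dm, Dm', D2,
    hD0] at hDadd ⊢
  -- X²(℘(x) - ℘(X)) is a unit. After multiplication by 4X² and its square, Lamé's equation becomes
  -- a polynomial consequence of the addition theorem, its D-derivative and the equations of ℘.
  obtain ⟨u, hu⟩ := isUnit_of_constantCoeff_eq_neg_one
    (show constantCoeff (X ^ 2 * C p - 1 + X ^ 2 * m) = -1 by simp)
  have hX : ∀ s : A⟦X⟧, X ^ 2 * s = 0 → s = 0 := fun s hs => by
    ext n
    have := congrArg (PowerSeries.coeff (n + 2)) hs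
    rwa [coeff_X_pow_mul] at this
  have h4 : ∀ s : A⟦X⟧, 4 * s = 0 → s = 0 := fun s hs => by
    have h5 : C (algebraMap ℂ A 4⁻¹) * 4 = 1 := by
      rw [← c4, ← map_mul, ← map_ofNat (algebraMap ℂ A) 4, ← map_mul]
      norm_num
    rw [← one_mul s, ← h5, mul_assoc, hs, mul_zero]
  rw [← sub_eq_zero]
  apply hX
  apply h4
  rw [← Units.mul_right_eq_zero (u ^ 2), Units.val_pow_eq_pow_val, hu]
  linear_combination (2 * (X ^ 2 * C p - 1 + X ^ 2 * m) * (1 + X ^ 2 * G) - X ^ 3 * C (D p) - 2 -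
    X ^ 3 * m₁) * X ^ 2 * hadd + 2 * (X ^ 2 * C p - 1 + X ^ 2 * m) * (X ^ 3 * hDadd +
    X ^ 4 * hp2') + he' - X ^ 6 * hp'

end Lame

end PseudoDiffOp

end

/-! ### Constant-coefficient operators; Lamé's equation and its companion as operator identities -/

noncomputable section

namespace PseudoDiffOp

open PowerSeries

variable {A : Type*} [CommRing A] [Algebra ℂ A] (D : Derivation ℂ A A)

/-- The operator with constant coefficients `∑ s_n ∂⁻ⁿ`. -/
def constSeries (s : ℂ⟦X⟧) : PseudoDiffOp D := ofSeries D (map (algebraMap ℂ A) s)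

theorem ofSeries_mul_constSeries (s : A⟦X⟧) (t : ℂ⟦X⟧) :
    ofSeries D s * constSeries D t = ofSeries D (s * map (algebraMap ℂ A) t) :=
  ofSeries_mul_of_const s (deriv_coeff_map D t)

theorem constSeries_add (s t : ℂ⟦X⟧) :
    constSeries D (s + t) = constSeries D s + constSeries D t := by
  simp only [constSeries, map_add, ofSeries_add]

theorem constSeries_sub (s t : ℂ⟦X⟧) :
    constSeries D (s - t) = constSeries D s - constSeries D t := by
  simp only [constSeries, map_sub, ofSeries_sub]

theorem constSeries_one : constSeries D 1 = 1 := by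
  rw [constSeries, map_one, ofSeries_one]

theorem constSeries_mul (s t : ℂ⟦X⟧) :
    constSeries D (s * t) = constSeries D s * constSeries D t := by
  rw [constSeries, constSeries, ofSeries_mul_constSeries, map_mul]

theorem constSeries_comm (s t : ℂ⟦X⟧) : Commute (constSeries D s) (constSeries D t) := by
  rw [Commute, SemiconjBy, ← constSeries_mul, mul_comm, constSeries_mul]

theorem del_comm_constSeries (s : ℂ⟦X⟧) : Commute (del D) (constSeries D s) :=
  del_mul_of_const (deriv_coeff_map D s)

theorem constSeries_C (c : ℂ) : constSeries D (C c) = mulBy D (algebraMap ℂ A c) := by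
  rw [constSeries, map_C, ofSeries_C]

theorem mul_mulBy_algebraMap (c : ℂ) (P : PseudoDiffOp D) :
    P * mulBy D (algebraMap ℂ A c) = mulBy D (algebraMap ℂ A c) * P := by
  refine ext_coeff fun n => ?_
  rw [coeff_mulBy_mul, coeff_mul, finsum_eq_single _ ((n, 0) : ℤ × ℕ)]
  · simp [mulBy, coeff_monomial, mul_comm]
  · rintro ⟨i, r⟩ h
    obtain rfl | hr := r.eq_zero_or_pos
    · have hi : ¬ n - i = 0 := fun h0 => h (by rw [sub_eq_zero.mp h0])
      simp [mulBy, coeff_monomial, hi]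
    · obtain ⟨r, rfl⟩ := Nat.exists_eq_succ_of_ne_zero hr.ne'
      simp only [mulBy, coeff_monomial, Function.iterate_succ_apply]
      split_ifs
      · rw [Derivation.map_algebraMap, iterate_map_zero, mul_zero, smul_zero]
      · rw [map_zero, iterate_map_zero, mul_zero, smul_zero]

/-- Complex constants as operators. -/
def constHom : ℂ →+* PseudoDiffOp D where
  toFun c := mulBy D (algebraMap ℂ A c)
  map_one' := by rw [map_one]; rfl
  map_zero' := by rw [← constSeries_C, map_zero, ← sub_self (0 : ℂ⟦X⟧), constSeries_sub, sub_self]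
  map_add' a b := by rw [← constSeries_C, map_add, constSeries_add, constSeries_C, constSeries_C]
  map_mul' a b := by rw [← constSeries_C, map_mul, constSeries_mul, constSeries_C, constSeries_C]

/-- Scalar multiplication of operators by complex constants. -/
instance : Algebra ℂ (PseudoDiffOp D) :=
  (constHom D).toAlgebra' fun c P => (mul_mulBy_algebraMap D c P).symm

theorem mulBy_algebraMap (c : ℂ) :
    mulBy D (algebraMap ℂ A c) = algebraMap ℂ (PseudoDiffOp D) c := rfl

theorem smul_constSeries (c : ℂ) (s : ℂ⟦X⟧) : c • constSeries D s = constSeries D (C c * s) := by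
  rw [Algebra.smul_def, ← mulBy_algebraMap, ← constSeries_C, constSeries_mul]

theorem constSeries_mul_X_pow (s : ℂ⟦X⟧) (n : ℕ) :
    constSeries D (s * X ^ n) * del D ^ n = constSeries D s := by
  rw [constSeries, map_mul, map_pow, map_X, ofSeries_mul_X_pow, constSeries]

theorem constSeries_X_pow (n : ℕ) : constSeries D (X ^ n) * del D ^ n = 1 := by
  rw [← one_mul (X ^ n), constSeries_mul_X_pow, constSeries_one]

theorem del_pow_add_constSeries (s : ℂ⟦X⟧) (n : ℕ) :
    del D ^ n + constSeries D s = constSeries D (1 + X ^ n * s) * del D ^ n := by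
  rw [constSeries_add, add_mul, constSeries_one, one_mul, mul_comm (X ^ n), constSeries_mul_X_pow]

theorem commute_del_pow_add_constSeries (s t : ℂ⟦X⟧) (m n : ℕ) :
    Commute (del D ^ m + constSeries D s) (del D ^ n + constSeries D t) :=
  (((Commute.refl _).pow_pow _ _).add_right ((del_comm_constSeries D t).pow_left _)).add_left
    (((del_comm_constSeries D s).symm.pow_right _).add_right (constSeries_comm D s t))

section Lame

variable {p z x : A} {ζ₀ : ℂ⟦X⟧} {a b : ℂ}

/-- This is ψ'' - 2℘(x)ψ = ℘(X)ψ: as DV = XGV and X stands for ∂⁻¹, the cross term 2(DV)∂ of ∂²V₀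
has order zero, and `lame_series` compares what remains. The symbol of the right factor is ℘(X),
because -ζ₀' is the regular part of ℘. -/
theorem lame_ofSeries (hz : D z = -p) (hx : D x = 1)
    (hp : (D p) ^ 2 = 4 * p ^ 3 - algebraMap ℂ A a * p - algebraMap ℂ A b)
    (hp2 : D (D p) = 6 * p ^ 2 - algebraMap ℂ A (a / 2)) (hζ : constantCoeff ζ₀ = 0)
    (he : (-2 - X ^ 3 * derivative ℂ (derivative ℂ ζ₀)) ^ 2 =
      4 * (1 - X ^ 2 * derivative ℂ ζ₀) ^ 3 - C a * X ^ 4 * (1 - X ^ 2 * derivative ℂ ζ₀) -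
        C b * X ^ 6)
    {V : A⟦X⟧} (hV : derivative A V = logDerivSeries D z x ζ₀ * V) (hV0 : constantCoeff V = 1) :
    (del D ^ 2 - mulBy D (2 * p)) * ofSeries D V =
      ofSeries D V * (del D ^ 2 + constSeries D (-derivative ℂ ζ₀)) := by
  obtain ⟨G, hG⟩ := X_dvd_iff.mpr (constantCoeff_zetaSeries D (z := z) hζ)
  have hlame := lame_series D hz hp hp2 he hG
  have hDV := mapSeries_of_derivative_eq D hz hx hζ hV hV0
  have h1 : ofSeries D (mapSeries D V) * del D = ofSeries D (G * V) := by
    rw [hDV, hG, mul_assoc, mul_comm X, ofSeries_mul_X]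
  have h2 : mapSeries D (mapSeries D V) =
      (mapSeries D (zetaSeries D z ζ₀) + zetaSeries D z ζ₀ ^ 2) * V := by
    rw [hDV, mapSeries_mul, hDV]; ring
  rw [sub_mul, mulBy_mul_ofSeries, mul_add, ofSeries_mul_constSeries, pow_two, mul_assoc,
    del_mul_ofSeries, mul_add, ← mul_assoc, del_mul_ofSeries, del_mul_ofSeries, add_mul, h1,
    mul_assoc]
  rw [add_assoc, add_sub_assoc, ← ofSeries_add, ← ofSeries_add, ← ofSeries_sub]
  congr 2
  rw [h2, map_mul, map_neg, map_ofNat]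
  linear_combination V * hlame

/-- This is the addition theorem multiplied by ψ. The operator ∂³ + ½ζ₀'' has symbol -½℘'(X). -/
theorem lameQ_ofSeries (hz : D z = -p) (hx : D x = 1)
    (hp : (D p) ^ 2 = 4 * p ^ 3 - algebraMap ℂ A a * p - algebraMap ℂ A b)
    (hp2 : D (D p) = 6 * p ^ 2 - algebraMap ℂ A (a / 2)) (hζ : constantCoeff ζ₀ = 0)
    (he : (-2 - X ^ 3 * derivative ℂ (derivative ℂ ζ₀)) ^ 2 =
      4 * (1 - X ^ 2 * derivative ℂ ζ₀) ^ 3 - C a * X ^ 4 * (1 - X ^ 2 * derivative ℂ ζ₀) -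
        C b * X ^ 6)
    {V : A⟦X⟧} (hV : derivative A V = logDerivSeries D z x ζ₀ * V) (hV0 : constantCoeff V = 1) :
    (mulBy D p * del D - mulBy D ((1 / 2 : ℂ) • D p)) * ofSeries D V =
      del D * ofSeries D V * (del D ^ 2 + constSeries D (-derivative ℂ ζ₀)) -
        ofSeries D V *
          (del D ^ 3 + constSeries D (C (1 / 2) * derivative ℂ (derivative ℂ ζ₀))) := by
  obtain ⟨G, hG⟩ := X_dvd_iff.mpr (constantCoeff_zetaSeries D (z := z) hζ)
  have hadd := addition_series D hz hp hp2 he hG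
  have hDV := mapSeries_of_derivative_eq D hz hx hζ hV hV0
  have h1 : ofSeries D (mapSeries D V) * del D = ofSeries D (G * V) := by
    rw [hDV, hG, mul_assoc, mul_comm X, ofSeries_mul_X]
  have h2 : C (algebraMap ℂ A (1 / 2)) * 2 = 1 := by
    rw [← map_ofNat C 2, ← map_mul, ← map_ofNat (algebraMap ℂ A) 2, ← map_mul]
    norm_num
  have hc : ofSeries D (V * map (algebraMap ℂ A) (-derivative ℂ ζ₀)) * del D =
      ofSeries D V * del D * constSeries D (-derivative ℂ ζ₀) := by
    rw [mul_assoc, (del_comm_constSeries D _).eq, ← mul_assoc, ofSeries_mul_constSeries]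
  have key : ofSeries D ((C p + map (algebraMap ℂ A) (derivative ℂ ζ₀) - G) * V) * del D +
      ofSeries D (((C p + map (algebraMap ℂ A) (derivative ℂ ζ₀)) * zetaSeries D z ζ₀ -
        C (algebraMap ℂ A (1 / 2)) * (C (D p) -
        map (algebraMap ℂ A) (derivative ℂ (derivative ℂ ζ₀)))) * V) = 0 := by
    -- Inserting X∂ = 1 makes both summands right multiples of ∂, leaving one power series: half the
    -- addition theorem times V.
    nth_rewrite 2 [← ofSeries_mul_X]
    rw [← add_mul, ← ofSeries_add]
    convert! zero_mul (del D)
    rw [← sub_self (ofSeries D (0 : A⟦X⟧)), ← ofSeries_sub, sub_zero]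
    congr 1
    linear_combination C (algebraMap ℂ A (1 / 2)) * V * hadd -
      (C p + map (algebraMap ℂ A) (derivative ℂ ζ₀) - G +
        X * (C p + map (algebraMap ℂ A) (derivative ℂ ζ₀)) * zetaSeries D z ζ₀) * V * h2
  have hL : (mulBy D p * del D - mulBy D ((1 / 2 : ℂ) • D p)) * ofSeries D V =
      ofSeries D (C p * V) * del D + ofSeries D (C p * mapSeries D V) -
        ofSeries D (C ((1 / 2 : ℂ) • D p) * V) := by
    rw [sub_mul, mul_assoc, del_mul_ofSeries, mul_add, ← mul_assoc, mulBy_mul_ofSeries,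
      mulBy_mul_ofSeries, mulBy_mul_ofSeries]
  have hR : del D * ofSeries D V * (del D ^ 2 + constSeries D (-derivative ℂ ζ₀)) =
      ofSeries D V * del D ^ 3 + ofSeries D (G * V) * del D +
        ofSeries D (V * map (algebraMap ℂ A) (-derivative ℂ ζ₀)) * del D +
        ofSeries D (mapSeries D V * map (algebraMap ℂ A) (-derivative ℂ ζ₀)) := by
    rw [del_mul_ofSeries, mul_add, add_mul, add_mul, ← hc, ofSeries_mul_constSeries, pow_two,
      ← mul_assoc (ofSeries D (mapSeries D V)), h1]
    noncomm_ring
  have key' : ofSeries D (C p * V - G * V - V * map (algebraMap ℂ A) (-derivative ℂ ζ₀)) * del D +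
      ofSeries D (C p * mapSeries D V - C ((1 / 2 : ℂ) • D p) * V -
        mapSeries D V * map (algebraMap ℂ A) (-derivative ℂ ζ₀) +
        V * map (algebraMap ℂ A) (C (1 / 2) * derivative ℂ (derivative ℂ ζ₀))) = 0 := by
    rw [← key, hDV]
    congr 3
    · rw [map_neg]; ring
    · rw [Algebra.smul_def, map_mul, map_mul, map_neg, map_C]; ring
  rw [hL, hR, mul_add, ofSeries_mul_constSeries, ← sub_eq_zero, ← key']
  simp only [ofSeries_add, ofSeries_sub, sub_mul]
  abel

end Lame

end PseudoDiffOp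

end

/-! ### The operators U_{n+2} and the commutator with x -/

noncomputable section

namespace PseudoDiffOp

open PowerSeries

section Symbols

variable {A : Type*} [CommRing A] [Algebra ℂ A] (D : Derivation ℂ A A)

/-- The series `∑ (-1)ᵐ (m+n)! / (m! (n+1)!) a_{m+n} Xᵐ`. -/
def uSeries (c : ℕ → ℂ) (n : ℕ) : ℂ⟦X⟧ := PowerSeries.mk fun m =>
  (-1) ^ m * ((m + n).factorial : ℂ) / ((m.factorial : ℂ) * ((n + 1).factorial : ℂ)) * c (m + n)

/-- When c is the Laurent coefficient sequence of ℘, the series is the regular part of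
(-1)ⁿ℘⁽ⁿ⁾(X)/(n+1)!. The sign (-1)ᵐ makes the rule hold for arbitrary c. -/
theorem derivative_uSeries (c : ℕ → ℂ) (n : ℕ) :
    derivative ℂ (uSeries c n) = -(C ((n : ℂ) + 2) * uSeries c (n + 1)) := by
  ext m
  rw [coeff_derivative, map_neg, coeff_C_mul, uSeries, uSeries, coeff_mk, coeff_mk,
    show m + 1 + n = m + (n + 1) by ring, Nat.factorial_succ m, Nat.factorial_succ (n + 1)]
  have h1 : (m.factorial : ℂ) ≠ 0 := by exact_mod_cast m.factorial_ne_zero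
  have h2 : ((n + 1).factorial : ℂ) ≠ 0 := by exact_mod_cast (n + 1).factorial_ne_zero
  have h3 : (m : ℂ) + 1 ≠ 0 := Nat.cast_add_one_ne_zero m
  have h4 : (n : ℂ) + 1 + 1 ≠ 0 := by
    simpa using Nat.cast_add_one_ne_zero (R := ℂ) (n + 1)
  push_cast
  field_simp
  ring

theorem uSeries_zero (c : ℕ → ℂ) : uSeries c 0 = PowerSeries.mk fun m => (-1) ^ m * c m := by
  ext m
  have h1 : (m.factorial : ℂ) ≠ 0 := by exact_mod_cast m.factorial_ne_zero
  rw [uSeries, coeff_mk, coeff_mk]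
  simp only [add_zero, zero_add, Nat.factorial_one, Nat.cast_one, mul_one]
  field_simp

/-- The operator `∂^{n+2} + ∑ (-1)ᵐ (m+n)! / (m! (n+1)!) a_{m+n} ∂⁻ᵐ`. -/
def uOp (c : ℕ → ℂ) (n : ℕ) : PseudoDiffOp D := del D ^ (n + 2) + constSeries D (uSeries c n)

theorem commute_uOp (c : ℕ → ℂ) (m n : ℕ) : Commute (uOp D c m) (uOp D c n) :=
  commute_del_pow_add_constSeries D _ _ _ _

theorem commute_uOp_del (c : ℕ → ℂ) (n : ℕ) : Commute (uOp D c n) (del D) :=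
  ((Commute.refl _).pow_left _).add_left (del_comm_constSeries D _).symm

/-- The operation `P ↦ [P, x] ∂²`. On operators with constant coefficients it is minus the
derivative with respect to the symbol `X` of `∂⁻¹`. -/
def adX (x : A) : PseudoDiffOp D →ₗ[ℂ] PseudoDiffOp D :=
  LinearMap.mulRight ℂ (del D ^ 2) ∘ₗ
    (LinearMap.mulRight ℂ (mulBy D x) - LinearMap.mulLeft ℂ (mulBy D x))

variable {D} in
theorem adX_apply (x : A) (P : PseudoDiffOp D) :
    adX D x P = (P * mulBy D x - mulBy D x * P) * del D ^ 2 := rfl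

variable {D} in
-- The commutator with x is a derivation; Q must commute with ∂ so that the trailing ∂² can be moved
-- past it.
theorem adX_mul (x : A) (P : PseudoDiffOp D) {Q : PseudoDiffOp D} (hQ : Commute Q (del D)) :
    adX D x (P * Q) = P * adX D x Q + adX D x P * Q := by
  simp only [adX_apply]
  have h := (hQ.pow_right 2).eq
  rw [mul_assoc (_ - _) _ Q, ← h]
  noncomm_ring

theorem adX_one (x : A) : adX D x 1 = 0 := by
  rw [adX_apply, one_mul, mul_one, sub_self, zero_mul]

variable {x : A}

theorem del_mul_mulBy (hx : D x = 1) : del D * mulBy D x = mulBy D x * del D + 1 := by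
  rw [del_mul]
  congr 1
  refine ext_coeff fun n => ?_
  simp only [coeffDeriv, mulBy, coeff_monomial, coeff_one]
  split_ifs <;> simp [hx]

theorem adX_del_pow (hx : D x = 1) (n : ℕ) :
    adX D x (del D ^ n) = (n : ℂ) • del D ^ (n + 1) := by
  induction n with
  | zero => rw [pow_zero, adX_one, Nat.cast_zero, zero_smul]
  | succ n ih =>
    rw [pow_succ, adX_mul _ _ (Commute.refl _), ih, adX_apply x (del D), del_mul_mulBy D hx,
      add_sub_cancel_left, one_mul, ← pow_add, smul_mul_assoc, ← pow_succ]
    push_cast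
    rw [add_smul, one_smul, add_comm]

theorem adX_constSeries (hx : D x = 1) (s : ℂ⟦X⟧) :
    adX D x (constSeries D s) = -constSeries D (derivative ℂ s) := by
  rw [adX_apply, constSeries, ofSeries_mul_mulBy hx, sub_sub_cancel_left, neg_mul, derivative_map,
    mul_comm, ofSeries_mul_X_pow, constSeries]

theorem adX_uOp (hx : D x = 1) (c : ℕ → ℂ) (n : ℕ) :
    adX D x (uOp D c n) = ((n : ℂ) + 2) • uOp D c (n + 1) := by
  rw [uOp, map_add, adX_del_pow D hx, adX_constSeries D hx, derivative_uSeries, uOp, smul_add,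
    smul_constSeries]
  congr 1
  · push_cast; rfl
  · rw [← zero_sub (C _ * _), constSeries_sub, neg_sub, sub_eq_self, ← sub_self (0 : ℂ⟦X⟧),
      constSeries_sub, sub_self]

theorem commute_aeval_uOp (c : ℕ → ℂ) (R : Polynomial ℂ) (n : ℕ) :
    Commute (Polynomial.aeval (uOp D c 0) R) (uOp D c n) := by
  induction R using Polynomial.induction_on' with
  | add p q hp hq => rw [map_add]; exact hp.add_left hq
  | monomial m r =>
    rw [Polynomial.aeval_monomial]
    exact (Algebra.commute_algebraMap_left r _).mul_left ((commute_uOp D c 0 n).pow_left m)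

/-- Chain rule, with twice `uOp D c 1` as the derivative of `uOp D c 0`. -/
theorem adX_aeval (hx : D x = 1) (c : ℕ → ℂ) (R : Polynomial ℂ) :
    adX D x (Polynomial.aeval (uOp D c 0) R) =
      (2 : ℂ) • (Polynomial.aeval (uOp D c 0) (Polynomial.derivative R) * uOp D c 1) := by
  have hpow : ∀ n : ℕ, adX D x (uOp D c 0 ^ n) =
      (2 : ℂ) • ((n : ℂ) • uOp D c 0 ^ (n - 1) * uOp D c 1) := by
    intro n
    induction n with
    | zero => rw [pow_zero, adX_one]; simp
    | succ n ih =>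
      rw [pow_succ, adX_mul _ _ (commute_uOp_del D c 0), ih, adX_uOp D hx]
      cases n with
      | zero => simp
      | succ n =>
        simp only [Nat.add_sub_cancel, Nat.cast_zero, zero_add, smul_mul_assoc, mul_smul_comm]
        rw [mul_assoc, (commute_uOp D c 1 0).eq, ← mul_assoc, ← pow_succ]
        push_cast
        module
  induction R using Polynomial.induction_on' with
  | add p q hp hq => rw [map_add, map_add, hp, hq, map_add, map_add, add_mul, smul_add]
  | monomial n r =>
    rw [Polynomial.derivative_monomial, Polynomial.aeval_monomial, Polynomial.aeval_monomial,
      ← Algebra.smul_def, ← Algebra.smul_def, map_smul, hpow]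
    simp only [smul_mul_assoc]
    module

section WeierstrassEquation

variable {c : ℕ → ℂ} {a b : ℂ}

/-- Pulling out the leading power of ∂ turns relations among these operators into relations among
commuting power series in X. -/
theorem uOp_eq (c : ℕ → ℂ) (n : ℕ) :
    uOp D c n = constSeries D (1 + X ^ (n + 2) * uSeries c n) * del D ^ (n + 2) :=
  del_pow_add_constSeries D _ _

theorem constSeries_mul_del_pow_mul (s t : ℂ⟦X⟧) (m n : ℕ) :
    constSeries D s * del D ^ m * (constSeries D t * del D ^ n) =
      constSeries D (s * t) * del D ^ (m + n) := by
  rw [constSeries_mul, pow_add, mul_assoc, ← mul_assoc (del D ^ m),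
    ((del_comm_constSeries D t).pow_left m).eq]
  noncomm_ring

/-- The hypothesis is (℘')² = 4℘³ - g₂℘ - g₃ multiplied by X⁶, and X⁶∂⁶ = 1. -/
theorem uOp_one_sq (h : 4 * (1 + X ^ 3 * uSeries c 1) ^ 2 = 4 * (1 + X ^ 2 * uSeries c 0) ^ 3 -
      C a * X ^ 4 * (1 + X ^ 2 * uSeries c 0) - C b * X ^ 6) :
    (4 : ℂ) • uOp D c 1 ^ 2 = (4 : ℂ) • uOp D c 0 ^ 3 - a • uOp D c 0 - b • 1 := by
  have h1 : uOp D c 1 ^ 2 = constSeries D ((1 + X ^ 3 * uSeries c 1) ^ 2) * del D ^ 6 := by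
    rw [pow_two, uOp_eq, constSeries_mul_del_pow_mul, ← pow_two]
  have h2 : uOp D c 0 ^ 3 = constSeries D ((1 + X ^ 2 * uSeries c 0) ^ 3) * del D ^ 6 := by
    rw [pow_succ, pow_two, uOp_eq, constSeries_mul_del_pow_mul, constSeries_mul_del_pow_mul,
      ← pow_two, ← pow_succ]
  have h3 : uOp D c 0 = constSeries D (X ^ 4 * (1 + X ^ 2 * uSeries c 0)) * del D ^ 6 := by
    rw [show 6 = 4 + 2 from rfl, pow_add, ← mul_assoc, mul_comm (X ^ 4), constSeries_mul_X_pow,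
      uOp_eq]
  nth_rewrite 2 [h3]
  rw [h1, h2, ← constSeries_X_pow D 6]
  simp only [← smul_mul_assoc, smul_constSeries, ← sub_mul, ← constSeries_sub]
  congr 2
  have c4 : C (4 : ℂ) = 4 := map_ofNat C 4
  rw [c4]
  linear_combination h

theorem uOp_two (h : 6 * (1 + X ^ 4 * uSeries c 2) =
      6 * (1 + X ^ 2 * uSeries c 0) ^ 2 - C (a / 2) * X ^ 4) :
    (6 : ℂ) • uOp D c 2 = (6 : ℂ) • uOp D c 0 ^ 2 - (a / 2) • 1 := by
  rw [pow_two, uOp_eq, uOp_eq, constSeries_mul_del_pow_mul, ← constSeries_X_pow D 4]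
  simp only [← smul_mul_assoc, smul_constSeries, ← sub_mul, ← constSeries_sub]
  congr 2
  have c6 : C (6 : ℂ) = 6 := map_ofNat C 6
  rw [c6]
  linear_combination h

end WeierstrassEquation

end Symbols

end PseudoDiffOp

/-! ### The polynomials R_m and the recursion for P_n, Q_n -/

namespace PeriodPair

open PseudoDiffOp

variable (L : PeriodPair)

theorem coeff_polyR (m i : ℕ) (hi : m ≤ i) :
    (L.polyR m).coeff i = if i = m + 1 then ((2 * m + 1).factorial : ℂ) else 0 := by
  induction m generalizing i with
  | zero =>
    rw [polyR, Polynomial.coeff_X]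
    simp [eq_comm]
  | succ m ih =>
    have e : L.polyR (m + 1) = Polynomial.C 6 * (Polynomial.X ^ 2 *
        Polynomial.derivative (L.polyR m)) - Polynomial.C (L.g₂ / 2) *
        Polynomial.derivative (L.polyR m) + Polynomial.C 4 * (Polynomial.X ^ 3 *
        Polynomial.derivative (Polynomial.derivative (L.polyR m))) - Polynomial.C L.g₂ *
        (Polynomial.X * Polynomial.derivative (Polynomial.derivative (L.polyR m))) -
        Polynomial.C L.g₃ * Polynomial.derivative (Polynomial.derivative (L.polyR m)) := by
      rw [polyR, map_ofNat Polynomial.C 6, map_ofNat Polynomial.C 4]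
      ring
    have hz : ∀ j, m + 2 ≤ j → (L.polyR m).coeff j = 0 := fun j hj => by
      rw [ih j (by omega), if_neg (by omega)]
    -- In these degrees only 6X²R' and 4X³R'' contribute, and 6(i-1) + 4(i-1)(i-2) = (i-1)(4i-2). At
    -- i = m + 2 this is (2m+2)(2m+3).
    have key : (L.polyR (m + 1)).coeff i =
        (((i : ℂ) - 1) * (4 * i - 2)) * (L.polyR m).coeff (i - 1) := by
      rw [e]
      simp only [Polynomial.coeff_add, Polynomial.coeff_sub, Polynomial.coeff_C_mul,
        Polynomial.coeff_X_pow_mul', Polynomial.coeff_derivative]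
      obtain _ | _ | _ | i := i
      · omega
      · simp [Polynomial.coeff_derivative, hz 2 (by omega), hz 3 (by omega)]
      · simp [Polynomial.coeff_derivative, hz 3 (by omega), hz 4 (by omega)]
        exact Or.inl (by ring)
      · simp [Polynomial.coeff_derivative, hz (i + 1 + 1 + 1 + 1) (by omega),
          hz (i + 1 + 1 + 1 + 1 + 1) (by omega)]
        ring
    rw [key, ih (i - 1) (by omega)]
    by_cases hi2 : i = m + 2
    · subst hi2
      have hf : (2 * (m + 1) + 1).factorial =
          (2 * m + 3) * ((2 * m + 2) * (2 * m + 1).factorial) := rfl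
      rw [if_pos (by omega), if_pos (by omega), hf]
      push_cast
      ring
    · rw [if_neg (by omega), if_neg (by omega), mul_zero]

theorem polyR_eq (m : ℕ) : L.polyR m = Polynomial.C ((2 * m + 1).factorial : ℂ) *
    (Polynomial.X ^ (m + 1) + ∑ j ∈ Finset.Ico 1 m, Polynomial.C (L.coeffR m j) * Polynomial.X ^ j +
      Polynomial.C (L.coeffR m 0)) := by
  have hf : ((2 * m + 1).factorial : ℂ) ≠ 0 := by exact_mod_cast (2 * m + 1).factorial_ne_zero
  ext i
  simp only [Polynomial.coeff_C_mul, Polynomial.coeff_add, Polynomial.coeff_X_pow,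
    Polynomial.finsetSum_coeff, mul_ite, mul_one, mul_zero, Finset.sum_ite_eq, Polynomial.coeff_C,
    Finset.mem_Ico]
  by_cases hi : m ≤ i
  · rw [coeff_polyR _ _ _ hi, if_neg (c := 1 ≤ i ∧ i < m) (by omega)]
    by_cases h0 : i = 0
    · subst h0
      obtain rfl : m = 0 := by omega
      simp [coeffR, polyR]
    · rw [if_neg h0]
      simp
  · rw [if_neg (by omega)]
    by_cases h0 : i = 0
    · subst h0
      simp only [coeffR]
      rw [if_neg (by omega), if_pos trivial]
      field_simp
      simp
    · rw [if_neg h0, if_pos (by omega), coeffR]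
      field_simp
      simp

theorem derivative_polyR_eq (m : ℕ) : Polynomial.derivative (L.polyR m) =
    Polynomial.C ((2 * m + 1).factorial : ℂ) * (Polynomial.C ((m : ℂ) + 1) * (Polynomial.X ^ m +
      ∑ j ∈ Finset.Ico 1 m,
        Polynomial.C ((j : ℂ) * L.coeffR m j / ((m : ℂ) + 1)) * Polynomial.X ^ (j - 1))) := by
  have hm : (m : ℂ) + 1 ≠ 0 := Nat.cast_add_one_ne_zero m
  rw [polyR_eq, Polynomial.derivative_C_mul, Polynomial.derivative_add, Polynomial.derivative_add,
    Polynomial.derivative_C, Polynomial.derivative_X_pow, Polynomial.derivative_sum, add_zero,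
    mul_add (Polynomial.C ((m : ℂ) + 1)), Finset.mul_sum]
  congr 2
  · simp
  · refine Finset.sum_congr rfl fun j _ => ?_
    rw [Polynomial.derivative_C_mul, Polynomial.derivative_X_pow, ← mul_assoc, ← mul_assoc,
      ← Polynomial.C_mul, ← Polynomial.C_mul]
    congr 2
    field_simp

theorem lameP_isDifferential (n : ℕ) :
    (L.lamePQ n).1.IsDifferential ∧ (L.lamePQ n).2.IsDifferential := by
  induction n with
  | zero =>
    refine ⟨?_, ?_⟩
    · rw [lamePQ, pow_two]
      exact (IsDifferential.del.mul .del).sub (.mulBy _)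
    · rw [lamePQ]
      exact ((IsDifferential.mulBy _).mul .del).sub (.mulBy _)
  | succ n ih =>
    refine ⟨?_, ?_⟩
    · exact ((ih.1.mul .del).add ih.1.coeffDeriv).sub ih.2
    · exact (((IsDifferential.mulBy _).mul ih.1).sub (ih.2.mul .del)).sub ih.2.coeffDeriv

theorem tildeP_isDifferential (n : ℕ) : (L.tildeP n).IsDifferential := by
  rw [tildeP]
  split_ifs
  · exact ((L.lameP_isDifferential _).1.add (.sum fun j _ =>
      (IsDifferential.mulBy _).mul (L.lameP_isDifferential _).1)).add (.mulBy _)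
  · exact (L.lameP_isDifferential _).1.add (.sum fun j _ =>
      (IsDifferential.mulBy _).mul (L.lameP_isDifferential _).1)

/-- The symbols by which the operators `P_n` act on the solution of Lamé's equation. -/
def lameEig (U₀ U₁ : L.PDO) : ℕ → L.PDO
  | 0 => U₀
  | 1 => U₁
  | n + 2 => U₀ * lameEig U₀ U₁ n

theorem lameEig_even (U₀ U₁ : L.PDO) (m : ℕ) : L.lameEig U₀ U₁ (2 * m) = U₀ ^ (m + 1) := by
  induction m with
  | zero => rw [zero_add, pow_one]; rfl
  | succ m ih => rw [pow_succ', ← ih]; rfl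

theorem lameEig_odd (U₀ U₁ : L.PDO) (m : ℕ) : L.lameEig U₀ U₁ (2 * m + 1) = U₀ ^ m * U₁ := by
  induction m with
  | zero => rw [pow_zero, one_mul]; rfl
  | succ m ih => rw [pow_succ', mul_assoc, ← ih]; rfl

/-- Because ∂P = P∂ + P', the recursion reads P_{n+1} = ∂Pₙ - Q_{n-1} and Qₙ = 2℘Pₙ - ∂Q_{n-1}. The
first telescopes against the formula for Q; the second uses (∂² - 2℘)V = VU₀. -/
theorem lamePQ_mul {V U₀ U₁ : L.PDO}
    (hP : (del L.derivation ^ 2 - mulBy L.derivation (2 * L.wp)) * V = V * U₀)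
    (hQ : (mulBy L.derivation L.wp * del L.derivation -
      mulBy L.derivation ((1 / 2 : ℂ) • L.derivation L.wp)) * V =
        del L.derivation * V * U₀ - V * U₁) (n : ℕ) :
    (L.lamePQ n).1 * V = V * L.lameEig U₀ U₁ n ∧
    (L.lamePQ n).2 * V = del L.derivation * V * L.lameEig U₀ U₁ n -
      V * L.lameEig U₀ U₁ (n + 1) := by
  induction n with
  | zero => exact ⟨hP, hQ⟩
  | succ n ih =>
    have h1 : (L.lamePQ (n + 1)).1 =
        del L.derivation * (L.lamePQ n).1 - (L.lamePQ n).2 := by rw [del_mul]; rfl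
    have h2 : (L.lamePQ (n + 1)).2 = mulBy L.derivation (2 * L.wp) * (L.lamePQ n).1 -
        del L.derivation * (L.lamePQ n).2 := by rw [del_mul, ← sub_sub]; rfl
    refine ⟨?_, ?_⟩
    · rw [h1, sub_mul, mul_assoc, ih.1, ih.2]
      noncomm_ring
    · have h3 : L.lameEig U₀ U₁ (n + 1 + 1) = U₀ * L.lameEig U₀ U₁ n := rfl
      rw [h2, sub_mul, mul_assoc, mul_assoc, ih.1, ih.2, h3, ← mul_assoc V U₀, ← hP]
      noncomm_ring

theorem constOp_eq (c : ℂ) : L.constOp c = algebraMap ℂ L.PDO c := rfl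

section Tilde

variable {c : ℕ → ℂ} {x : L.holomorphicFun}

/-- The operator form of ℘⁽²ᵐ⁾ = R_m(℘). -/
theorem aeval_polyR (hx : L.derivation x = 1)
    (h1 : (4 : ℂ) • uOp L.derivation c 1 ^ 2 =
      (4 : ℂ) • uOp L.derivation c 0 ^ 3 - L.g₂ • uOp L.derivation c 0 - L.g₃ • 1)
    (h2 : (6 : ℂ) • uOp L.derivation c 2 =
      (6 : ℂ) • uOp L.derivation c 0 ^ 2 - (L.g₂ / 2) • 1) (m : ℕ) :
    Polynomial.aeval (uOp L.derivation c 0) (L.polyR m) =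
      ((2 * m + 1).factorial : ℂ) • uOp L.derivation c (2 * m) := by
  induction m with
  | zero => simp [polyR]
  | succ m ih =>
    -- Differentiating the induction hypothesis twice gives R_m'(U₂)·6U₄ + R_m''(U₂)·4U₃², and `h2`,
    -- `h1` turn this into the recursion defining R_{m+1}.
    have h3 := congrArg (adX L.derivation x) (congrArg (adX L.derivation x) ih)
    rw [adX_aeval _ hx, map_smul, map_smul, map_smul, adX_uOp _ hx, map_smul,
      adX_mul _ _ (commute_uOp_del _ c 1), adX_aeval _ hx, adX_uOp _ hx, adX_uOp _ hx] at h3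
    have h4 : Polynomial.aeval (uOp L.derivation c 0) (L.polyR (m + 1)) =
        ((6 : ℂ) • uOp L.derivation c 0 ^ 2 - (L.g₂ / 2) • 1) *
          Polynomial.aeval (uOp L.derivation c 0) (Polynomial.derivative (L.polyR m)) +
        ((4 : ℂ) • uOp L.derivation c 0 ^ 3 - L.g₂ • uOp L.derivation c 0 - L.g₃ • 1) *
          Polynomial.aeval (uOp L.derivation c 0)
            (Polynomial.derivative (Polynomial.derivative (L.polyR m))) := by
      rw [polyR, ← map_ofNat Polynomial.C 6, ← map_ofNat Polynomial.C 4]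
      simp only [map_add, map_sub, map_mul, map_pow, Polynomial.aeval_C, Polynomial.aeval_X,
        Algebra.smul_def, mul_one]
    rw [h4, ← h1, ← h2, smul_mul_assoc, smul_mul_assoc, pow_two,
      ← (commute_aeval_uOp L.derivation c _ 2).eq, mul_assoc (uOp _ _ 1),
      ← (commute_aeval_uOp L.derivation c _ 1).eq, ← mul_assoc (uOp _ _ 1),
      ← (commute_aeval_uOp L.derivation c _ 1).eq]
    have h5 : ((2 * (m + 1) + 1).factorial : ℂ) =
        ((2 * m + 1).factorial : ℂ) * (((2 * m : ℕ) : ℂ) + 2) * (((2 * m + 1 : ℕ) : ℂ) + 2) := by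
      rw [show 2 * (m + 1) + 1 = (2 * m + 1) + 1 + 1 by ring, Nat.factorial_succ,
        Nat.factorial_succ]
      push_cast
      ring
    rw [h5, mul_smul, mul_smul]
    refine Eq.trans ?_ h3
    simp only [smul_mul_assoc, mul_smul_comm, Nat.cast_one]
    module

theorem tildeP_even_mul {V : L.PDO} (hx : L.derivation x = 1)
    (h1 : (4 : ℂ) • uOp L.derivation c 1 ^ 2 =
      (4 : ℂ) • uOp L.derivation c 0 ^ 3 - L.g₂ • uOp L.derivation c 0 - L.g₃ • 1)
    (h2 : (6 : ℂ) • uOp L.derivation c 2 =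
      (6 : ℂ) • uOp L.derivation c 0 ^ 2 - (L.g₂ / 2) • 1)
    (hP : (del L.derivation ^ 2 - mulBy L.derivation (2 * L.wp)) * V = V * uOp L.derivation c 0)
    (hQ : (mulBy L.derivation L.wp * del L.derivation -
      mulBy L.derivation ((1 / 2 : ℂ) • L.derivation L.wp)) * V =
        del L.derivation * V * uOp L.derivation c 0 - V * uOp L.derivation c 1) (m : ℕ) :
    L.tildeP (2 * m + 2) * V = V * uOp L.derivation c (2 * m) := by
  have hPQ := L.lamePQ_mul hP hQ
  have hc : ∀ (r : ℂ) (P : L.PDO), algebraMap ℂ L.PDO r * (V * P) =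
      V * (algebraMap ℂ L.PDO r * P) := fun r P => by
    rw [← mul_assoc, Algebra.commutes, mul_assoc]
  have hm : (2 * m + 2) / 2 - 1 = m := by omega
  have hf : ((2 * m + 1).factorial : ℂ) ≠ 0 := by exact_mod_cast (2 * m + 1).factorial_ne_zero
  have key := L.aeval_polyR hx h1 h2 m
  rw [polyR_eq, map_mul, Polynomial.aeval_C, ← Algebra.smul_def] at key
  have key := smul_right_injective _ hf key
  simp only [map_add, map_sum, map_mul, map_pow, Polynomial.aeval_C, Polynomial.aeval_X] at key
  rw [tildeP, if_pos (by simp [Nat.even_add]), hm, lameP, Nat.add_sub_cancel, add_mul, add_mul,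
    (hPQ _).1, Finset.sum_mul, lameEig_even, ← key, mul_add, mul_add, Finset.mul_sum,
    constOp_eq, Algebra.commutes]
  congr 2
  refine Finset.sum_congr rfl fun j hj => ?_
  rw [Finset.mem_Ico] at hj
  rw [lameP, show 2 * j - 2 = 2 * (j - 1) by omega, constOp_eq, mul_assoc, (hPQ _).1, hc,
    lameEig_even, Nat.sub_add_cancel hj.1]

theorem tildeP_odd_mul {V : L.PDO} (hx : L.derivation x = 1)
    (h1 : (4 : ℂ) • uOp L.derivation c 1 ^ 2 =
      (4 : ℂ) • uOp L.derivation c 0 ^ 3 - L.g₂ • uOp L.derivation c 0 - L.g₃ • 1)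
    (h2 : (6 : ℂ) • uOp L.derivation c 2 =
      (6 : ℂ) • uOp L.derivation c 0 ^ 2 - (L.g₂ / 2) • 1)
    (hP : (del L.derivation ^ 2 - mulBy L.derivation (2 * L.wp)) * V = V * uOp L.derivation c 0)
    (hQ : (mulBy L.derivation L.wp * del L.derivation -
      mulBy L.derivation ((1 / 2 : ℂ) • L.derivation L.wp)) * V =
        del L.derivation * V * uOp L.derivation c 0 - V * uOp L.derivation c 1) (m : ℕ) :
    L.tildeP (2 * m + 1 + 2) * V = V * uOp L.derivation c (2 * m + 1) := by
  have hPQ := L.lamePQ_mul hP hQ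
  have hc : ∀ (r : ℂ) (P : L.PDO), algebraMap ℂ L.PDO r * (V * P) =
      V * (algebraMap ℂ L.PDO r * P) := fun r P => by
    rw [← mul_assoc, Algebra.commutes, mul_assoc]
  have hm : (2 * m + 1 + 2) / 2 - 1 = m := by omega
  have hm1 : (m : ℂ) + 1 ≠ 0 := Nat.cast_add_one_ne_zero m
  have hf : ((2 * m + 1).factorial : ℂ) ≠ 0 := by exact_mod_cast (2 * m + 1).factorial_ne_zero
  have h22 : ((2 * m : ℕ) : ℂ) + 2 ≠ 0 := by
    exact_mod_cast Nat.cast_add_one_ne_zero (R := ℂ) (2 * m + 1)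
  have h23 : (2 : ℂ) * ((m : ℂ) + 1) = ((2 * m : ℕ) : ℂ) + 2 := by push_cast; ring
  -- Differentiating the even identity once yields 2R_m'(U₂)U₃ = (2m+1)!(2m+2)U_{2m+3}; the weights
  -- j r_{m,j}/(m+1) come from R_m' after cancelling 2(m+1).
  have key := congrArg (adX L.derivation x) (L.aeval_polyR hx h1 h2 m)
  rw [adX_aeval _ hx, map_smul, adX_uOp _ hx, derivative_polyR_eq, map_mul, map_mul,
    Polynomial.aeval_C, Polynomial.aeval_C, ← Algebra.smul_def, ← Algebra.smul_def,
    smul_mul_assoc, smul_comm (2 : ℂ), smul_mul_assoc, smul_smul (2 : ℂ), h23] at key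
  have key := smul_right_injective _ h22 (smul_right_injective _ hf key)
  simp only [map_add, map_sum, map_mul, map_pow, Polynomial.aeval_C, Polynomial.aeval_X] at key
  rw [tildeP, if_neg (by simp [Nat.even_add]), hm, lameP, Nat.add_sub_cancel, add_mul,
    (hPQ _).1, Finset.sum_mul, lameEig_odd, ← key, add_mul, mul_add, Finset.sum_mul, Finset.mul_sum]
  congr 1
  refine Finset.sum_congr rfl fun j hj => ?_
  rw [Finset.mem_Ico] at hj
  rw [lameP, show 2 * j + 1 - 2 = 2 * (j - 1) + 1 by omega, constOp_eq, mul_assoc, (hPQ _).1, hc,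
    lameEig_odd, mul_assoc]

theorem tildeP_mul {V : L.PDO} (hx : L.derivation x = 1)
    (h1 : (4 : ℂ) • uOp L.derivation c 1 ^ 2 =
      (4 : ℂ) • uOp L.derivation c 0 ^ 3 - L.g₂ • uOp L.derivation c 0 - L.g₃ • 1)
    (h2 : (6 : ℂ) • uOp L.derivation c 2 =
      (6 : ℂ) • uOp L.derivation c 0 ^ 2 - (L.g₂ / 2) • 1)
    (hP : (del L.derivation ^ 2 - mulBy L.derivation (2 * L.wp)) * V = V * uOp L.derivation c 0)
    (hQ : (mulBy L.derivation L.wp * del L.derivation -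
      mulBy L.derivation ((1 / 2 : ℂ) • L.derivation L.wp)) * V =
        del L.derivation * V * uOp L.derivation c 0 - V * uOp L.derivation c 1) (n : ℕ) :
    L.tildeP (n + 2) * V = V * uOp L.derivation c n := by
  obtain ⟨m, rfl | rfl⟩ := n.even_or_odd'
  · exact L.tildeP_even_mul hx h1 h2 hP hQ m
  · exact L.tildeP_odd_mul hx h1 h2 hP hQ m

end Tilde

end PeriodPair

end

/-! ### From the intertwining relations to the KP hierarchy -/

noncomputable section

namespace PeriodPair

open PseudoDiffOp PowerSeries

variable (L : PeriodPair)

theorem opU_eq (n : ℕ) : L.opU n = uOp L.derivation L.laurentCoeff n := by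
  rw [opU, uOp, constSeries, ofSeries]
  congr 2
  funext m
  rw [coeff_map, uSeries, coeff_mk]

theorem constantCoeff_uSeries (c : ℕ → ℂ) (n : ℕ) :
    constantCoeff (uSeries c n) = c n / ((n : ℂ) + 1) := by
  have h1 : (n.factorial : ℂ) ≠ 0 := by exact_mod_cast n.factorial_ne_zero
  have h2 : (n : ℂ) + 1 ≠ 0 := Nat.cast_add_one_ne_zero n
  rw [← coeff_zero_eq_constantCoeff_apply, uSeries, coeff_mk, Nat.factorial_succ, zero_add]
  push_cast
  rw [Nat.factorial_zero, Nat.cast_one]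
  field_simp

variable {z x : L.holomorphicFun} {ζ₀ : ℂ⟦X⟧} {V : L.holomorphicFun⟦X⟧}

theorem tildeP_mul_ofSeries (hz : L.derivation z = -L.wp) (hx : L.derivation x = 1)
    (hp : (L.derivation L.wp) ^ 2 = 4 * L.wp ^ 3 - algebraMap ℂ _ L.g₂ * L.wp - algebraMap ℂ _ L.g₃)
    (hp2 : L.derivation (L.derivation L.wp) = 6 * L.wp ^ 2 - algebraMap ℂ _ (L.g₂ / 2))
    (hζ : constantCoeff ζ₀ = 0)
    (he : (-2 - X ^ 3 * derivative ℂ (derivative ℂ ζ₀)) ^ 2 =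
      4 * (1 - X ^ 2 * derivative ℂ ζ₀) ^ 3 - C L.g₂ * X ^ 4 * (1 - X ^ 2 * derivative ℂ ζ₀) -
        C L.g₃ * X ^ 6)
    (hu : uSeries L.laurentCoeff 0 = -derivative ℂ ζ₀)
    (hV : derivative _ V = logDerivSeries L.derivation z x ζ₀ * V) (hV0 : constantCoeff V = 1)
    (n : ℕ) :
    L.tildeP (n + 2) * ofSeries L.derivation V = ofSeries L.derivation V * L.opU n := by
  have he2 := second_order_of_first_order (e := -derivative ℂ ζ₀) (a := L.g₂) (b := L.g₃)
    (by rw [map_neg]; linear_combination he)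
  have d0 := derivative_uSeries L.laurentCoeff 0
  have d1 := derivative_uSeries L.laurentCoeff 1
  have c2 : C (2 : ℂ) = 2 := map_ofNat C 2
  have c3 : C (3 : ℂ) = 3 := map_ofNat C 3
  have ch : C (1 / 2 : ℂ) * 2 = 1 := by rw [← c2, ← map_mul]; norm_num
  rw [Nat.cast_zero, zero_add, zero_add, c2] at d0
  rw [Nat.cast_one, show (1 : ℂ) + 2 = 3 by norm_num, c3, show 1 + 1 = 2 from rfl] at d1
  -- Differentiating the series for n = 0 gives -2 times that for n = 1, so the symbol of U₃ is
  -- -½℘'(X), as the relation for Q₁ requires.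
  have hu1 : uSeries L.laurentCoeff 1 = C (1 / 2) * derivative ℂ (derivative ℂ ζ₀) := by
    rw [hu, map_neg] at d0
    linear_combination C (1 / 2) * d0 - uSeries L.laurentCoeff 1 * ch
  rw [opU_eq]
  refine L.tildeP_mul hx (uOp_one_sq _ ?_) (uOp_two _ ?_) ?_ ?_ n
  · rw [hu]
    rw [hu, map_neg] at d0
    linear_combination he - (-4 - 2 * X ^ 3 * uSeries L.laurentCoeff 1 - X ^ 3 *
      derivative ℂ (derivative ℂ ζ₀)) * X ^ 3 * d0
  · have h6 := congrArg (derivative ℂ) d0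
    have d2 : derivative ℂ (2 : ℂ⟦X⟧) = 0 := derivative_ofNat 2
    rw [map_neg, Derivation.leibniz, d2, d1, hu, smul_eq_mul, smul_eq_mul] at h6
    rw [hu]
    linear_combination he2 - X ^ 4 * h6
  · rw [uOp, hu]
    exact lame_ofSeries L.derivation hz hx hp hp2 hζ he hV hV0
  · rw [uOp, uOp, hu, hu1]
    exact lameQ_ofSeries L.derivation hz hx hp hp2 hζ he hV hV0

theorem stationary_of_series {v : ℕ → L.holomorphicFun}
    (hz : L.derivation z = -L.wp) (hx : L.derivation x = 1)
    (hp : (L.derivation L.wp) ^ 2 = 4 * L.wp ^ 3 - algebraMap ℂ _ L.g₂ * L.wp - algebraMap ℂ _ L.g₃)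
    (hp2 : L.derivation (L.derivation L.wp) = 6 * L.wp ^ 2 - algebraMap ℂ _ (L.g₂ / 2))
    (hζ : constantCoeff ζ₀ = 0)
    (he : (-2 - X ^ 3 * derivative ℂ (derivative ℂ ζ₀)) ^ 2 =
      4 * (1 - X ^ 2 * derivative ℂ ζ₀) ^ 3 - C L.g₂ * X ^ 4 * (1 - X ^ 2 * derivative ℂ ζ₀) -
        C L.g₃ * X ^ 6)
    (hu : uSeries L.laurentCoeff 0 = -derivative ℂ ζ₀)
    (hV : derivative _ V = logDerivSeries L.derivation z x ζ₀ * V) (hV0 : constantCoeff V = 1)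
    (hv : ∀ n, v n = PowerSeries.coeff n V) :
    let V₀ : L.PDO := ofSymbol L.derivation v
    let L₀ : L.PDO := V₀ * del L.derivation * Ring.inverse V₀
    v 0 = 1 ∧ IsUnit V₀ ∧ L₀.IsStationaryKP ∧
      ∀ n : ℕ,
        (L₀ ^ (n + 2)).nonnegPart =
          L.tildeP (n + 2) - L.constOp (L.laurentCoeff n / ((n : ℂ) + 1)) ∧
        (L₀ ^ (n + 2)).nonnegPart =
          V₀ * L.opU n * Ring.inverse V₀ - L.constOp (L.laurentCoeff n / ((n : ℂ) + 1)) := by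
  intro V₀ L₀
  have hV₀ : V₀ = ofSeries L.derivation V := by
    simp only [V₀, ofSeries]; congr 1; funext n; exact hv n
  obtain ⟨t, ht, h1, h2⟩ := exists_ofSeries_inverse (D := L.derivation) hV0
  rw [← hV₀] at h1 h2
  let u : L.PDOˣ := ⟨V₀, ofSeries L.derivation t, h1, h2⟩
  have hinv : Ring.inverse V₀ = ofSeries L.derivation t := Ring.inverse_unit u
  have hL : L₀ = V₀ * del L.derivation * ofSeries L.derivation t := by simp only [L₀, hinv]
  have hpow : ∀ n, L₀ ^ n = V₀ * del L.derivation ^ n * ofSeries L.derivation t := fun n => by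
    rw [hL]; exact Units.conj_pow u _ n
  have htilde : ∀ n, L.tildeP (n + 2) = V₀ * L.opU n * ofSeries L.derivation t := fun n => by
    have := L.tildeP_mul_ofSeries hz hx hp hp2 hζ he hu hV hV0 n
    rw [← hV₀] at this
    rw [← this, mul_assoc, h1, mul_one]
  have hnonneg : ∀ n, (L₀ ^ (n + 2)).nonnegPart =
      L.tildeP (n + 2) - L.constOp (L.laurentCoeff n / ((n : ℂ) + 1)) := fun n => by
    -- Conjugating U_{n+2} = ∂^{n+2} + u by V₀ gives L₀^{n+2} plus an operator of order at most
    -- zero; its leading coefficient is that of u, since V₀ and V₀⁻¹ both start with 1.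
    have h3 : L₀ ^ (n + 2) = L.tildeP (n + 2) - ofSeries L.derivation (seriesMul L.derivation
        (V * map (algebraMap ℂ L.holomorphicFun) (uSeries L.laurentCoeff n)) t) := by
      rw [htilde, hpow, opU_eq, uOp, ← ofSeries_mul_ofSeries, ← ofSeries_mul_constSeries, ← hV₀]
      noncomm_ring
    rw [h3, nonnegPart_sub, (L.tildeP_isDifferential _).nonnegPart, nonnegPart_ofSeries,
      constantCoeff_seriesMul, ht, mul_one, map_mul, hV0, one_mul,
      ← coeff_zero_eq_constantCoeff_apply, coeff_map, coeff_zero_eq_constantCoeff_apply,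
      constantCoeff_uSeries]
    rfl
  have hone : constantCoeff V = v 0 := by rw [hv, coeff_zero_eq_constantCoeff_apply]
  refine ⟨by rw [← hone, hV0], ⟨u, rfl⟩, ⟨?_, fun n => ?_⟩, fun n => ⟨hnonneg n, ?_⟩⟩
  -- From ∂V₀ = V₀∂ + V₀' one gets L₀ = ∂ - V₀'V₀⁻¹; the constant term 1 of V has zero derivative,
  -- so no term of order zero appears.
  · have hL' : L₀ = del L.derivation - ofSeries L.derivation (seriesMul L.derivation
        (mapSeries L.derivation V) t) := by
      have h3 := del_mul_ofSeries (D := L.derivation) V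
      rw [← hV₀] at h3
      rw [hL, eq_sub_of_add_eq h3.symm, sub_mul, mul_assoc, h1, mul_one, ofSeries_mul_ofSeries]
    rw [hL']
    refine ⟨fun n hn => ?_, ?_, ?_⟩
    · rw [coeff_sub, coeff_ofSeries_of_pos _ (by omega), sub_zero]
      rw [del, PseudoDiffOp.coeff_monomial, if_neg hn.ne']
    · rw [coeff_sub, coeff_ofSeries_of_pos _ (by omega), sub_zero]
      rw [del, PseudoDiffOp.coeff_monomial, if_pos rfl]
    · rw [coeff_sub, coeff_ofSeries_zero, constantCoeff_seriesMul,
        ← coeff_zero_eq_constantCoeff_apply, coeff_mapSeries, coeff_zero_eq_constantCoeff_apply,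
        hV0, Derivation.map_one_eq_zero, zero_mul, sub_zero,
        del, PseudoDiffOp.coeff_monomial, if_neg (by omega)]
  · rw [hnonneg, htilde, Ring.lie_def, sub_eq_zero]
    have hc : Commute (L.opU n) (del L.derivation) := by
      rw [opU_eq]; exact commute_uOp_del _ _ _
    have h4 : Commute (V₀ * L.opU n * ofSeries L.derivation t) L₀ := by
      rw [hL, Commute, SemiconjBy]
      calc _ = V₀ * L.opU n * (ofSeries L.derivation t * V₀) * del L.derivation *
            ofSeries L.derivation t := by noncomm_ring
        _ = V₀ * del L.derivation * (ofSeries L.derivation t * V₀) * L.opU n *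
            ofSeries L.derivation t := by
          rw [h2, mul_one, mul_one, mul_assoc V₀, hc.eq, mul_assoc V₀ (del _)]
        _ = _ := by noncomm_ring
    exact (h4.sub_left (by rw [constOp_eq]; exact Algebra.commute_algebraMap_left _ _)).eq
  · rw [hnonneg, htilde, hinv]

end PeriodPair

end

/-! ### Taylor series of analytic functions at 0 -/

noncomputable section

open PowerSeries Filter Topology

/-- The Taylor series at `0` of a function. -/
def taylorSeries (f : ℂ → ℂ) : ℂ⟦X⟧ :=
  PowerSeries.mk fun n => iteratedDeriv n f 0 / (n.factorial : ℂ)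

namespace taylorSeries

variable {f g : ℂ → ℂ}

theorem coeff_eq (f : ℂ → ℂ) (n : ℕ) :
    PowerSeries.coeff n (taylorSeries f) = iteratedDeriv n f 0 / (n.factorial : ℂ) := coeff_mk _ _

theorem constantCoeff_eq (f : ℂ → ℂ) : constantCoeff (taylorSeries f) = f 0 := by
  rw [← coeff_zero_eq_constantCoeff_apply, coeff_eq]; simp

theorem congr (h : f =ᶠ[𝓝 0] g) : taylorSeries f = taylorSeries g := by
  ext n; rw [coeff_eq, coeff_eq, h.iteratedDeriv_eq]

theorem mul (hf : AnalyticAt ℂ f 0) (hg : AnalyticAt ℂ g 0) :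
    taylorSeries (fun z => f z * g z) = taylorSeries f * taylorSeries g := by
  ext
  simp only [coeff_eq, iteratedDeriv_fun_mul hf.contDiffAt hg.contDiffAt, PowerSeries.coeff_mul,
    Finset.Nat.sum_antidiagonal_eq_sum_range_succ_mk, Nat.succ_eq_add_one, Finset.sum_div]
  refine Finset.sum_congr rfl fun i hi ↦ ?_
  rw [Nat.cast_choose _ (by grind)]
  field_simp [Nat.factorial_ne_zero]

theorem sub (hf : AnalyticAt ℂ f 0) (hg : AnalyticAt ℂ g 0) :
    taylorSeries (fun z => f z - g z) = taylorSeries f - taylorSeries g := by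
  ext n
  rw [map_sub, coeff_eq, coeff_eq, coeff_eq, ← sub_div]
  congr 1
  exact iteratedDeriv_sub hf.contDiffAt hg.contDiffAt

theorem add (hf : AnalyticAt ℂ f 0) (hg : AnalyticAt ℂ g 0) :
    taylorSeries (fun z => f z + g z) = taylorSeries f + taylorSeries g := by
  ext n
  rw [map_add, coeff_eq, coeff_eq, coeff_eq, ← add_div]
  congr 1
  exact iteratedDeriv_add hf.contDiffAt hg.contDiffAt

theorem neg (f : ℂ → ℂ) : taylorSeries (fun z => -f z) = -taylorSeries f := by
  ext n
  rw [map_neg, coeff_eq, coeff_eq, ← neg_div, iteratedDeriv_fun_neg]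

theorem const_mul (c : ℂ) (f : ℂ → ℂ) :
    taylorSeries (fun z => c * f z) = C c * taylorSeries f := by
  ext n
  rw [coeff_C_mul, coeff_eq, coeff_eq, iteratedDeriv_const_mul_field, mul_div_assoc]

theorem const (c : ℂ) : taylorSeries (fun _ => c) = C c := by
  ext n
  rw [coeff_eq, coeff_C, iteratedDeriv_const]
  split_ifs with h
  · simp [h]
  · simp

theorem pow_id (m : ℕ) : taylorSeries (fun z => z ^ m) = X ^ m := by
  ext n
  rw [coeff_eq, coeff_X_pow, iteratedDeriv_fun_pow_zero]
  split_ifs with h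
  · subst h
    rw [div_self]
    exact_mod_cast n.factorial_ne_zero
  · simp

theorem pow (hf : AnalyticAt ℂ f 0) (m : ℕ) :
    taylorSeries (fun z => f z ^ m) = taylorSeries f ^ m := by
  induction m with
  | zero => simp only [pow_zero, const, map_one]
  | succ m ih => simp only [pow_succ, mul (hf.fun_pow m) hf, ih]

theorem deriv (f : ℂ → ℂ) : taylorSeries (deriv f) = derivative ℂ (taylorSeries f) := by
  ext n
  have h1 : (n.factorial : ℂ) ≠ 0 := by exact_mod_cast n.factorial_ne_zero
  have h2 : (n : ℂ) + 1 ≠ 0 := Nat.cast_add_one_ne_zero n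
  rw [coeff_derivative, coeff_eq, coeff_eq, iteratedDeriv_succ', Nat.factorial_succ]
  push_cast
  field_simp

theorem eventually_hasSum (hf : AnalyticAt ℂ f 0) : ∀ᶠ z in 𝓝 0,
    HasSum (fun n => PowerSeries.coeff n (taylorSeries f) * z ^ n) (f z) := by
  have h := hasFPowerSeriesAt_iff.mp hf.hasFPowerSeriesAt
  filter_upwards [h] with z hz
  convert! hz using 2 with n
  · rw [FormalMultilinearSeries.coeff_ofScalars, coeff_eq, smul_eq_mul, mul_comm]
  · rw [zero_add]

/-- The sum is assumed only off 0, matching large finite λ. Redefining f at 0 as c₀ gives an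
analytic function, and continuity forces c₀ = f(0). -/
theorem eq_coeff_of_eventually_hasSum (hf : AnalyticAt ℂ f 0) {c : ℕ → ℂ}
    (hc : ∀ᶠ z in 𝓝[≠] 0, HasSum (fun n => c n * z ^ n) (f z)) (n : ℕ) :
    c n = PowerSeries.coeff n (taylorSeries f) := by
  have h1 : HasFPowerSeriesAt (fun z => if z = 0 then c 0 else f z)
      (FormalMultilinearSeries.ofScalars ℂ c) 0 := by
    rw [hasFPowerSeriesAt_iff]
    rw [eventually_nhdsWithin_iff] at hc
    filter_upwards [hc] with z hz
    simp only [FormalMultilinearSeries.coeff_ofScalars, zero_add, smul_eq_mul]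
    split_ifs with h0
    · subst h0
      convert! hasSum_single (f := fun n => (0 : ℂ) ^ n * c n) 0 ?_
      · simp
      · intro n hn; simp [hn]
    · simpa only [mul_comm] using hz h0
  have h2 : (fun z => if z = 0 then c 0 else f z) =ᶠ[𝓝 0] f := by
    rw [← h1.continuousAt.eventuallyEq_nhds_iff_eventuallyEq_nhdsNE hf.continuousAt]
    filter_upwards [self_mem_nhdsWithin] with z hz using if_neg hz
  have h3 := congrArg (FormalMultilinearSeries.coeff · n)
    (h1.eq_formalMultilinearSeries_of_eventually hf.hasFPowerSeriesAt h2)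
  simpa only [FormalMultilinearSeries.coeff_ofScalars, coeff_eq] using h3

end taylorSeries

/-! ### The differential equations of ℘, at the pole and off the lattice -/

namespace PeriodPair

open PseudoDiffOp

variable (L : PeriodPair)

theorem eventually_mem_compl_diff : ∀ᶠ z in 𝓝 (0 : ℂ), z ∈ ((L.lattice : Set ℂ) \ {0})ᶜ :=
  L.compl_lattice_sdiff_singleton_mem_nhds 0

theorem eventually_notMem_lattice : ∀ᶠ z in 𝓝[≠] (0 : ℂ), z ∉ L.lattice := by
  rw [eventually_nhdsWithin_iff]
  filter_upwards [L.eventually_mem_compl_diff] with z hz h0 hm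
  exact hz ⟨hm, h0⟩

theorem deriv_weierstrassPExcept_zero_eventuallyEq :
    deriv (L.weierstrassPExcept 0) =ᶠ[𝓝 0] L.derivWeierstrassPExcept 0 := by
  filter_upwards [L.eventually_mem_compl_diff] with z hz
  exact L.eqOn_deriv_weierstrassPExcept_derivWeierstrassPExcept 0 hz

theorem weierstrassP_eq (z : ℂ) : L.weierstrassP z = 1 / z ^ 2 + L.weierstrassPExcept 0 z := by
  have := L.weierstrassPExcept_add 0 z
  rw [← this]
  simp [add_comm]

theorem derivWeierstrassP_eq (z : ℂ) :
    L.derivWeierstrassP z = -2 / z ^ 3 + L.derivWeierstrassPExcept 0 z := by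
  have := L.derivWeierstrassPExcept_sub 0 z
  rw [← this]
  simp only [ZeroMemClass.coe_zero, sub_zero]
  ring

/-- Multiplying the differential equation of ℘ by z⁶ removes the poles, and the result also holds at
z = 0. -/
theorem eventually_weierstrassPExcept_relation : ∀ᶠ z in 𝓝 (0 : ℂ),
    (-2 + z ^ 3 * deriv (L.weierstrassPExcept 0) z) ^ 2 =
      4 * (1 + z ^ 2 * L.weierstrassPExcept 0 z) ^ 3 -
        L.g₂ * (z ^ 4 * (1 + z ^ 2 * L.weierstrassPExcept 0 z)) - L.g₃ * z ^ 6 := by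
  filter_upwards [L.eventually_mem_compl_diff, L.deriv_weierstrassPExcept_zero_eventuallyEq]
    with z hz hd
  by_cases h0 : z = 0
  · subst h0; norm_num
  · have hm : z ∉ L.lattice := fun hm => hz ⟨hm, h0⟩
    have key := L.derivWeierstrassP_sq z hm
    rw [derivWeierstrassP_eq, weierstrassP_eq] at key
    have h3 : -2 + z ^ 3 * L.derivWeierstrassPExcept 0 z =
        z ^ 3 * (-2 / z ^ 3 + L.derivWeierstrassPExcept 0 z) := by field_simp
    have h4 : 1 + z ^ 2 * L.weierstrassPExcept 0 z =
        z ^ 2 * (1 / z ^ 2 + L.weierstrassPExcept 0 z) := by field_simp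
    rw [hd, h3, h4]
    linear_combination z ^ 6 * key

theorem taylorSeries_weierstrassPExcept_relation :
    (-2 + X ^ 3 * derivative ℂ (taylorSeries (L.weierstrassPExcept 0))) ^ 2 =
      4 * (1 + X ^ 2 * taylorSeries (L.weierstrassPExcept 0)) ^ 3 -
        C L.g₂ * X ^ 4 * (1 + X ^ 2 * taylorSeries (L.weierstrassPExcept 0)) -
          C L.g₃ * X ^ 6 := by
  have h := taylorSeries.congr L.eventually_weierstrassPExcept_relation
  have he := L.analyticAt_weierstrassPExcept 0
  have hd := he.deriv
  have hz : ∀ n : ℕ, AnalyticAt ℂ (fun z : ℂ => z ^ n) 0 := fun n => analyticAt_id.fun_pow n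
  have hc : ∀ c : ℂ, AnalyticAt ℂ (fun _ : ℂ => c) 0 := fun c => analyticAt_const
  have a1 := (hz 3).fun_mul hd
  have a2 := (hz 2).fun_mul he
  have a3 := (hc 1).fun_add a2
  rw [taylorSeries.pow ((hc (-2)).fun_add a1), taylorSeries.add (hc (-2)) a1,
    taylorSeries.mul (hz 3) hd, taylorSeries.sub (((hc 4).fun_mul (a3.fun_pow 3)).fun_sub
      ((hc L.g₂).fun_mul ((hz 4).fun_mul a3))) ((hc L.g₃).fun_mul (hz 6)),
    taylorSeries.sub ((hc 4).fun_mul (a3.fun_pow 3)) ((hc L.g₂).fun_mul ((hz 4).fun_mul a3)),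
    taylorSeries.const_mul, taylorSeries.const_mul, taylorSeries.const_mul, taylorSeries.pow a3,
    taylorSeries.mul (hz 4) a3, taylorSeries.add (hc 1) a2, taylorSeries.mul (hz 2) he,
    taylorSeries.const, taylorSeries.const, taylorSeries.pow_id, taylorSeries.pow_id,
    taylorSeries.pow_id, taylorSeries.pow_id, taylorSeries.deriv, map_one, map_neg,
    map_ofNat, map_ofNat] at h
  linear_combination h

theorem coeff_taylorSeries_weierstrassPExcept (n : ℕ) :
    PowerSeries.coeff n (taylorSeries (L.weierstrassPExcept 0)) = L.laurentCoeff n :=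
  taylorSeries.coeff_eq _ n

theorem neg_one_pow_mul_laurentCoeff (n : ℕ) : (-1) ^ n * L.laurentCoeff n = L.laurentCoeff n := by
  have h := iteratedDeriv_comp_neg n (L.weierstrassPExcept 0) (0 : ℂ)
  have h2 : (fun z => L.weierstrassPExcept 0 (-z)) = L.weierstrassPExcept 0 := by
    funext z
    have := L.weierstrassPExcept_neg 0 z
    rwa [neg_zero] at this
  rw [h2, neg_zero, smul_eq_mul] at h
  rw [laurentCoeff, ← mul_div_assoc, ← h]

/-- The signs (-1)ᵐ disappear because ℘ is even. -/
theorem uSeries_laurentCoeff_zero :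
    uSeries L.laurentCoeff 0 = taylorSeries (L.weierstrassPExcept 0) := by
  rw [uSeries_zero]
  ext n
  rw [coeff_mk, neg_one_pow_mul_laurentCoeff, coeff_taylorSeries_weierstrassPExcept]

theorem isConnected_compl_lattice : IsConnected ((L.lattice : Set ℂ)ᶜ) := by
  refine Set.Countable.isConnected_compl_of_one_lt_rank ?_ ?_
  · rw [Complex.rank_real_complex]; norm_num
  · have : Countable L.lattice := L.latticeEquivProd.injective.countable
    exact Set.to_countable _

/-- Near the pole, z³℘'(z) tends to -2. -/
theorem exists_derivWeierstrassP_ne_zero : ∃ z ∉ L.lattice, L.derivWeierstrassP z ≠ 0 := by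
  have hc : ContinuousAt (fun z => -2 + z ^ 3 * L.derivWeierstrassPExcept 0 z) 0 :=
    continuousAt_const.add ((continuousAt_id.pow 3).mul
      (L.analyticAt_derivWeierstrassPExcept 0).continuousAt)
  have h1 : ∀ᶠ z in 𝓝 (0 : ℂ), -2 + z ^ 3 * L.derivWeierstrassPExcept 0 z ≠ 0 :=
    hc.eventually_ne (by norm_num)
  obtain ⟨z, ⟨hz, hm⟩, h0⟩ := (((h1.filter_mono nhdsWithin_le_nhds).and
    L.eventually_notMem_lattice).and self_mem_nhdsWithin).exists (f := 𝓝[≠] (0 : ℂ))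
  refine ⟨z, hm, fun h => hz ?_⟩
  rw [derivWeierstrassP_eq] at h
  have h0 : z ≠ 0 := h0
  have h3 : -2 + z ^ 3 * L.derivWeierstrassPExcept 0 z =
      z ^ 3 * (-2 / z ^ 3 + L.derivWeierstrassPExcept 0 z) := by field_simp
  rw [h3, h, mul_zero]

theorem hasDerivAt_weierstrassP {z : ℂ} (hz : z ∉ L.lattice) :
    HasDerivAt L.weierstrassP (L.derivWeierstrassP z) z := by
  rw [← deriv_weierstrassP]
  exact (L.differentiableOn_weierstrassP.differentiableAt
    (L.isClosed_lattice.isOpen_compl.mem_nhds hz)).hasDerivAt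

/-- `℘″ = 6 ℘² - g₂ / 2`. -/
theorem deriv_derivWeierstrassP {z : ℂ} (hz : z ∉ L.lattice) :
    deriv L.derivWeierstrassP z = 6 * L.weierstrassP z ^ 2 - L.g₂ / 2 := by
  have han : AnalyticOnNhd ℂ (fun z => deriv L.derivWeierstrassP z -
      (6 * L.weierstrassP z ^ 2 - L.g₂ / 2)) (L.lattice : Set ℂ)ᶜ := fun w hw =>
    (L.analyticOnNhd_derivWeierstrassP w hw).deriv.fun_sub
      ((analyticAt_const.fun_mul ((L.analyticOnNhd_weierstrassP w hw).fun_pow 2)).fun_sub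
        analyticAt_const)
  obtain ⟨w, hw, hw0⟩ := L.exists_derivWeierstrassP_ne_zero
  have hopen := L.isClosed_lattice.isOpen_compl
  -- Differentiating the first-order equation and cancelling 2℘' works near a point where ℘' ≠ 0;
  -- the identity theorem on the connected complement of the lattice does the rest.
  have hev : ∀ᶠ y in 𝓝 w, deriv L.derivWeierstrassP y -
      (6 * L.weierstrassP y ^ 2 - L.g₂ / 2) = 0 := by
    filter_upwards [hopen.mem_nhds hw,
      (L.analyticOnNhd_derivWeierstrassP w hw).continuousAt.eventually_ne hw0] with y hy hy0
    have h1 : (fun z => L.derivWeierstrassP z ^ 2) =ᶠ[𝓝 y]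
        fun z => 4 * L.weierstrassP z ^ 3 - L.g₂ * L.weierstrassP z - L.g₃ := by
      filter_upwards [hopen.mem_nhds hy] with u hu using L.derivWeierstrassP_sq u hu
    have hP := L.hasDerivAt_weierstrassP hy
    have hP' := (L.analyticOnNhd_derivWeierstrassP y hy).differentiableAt.hasDerivAt
    have h2 := h1.deriv_eq
    rw [(hP'.fun_pow 2).deriv,
      ((((hP.fun_pow 3).const_mul 4).fun_sub (hP.const_mul L.g₂)).sub_const L.g₃).deriv] at h2
    refine mul_left_cancel₀ (mul_ne_zero two_ne_zero hy0) ?_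
    push_cast at h2
    linear_combination h2
  have := han.eqOn_zero_of_preconnected_of_eventuallyEq_zero
    L.isConnected_compl_lattice.isPreconnected hw hev hz
  exact sub_eq_zero.mp this

theorem derivation_apply_of_eq {f : L.holomorphicFun} {F : ℂ → ℂ}
    (h : ∀ z : ((L.lattice : Set ℂ)ᶜ : Set ℂ), f.1 z = F z)
    (z : ((L.lattice : Set ℂ)ᶜ : Set ℂ)) : (L.derivation f).1 z = deriv F z :=
  L.deriv_extendZero h z

theorem iterate_derivation_apply {f : L.holomorphicFun} {F : ℂ → ℂ}
    (h : ∀ z : ((L.lattice : Set ℂ)ᶜ : Set ℂ), f.1 z = F z) (n : ℕ)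
    (z : ((L.lattice : Set ℂ)ᶜ : Set ℂ)) : (L.derivation^[n] f).1 z = iteratedDeriv n F z := by
  induction n generalizing z with
  | zero => rw [Function.iterate_zero_apply, h, iteratedDeriv_zero]
  | succ n ih => rw [Function.iterate_succ_apply', L.derivation_apply_of_eq ih, iteratedDeriv_succ]

theorem derivation_wp_apply (z : ((L.lattice : Set ℂ)ᶜ : Set ℂ)) :
    (L.derivation L.wp).1 z = L.derivWeierstrassP z := by
  rw [L.derivation_apply_of_eq (F := L.weierstrassP) (fun _ => rfl), deriv_weierstrassP]

theorem derivation_wp_sq : (L.derivation L.wp) ^ 2 =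
    4 * L.wp ^ 3 - algebraMap ℂ _ L.g₂ * L.wp - algebraMap ℂ _ L.g₃ := by
  refine Subtype.ext <| funext fun z => ?_
  have h := L.derivWeierstrassP_sq z z.2
  rw [← derivation_wp_apply] at h
  exact h

theorem derivation_derivation_wp : L.derivation (L.derivation L.wp) =
    6 * L.wp ^ 2 - algebraMap ℂ _ (L.g₂ / 2) := by
  refine Subtype.ext <| funext fun z => ?_
  rw [L.derivation_apply_of_eq L.derivation_wp_apply]
  exact L.deriv_derivWeierstrassP z.2

end PeriodPair

end

noncomputable section

open Filter Topology

namespace PeriodPair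

variable (L : PeriodPair)

/-! ### The Weierstrass zeta function -/

/-- The function `ζ(z) - 1/z`, holomorphic at `0`. -/
def zetaReg (z : ℂ) : ℂ :=
  ∑' l : L.lattice, if (l : ℂ) = 0 then 0 else (1 / (z - l) + 1 / (l : ℂ) + z / (l : ℂ) ^ 2)

/-- The three terms combine to s²/(l²(s - l)), and |s - l| ≥ |l|/2. -/
theorem norm_zeta_term_le (r : ℝ) (hr : 0 < r) (s : ℂ) (hs : ‖s‖ < r) (l : ℂ)
    (h : 2 * r ≤ ‖l‖) :
    ‖1 / (s - l) + 1 / l + s / l ^ 2‖ ≤ 2 * r ^ 2 * ‖l‖ ^ (-3 : ℝ) := by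
  have hl : 0 < ‖l‖ := by linarith
  have hl0 : l ≠ 0 := norm_pos_iff.mp hl
  have hsl : ‖l‖ / 2 ≤ ‖s - l‖ := by
    rw [norm_sub_rev]
    exact le_trans (by linarith) (norm_sub_norm_le l s)
  have hsl0 : s - l ≠ 0 := norm_pos_iff.mp (by linarith)
  have e : 1 / (s - l) + 1 / l + s / l ^ 2 = s ^ 2 / (l ^ 2 * (s - l)) := by
    field_simp
    ring
  have e2 : 2 * r ^ 2 * ‖l‖ ^ (-3 : ℝ) = r ^ 2 / (‖l‖ ^ 2 * (‖l‖ / 2)) := by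
    rw [show (-3 : ℝ) = ((-3 : ℤ) : ℝ) by norm_num, Real.rpow_intCast, zpow_neg]
    norm_cast
    field_simp
  rw [e, e2, norm_div, norm_mul, norm_pow, norm_pow]
  gcongr

theorem summable_norm_rpow_neg_three :
    Summable fun l : L.lattice => ‖(l : ℂ)‖ ^ (-3 : ℝ) :=
  ZLattice.summable_norm_rpow _ _ (by simp; norm_num)

theorem hasSumLocallyUniformly_zetaReg : HasSumLocallyUniformly
    (fun (l : L.lattice) (z : ℂ) => if (l : ℂ) = 0 then 0 else
      (1 / (z - l) + 1 / (l : ℂ) + z / (l : ℂ) ^ 2)) L.zetaReg := by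
  refine L.hasSumLocallyUniformly_aux (u := fun r l => 2 * r ^ 2 * ‖(l : ℂ)‖ ^ (-3 : ℝ)) _
    (fun _ _ => L.summable_norm_rpow_neg_three.mul_left _) fun r hr =>
    eventually_atTop.mpr ⟨2 * r, ?_⟩
  rintro _ h s hs l rfl
  split_ifs
  · rw [norm_zero]; positivity
  · exact norm_zeta_term_le r hr s hs l h

theorem hasSum_zetaReg (z : ℂ) : HasSum (fun l : L.lattice => if (l : ℂ) = 0 then 0 else
    (1 / (z - l) + 1 / (l : ℂ) + z / (l : ℂ) ^ 2)) (L.zetaReg z) :=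
  L.hasSumLocallyUniformly_zetaReg.hasSum

theorem hasDerivAt_zeta_term {z l : ℂ} (hz : z - l ≠ 0) :
    HasDerivAt (fun z => 1 / (z - l) + 1 / l + z / l ^ 2) (-(1 / (z - l) ^ 2 - 1 / l ^ 2)) z := by
  have h := ((((hasDerivAt_id z).sub_const l).fun_inv hz).add_const (1 / l)).fun_add
    ((hasDerivAt_id z).div_const (l ^ 2))
  simp only [id, inv_eq_one_div] at h
  convert! h using 1
  ring

theorem hasDerivAt_zetaReg_term (l : L.lattice) {z : ℂ} (hz : z ∈ ((L.lattice : Set ℂ) \ {0})ᶜ) :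
    HasDerivAt (fun z => if (l : ℂ) = 0 then 0 else
      (1 / (z - l) + 1 / (l : ℂ) + z / (l : ℂ) ^ 2))
      (-if (l : ℂ) = 0 then 0 else (1 / (z - l) ^ 2 - 1 / (l : ℂ) ^ 2)) z := by
  split_ifs with h
  · simpa using! hasDerivAt_const z (0 : ℂ)
  · refine hasDerivAt_zeta_term fun e => hz ?_
    rw [sub_eq_zero.mp e]
    exact ⟨l.2, h⟩

/-- Locally uniform convergence permits termwise differentiation, which produces minus the series of
℘ without its pole at 0. -/
theorem hasDerivAt_zetaReg {z : ℂ} (hz : z ∈ ((L.lattice : Set ℂ) \ {0})ᶜ) :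
    HasDerivAt L.zetaReg (-L.weierstrassPExcept 0 z) z := by
  have hd : ∀ᶠ s : Finset L.lattice in atTop, DifferentiableOn ℂ
      (fun z => ∑ l ∈ s, if (l : ℂ) = 0 then 0 else
        (1 / (z - l) + 1 / (l : ℂ) + z / (l : ℂ) ^ 2)) ((L.lattice : Set ℂ) \ {0})ᶜ :=
    .of_forall fun s => .fun_sum fun i _ => fun w hw =>
      (L.hasDerivAt_zetaReg_term i hw).differentiableAt.differentiableWithinAt
  have ht := L.hasSumLocallyUniformly_zetaReg.hasSumLocallyUniformlyOn
    (s := ((L.lattice : Set ℂ) \ {0})ᶜ)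
  have hdiff := ht.differentiableOn hd L.isOpen_compl_lattice_sdiff
  have h1 := (L.hasSumLocallyUniformly_zetaReg.tendstoLocallyUniformlyOn.deriv hd
    L.isOpen_compl_lattice_sdiff).tendsto_at hz
  have h2 := (L.hasSum_weierstrassPExcept 0 z).neg
  have h3 : deriv L.zetaReg z = -L.weierstrassPExcept 0 z := by
    refine tendsto_nhds_unique h1 ?_
    refine h2.congr fun s => ?_
    exact (HasDerivAt.fun_sum fun i _ => L.hasDerivAt_zetaReg_term i hz).deriv.symm
  rw [← h3]
  exact (hdiff.differentiableAt (L.isOpen_compl_lattice_sdiff.mem_nhds hz)).hasDerivAt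

theorem zetaReg_zero : L.zetaReg 0 = 0 := by
  rw [zetaReg]
  refine (tsum_congr fun l => ?_).trans tsum_zero
  split_ifs
  · rfl
  · rw [zero_sub, zero_div, div_neg, add_zero, neg_add_cancel]

theorem analyticAt_zetaReg : AnalyticAt ℂ L.zetaReg 0 := by
  refine Complex.analyticAt_iff_eventually_differentiableAt.mpr ?_
  filter_upwards [L.eventually_mem_compl_diff] with z hz
    using (L.hasDerivAt_zetaReg hz).differentiableAt

theorem summable_weierstrassZeta (z : ℂ) :
    Summable fun l : L.lattice => 1 / (z - l) + 1 / (l : ℂ) + z / (l : ℂ) ^ 2 := by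
  refine (L.hasSum_zetaReg z).summable.congr_cofinite ?_
  refine (Set.finite_singleton (0 : L.lattice)).subset fun l hl => ?_
  by_contra h
  exact hl (if_neg fun h0 => h (Subtype.ext h0))

theorem weierstrassZeta_eq (z : ℂ) : L.weierstrassZeta z = 1 / z + L.zetaReg z := by
  rw [weierstrassZeta, (L.summable_weierstrassZeta z).tsum_eq_add_tsum_ite (0 : L.lattice), zetaReg]
  congr 1
  · simp
  · exact tsum_congr fun l => by simp only [← ZeroMemClass.coe_eq_zero]

theorem hasDerivAt_weierstrassZeta {z : ℂ} (hz : z ∉ L.lattice) :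
    HasDerivAt L.weierstrassZeta (-L.weierstrassP z) z := by
  have h0 : z ≠ 0 := fun h => hz (h ▸ L.lattice.zero_mem)
  have h := (hasDerivAt_inv h0).fun_add (L.hasDerivAt_zetaReg (z := z) fun h => hz h.1)
  have e : L.weierstrassZeta = fun z => z⁻¹ + L.zetaReg z :=
    funext fun z => by rw [weierstrassZeta_eq, one_div]
  rw [e, weierstrassP_eq]
  convert! h using 1
  ring

theorem differentiableOn_weierstrassZeta :
    DifferentiableOn ℂ L.weierstrassZeta (L.lattice : Set ℂ)ᶜ := fun _ hz =>
  (L.hasDerivAt_weierstrassZeta hz).differentiableAt.differentiableWithinAt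

/-! ### The Weierstrass sigma function -/

/-- The factor of the product defining `σ` that belongs to the lattice point `l`. -/
def sigmaFactor (l z : ℂ) : ℂ :=
  (1 - z / l) * Complex.exp (z / l + z ^ 2 / (2 * l ^ 2))

theorem hasDerivAt_primary (u : ℂ) : HasDerivAt (fun u => (1 - u) * Complex.exp (u + u ^ 2 / 2))
    (-u ^ 2 * Complex.exp (u + u ^ 2 / 2)) u := by
  have h1 : HasDerivAt (fun u : ℂ => 1 - u) (-1) u := (hasDerivAt_id u).const_sub 1
  have h2 : HasDerivAt (fun u : ℂ => u + u ^ 2 / 2) (1 + u) u := by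
    convert! (hasDerivAt_id u).fun_add ((hasDerivAt_pow 2 u).div_const 2) using 1
    push_cast
    ring
  convert! h1.fun_mul h2.cexp using 1
  ring

/-- The derivative of the primary factor is -u²exp(u + u²/2), so the mean value inequality gives
cubic decay; the constant e² comes from |v + v²/2| ≤ 2. -/
theorem norm_primary_sub_one_le {u : ℂ} (hu : ‖u‖ ≤ 1) :
    ‖(1 - u) * Complex.exp (u + u ^ 2 / 2) - 1‖ ≤ Real.exp 2 * ‖u‖ ^ 3 := by
  have h := (convex_closedBall (0 : ℂ) ‖u‖).norm_image_sub_le_of_norm_hasDerivWithin_le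
    (C := Real.exp 2 * ‖u‖ ^ 2) (x := 0) (y := u)
    (fun v _ => (hasDerivAt_primary v).hasDerivWithinAt) (fun v hv => ?_)
    (Metric.mem_closedBall_self (norm_nonneg u)) (by simp)
  · simp only [sub_zero, one_mul, zero_add] at h
    convert! h using 1
    · norm_num
    · ring
  · have hv' : ‖v‖ ≤ ‖u‖ := by simpa using hv
    have hv1 : ‖v‖ ≤ 1 := hv'.trans hu
    rw [norm_mul, norm_neg, norm_pow, mul_comm]
    gcongr
    refine (Complex.norm_exp_le_exp_norm _).trans (Real.exp_le_exp.mpr ?_)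
    refine (norm_add_le _ _).trans ?_
    rw [norm_div, norm_pow, Complex.norm_ofNat]
    nlinarith [norm_nonneg v]

theorem sigmaFactor_eq (l z : ℂ) : sigmaFactor l z =
    (1 - z / l) * Complex.exp (z / l + (z / l) ^ 2 / 2) := by
  rw [sigmaFactor, div_pow, div_div, mul_comm (l ^ 2)]

theorem norm_sigmaFactor_sub_one_le {r : ℝ} {z l : ℂ} (hz : ‖z‖ < r) (hl : r ≤ ‖l‖) :
    ‖sigmaFactor l z - 1‖ ≤ Real.exp 2 * r ^ 3 * ‖l‖ ^ (-3 : ℝ) := by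
  have hr : 0 < r := (norm_nonneg z).trans_lt hz
  have hl0 : 0 < ‖l‖ := hr.trans_le hl
  rw [sigmaFactor_eq]
  refine (norm_primary_sub_one_le ?_).trans ?_
  · rw [norm_div, div_le_one hl0]; linarith
  · rw [show (-3 : ℝ) = ((-3 : ℤ) : ℝ) by norm_num, Real.rpow_intCast, zpow_neg, mul_assoc,
      norm_div, div_pow, div_eq_mul_inv]
    norm_cast
    gcongr

theorem eventually_norm_sigmaFactor_sub_one_le (r : ℝ) : ∀ᶠ l : L.lattice in cofinite,
    ∀ z ∈ Metric.ball (0 : ℂ) r,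
      ‖sigmaFactor l z - 1‖ ≤ Real.exp 2 * r ^ 3 * ‖(l : ℂ)‖ ^ (-3 : ℝ) := by
  refine (isCompact_iff_finite.mp (isCompact_closedBall (0 : L.lattice) r)).subset ?_
  intro l hl
  by_contra h
  rw [Metric.mem_closedBall, dist_zero_right, not_le] at h
  exact hl fun z hz => norm_sigmaFactor_sub_one_le (by simpa using hz) h.le

theorem differentiable_sigmaFactor (l : ℂ) : Differentiable ℂ (sigmaFactor l) := by
  unfold sigmaFactor
  fun_prop

theorem hasProdLocallyUniformlyOn_sigmaFactor (r : ℝ) : HasProdLocallyUniformlyOn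
    (fun (l : L.lattice) z => sigmaFactor l z) (fun z => ∏' l : L.lattice, sigmaFactor l z)
    (Metric.ball 0 r) := by
  have h := (L.summable_norm_rpow_neg_three.mul_left
    (Real.exp 2 * r ^ 3)).hasProdLocallyUniformlyOn_one_add Metric.isOpen_ball
    (L.eventually_norm_sigmaFactor_sub_one_le r)
    (fun l => ((differentiable_sigmaFactor l).sub_const 1).continuous.continuousOn)
  simpa only [add_sub_cancel] using h

theorem differentiable_tprod_sigmaFactor :
    Differentiable ℂ fun z => ∏' l : L.lattice, sigmaFactor l z := fun z =>
  ((L.hasProdLocallyUniformlyOn_sigmaFactor (‖z‖ + 1)).differentiableOn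
    (.of_forall fun s => by
      exact DifferentiableOn.fun_finsetProd fun (i : L.lattice) _ =>
        (differentiable_sigmaFactor (i : ℂ)).differentiableOn)
    Metric.isOpen_ball).differentiableAt (Metric.isOpen_ball.mem_nhds (by simp))

theorem sigmaFactor_ne_zero (l : L.lattice) {z : ℂ} (hz : z ∉ L.lattice) :
    sigmaFactor l z ≠ 0 := by
  refine mul_ne_zero (fun h => hz ?_) (Complex.exp_ne_zero _)
  by_cases h0 : (l : ℂ) = 0
  · rw [h0] at h; norm_num at h
  · rw [sub_eq_zero, eq_div_iff h0, one_mul] at h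
    rw [← h]
    exact l.2

theorem summable_norm_sigmaFactor_sub_one (z : ℂ) :
    Summable fun l : L.lattice => ‖sigmaFactor l z - 1‖ := by
  refine Summable.of_norm_bounded_eventually (L.summable_norm_rpow_neg_three.mul_left
    (Real.exp 2 * (‖z‖ + 1) ^ 3)) ?_
  filter_upwards [L.eventually_norm_sigmaFactor_sub_one_le (‖z‖ + 1)] with l hl
  rw [norm_norm]
  exact hl z (by simp)

/-- An absolutely convergent infinite product without zero factors is nonzero. -/
theorem tprod_sigmaFactor_ne_zero {z : ℂ} (hz : z ∉ L.lattice) :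
    ∏' l : L.lattice, sigmaFactor l z ≠ 0 := by
  have h := tprod_one_add_ne_zero_of_summable (f := fun l : L.lattice => sigmaFactor l z - 1)
    (fun l => by rw [add_sub_cancel]; exact L.sigmaFactor_ne_zero l hz)
    (L.summable_norm_sigmaFactor_sub_one z)
  simpa only [add_sub_cancel] using h

theorem logDeriv_sigmaFactor (l : L.lattice) {z : ℂ} (hz : z ∉ L.lattice) :
    logDeriv (sigmaFactor l) z =
      if (l : ℂ) = 0 then 0 else (1 / (z - l) + 1 / (l : ℂ) + z / (l : ℂ) ^ 2) := by
  split_ifs with h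
  · have : sigmaFactor l = fun _ => 1 := by
      funext w; simp [sigmaFactor, h]
    rw [this, logDeriv_const]; rfl
  · have hzl : z - l ≠ 0 := fun e => hz (by rw [sub_eq_zero.mp e]; exact l.2)
    have hlz : (l : ℂ) - z ≠ 0 := fun e => hzl (by linear_combination -e)
    have h1 : HasDerivAt (sigmaFactor l)
        (-(z / l) ^ 2 * Complex.exp (z / l + (z / l) ^ 2 / 2) * (1 / l)) z := by
      have := (hasDerivAt_primary (z / l)).comp z ((hasDerivAt_id z).div_const (l : ℂ))
      exact this.congr_of_eventuallyEq (.of_forall fun w => sigmaFactor_eq l w)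
    rw [logDeriv_apply, h1.deriv, sigmaFactor_eq]
    have he := Complex.exp_ne_zero (z / l + (z / l) ^ 2 / 2)
    have h2 : 1 - z / (l : ℂ) ≠ 0 := by
      rw [one_sub_div h]
      exact div_ne_zero hlz h
    generalize Complex.exp (z / l + (z / l) ^ 2 / 2) = E at he
    field_simp
    ring

theorem differentiable_weierstrassSigma : Differentiable ℂ L.weierstrassSigma :=
  differentiable_id.fun_mul L.differentiable_tprod_sigmaFactor

theorem weierstrassSigma_ne_zero {z : ℂ} (hz : z ∉ L.lattice) : L.weierstrassSigma z ≠ 0 :=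
  mul_ne_zero (fun h => hz (h ▸ L.lattice.zero_mem)) (L.tprod_sigmaFactor_ne_zero hz)

theorem logDeriv_weierstrassSigma {z : ℂ} (hz : z ∉ L.lattice) :
    logDeriv L.weierstrassSigma z = L.weierstrassZeta z := by
  have h0 : z ≠ 0 := fun h => hz (h ▸ L.lattice.zero_mem)
  have h1 := logDeriv_tprod_eq_tsum (f := fun (l : L.lattice) z => sigmaFactor l z)
    (Metric.isOpen_ball (x := (0 : ℂ)) (ε := ‖z‖ + 1)) (x := z) (by simp)
    (fun l => L.sigmaFactor_ne_zero l hz)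
    (fun l => (differentiable_sigmaFactor (l : ℂ)).differentiableOn)
    ((L.hasSum_zetaReg z).summable.congr fun l => (L.logDeriv_sigmaFactor l hz).symm)
    ⟨_, L.hasProdLocallyUniformlyOn_sigmaFactor _⟩ (L.tprod_sigmaFactor_ne_zero hz)
  rw [tsum_congr fun l => L.logDeriv_sigmaFactor l hz] at h1
  have h2 : L.weierstrassSigma = fun z => id z * ∏' l : L.lattice, sigmaFactor l z := rfl
  rw [h2, logDeriv_mul z h0 (L.tprod_sigmaFactor_ne_zero hz) differentiableAt_id
    (L.differentiable_tprod_sigmaFactor z), h1, logDeriv_id, weierstrassZeta_eq, zetaReg]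

theorem hasDerivAt_weierstrassSigma {z : ℂ} (hz : z ∉ L.lattice) :
    HasDerivAt L.weierstrassSigma (L.weierstrassZeta z * L.weierstrassSigma z) z := by
  rw [← L.logDeriv_weierstrassSigma hz, logDeriv_apply,
    div_mul_cancel₀ _ (L.weierstrassSigma_ne_zero hz)]
  exact (L.differentiable_weierstrassSigma z).hasDerivAt

end PeriodPair

end

noncomputable section

open PowerSeries Filter Topology

namespace PeriodPair

open PseudoDiffOp

variable (L : PeriodPair)

/-! ### The expansion of the vacuum Baker–Akhiezer function -/

/-- The function `ζ` as a coefficient. -/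
def zetaFun : L.holomorphicFun :=
  L.toHolomorphicFun L.weierstrassZeta L.differentiableOn_weierstrassZeta

/-- The function `x` as a coefficient. -/
def coordFun : L.holomorphicFun :=
  L.toHolomorphicFun id differentiableOn_id

/-- The Taylor series of `ζ(z) - 1/z` at `0`. -/
def zetaTaylor : ℂ⟦X⟧ := taylorSeries L.zetaReg

theorem derivation_zetaFun : L.derivation L.zetaFun = -L.wp :=
  Subtype.ext <| funext fun z => by
    rw [L.derivation_apply_of_eq (F := L.weierstrassZeta) (fun _ => rfl),
      (L.hasDerivAt_weierstrassZeta z.2).deriv]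
    rfl

theorem derivation_coordFun : L.derivation L.coordFun = 1 :=
  Subtype.ext <| funext fun z => by
    rw [L.derivation_apply_of_eq (F := id) (fun _ => rfl), deriv_id]
    rfl

theorem constantCoeff_zetaTaylor : constantCoeff L.zetaTaylor = 0 := by
  rw [zetaTaylor, taylorSeries.constantCoeff_eq, zetaReg_zero]

theorem derivative_zetaTaylor :
    derivative ℂ L.zetaTaylor = -taylorSeries (L.weierstrassPExcept 0) := by
  rw [zetaTaylor, ← taylorSeries.deriv, ← taylorSeries.neg]
  refine taylorSeries.congr ?_
  filter_upwards [L.eventually_mem_compl_diff] with z hz using (L.hasDerivAt_zetaReg hz).deriv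

theorem zetaTaylor_relation :
    (-2 - X ^ 3 * derivative ℂ (derivative ℂ L.zetaTaylor)) ^ 2 =
      4 * (1 - X ^ 2 * derivative ℂ L.zetaTaylor) ^ 3 -
        C L.g₂ * X ^ 4 * (1 - X ^ 2 * derivative ℂ L.zetaTaylor) - C L.g₃ * X ^ 6 := by
  rw [derivative_zetaTaylor, map_neg]
  linear_combination L.taylorSeries_weierstrassPExcept_relation

/-- Evaluation at a point off the lattice. -/
def evalAt (x : ((L.lattice : Set ℂ)ᶜ : Set ℂ)) : L.holomorphicFun →+* ℂ :=
  (Pi.evalRingHom (fun _ : ((L.lattice : Set ℂ)ᶜ : Set ℂ) => ℂ) x).comp L.holomorphicFun.val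

theorem evalAt_apply (x : ((L.lattice : Set ℂ)ᶜ : Set ℂ)) (f : L.holomorphicFun) :
    L.evalAt x f = f.1 x := rfl

theorem derivative_map_ringHom {R S : Type*} [CommRing R] [CommRing S] (φ : R →+* S) (s : R⟦X⟧) :
    derivative S (map φ s) = map φ (derivative R s) := by
  ext n; simp [coeff_derivative]

/-- `vHat` as a function of `μ = λ⁻¹`, extended to `μ = 0`. -/
def vReg (x μ : ℂ) : ℂ :=
  L.weierstrassSigma (x - μ) / L.weierstrassSigma x * Complex.exp (L.zetaReg μ * x)

/-- The pole 1/μ of ζ(μ) cancels λ in the exponent. -/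
theorem vHat_eq_vReg (x lam : ℂ) : L.vHat x lam = L.vReg x lam⁻¹ := by
  rw [vHat, vReg, weierstrassZeta_eq, one_div, inv_inv, add_sub_cancel_left]

theorem vReg_zero {x : ℂ} (hx : x ∉ L.lattice) : L.vReg x 0 = 1 := by
  rw [vReg, zetaReg_zero, sub_zero, zero_mul, Complex.exp_zero, mul_one,
    div_self (L.weierstrassSigma_ne_zero hx)]

theorem analyticAt_vReg (x : ℂ) : AnalyticAt ℂ (L.vReg x) 0 := by
  have h1 : AnalyticAt ℂ (fun μ => L.weierstrassSigma (x - μ)) 0 :=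
    (L.differentiable_weierstrassSigma.comp (differentiable_id.const_sub x)).analyticAt 0
  exact (h1.div_const (c := L.weierstrassSigma x)).fun_mul
    (L.analyticAt_zetaReg.fun_mul analyticAt_const).cexp

/-- The logarithmic derivative of `vReg` in `μ`. -/
def vRegLogDeriv (x μ : ℂ) : ℂ :=
  -L.weierstrassZeta (x - μ) + x * -L.weierstrassPExcept 0 μ

theorem deriv_vReg {x : ℂ} (hx : x ∉ L.lattice) :
    deriv (L.vReg x) =ᶠ[𝓝 0] fun μ => L.vRegLogDeriv x μ * L.vReg x μ := by
  have hc : ∀ᶠ μ in 𝓝 (0 : ℂ), x - μ ∉ L.lattice := by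
    refine (continuous_const.sub continuous_id).continuousAt.eventually_mem
      (L.isClosed_lattice.isOpen_compl.mem_nhds ?_)
    simpa using hx
  filter_upwards [hc, L.eventually_mem_compl_diff] with μ h1 h2
  have h3 := (L.hasDerivAt_weierstrassSigma h1).comp_const_sub x μ
  have h4 := ((L.hasDerivAt_zetaReg h2).mul_const x).cexp
  have h5 := (h3.div_const (L.weierstrassSigma x)).fun_mul h4
  refine h5.deriv.trans ?_
  rw [vRegLogDeriv, vReg]
  ring

theorem analyticAt_weierstrassZeta_const_sub {x : ℂ} (hx : x ∉ L.lattice) :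
    AnalyticAt ℂ (fun μ => L.weierstrassZeta (x - μ)) 0 := by
  have h : AnalyticAt ℂ L.weierstrassZeta (x - 0) := by
    rw [sub_zero]
    exact L.differentiableOn_weierstrassZeta.analyticAt
      (L.isClosed_lattice.isOpen_compl.mem_nhds hx)
  exact h.comp_of_eq (analyticAt_const.fun_sub analyticAt_id) rfl

/-- Pointwise Taylor expansion of ζ(x - μ) in μ is the formal shift series, so the analytic and
formal equations for V agree. -/
theorem taylorSeries_vRegLogDeriv (x : ((L.lattice : Set ℂ)ᶜ : Set ℂ)) :
    taylorSeries (L.vRegLogDeriv x) =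
      map (L.evalAt x) (logDerivSeries L.derivation L.zetaFun L.coordFun L.zetaTaylor) := by
  have h1 := L.analyticAt_weierstrassZeta_const_sub x.2
  have h2 := L.analyticAt_weierstrassPExcept 0
  have e1 : taylorSeries (L.vRegLogDeriv x) =
      -taylorSeries (fun μ => L.weierstrassZeta (x - μ)) +
        C (x : ℂ) * -taylorSeries (L.weierstrassPExcept 0) := by
    rw [← taylorSeries.neg, ← taylorSeries.neg, ← taylorSeries.const_mul,
      ← taylorSeries.add h1.fun_neg (analyticAt_const.fun_mul h2.fun_neg)]
    rfl
  rw [e1, ← derivative_zetaTaylor, logDerivSeries, map_add, map_neg, map_mul, map_C]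
  congr 2
  · ext n
    rw [taylorSeries.coeff_eq, iteratedDeriv_comp_const_sub, coeff_map, shiftSeries,
      PowerSeries.coeff_mk, evalAt_apply]
    change _ = ((-1) ^ n / (n.factorial : ℂ)) • (L.derivation^[n] L.zetaFun).1 x
    rw [L.iterate_derivation_apply (F := L.weierstrassZeta) (fun _ => rfl), smul_eq_mul]
    simp only [sub_zero, smul_eq_mul]
    ring

/-- At each x both series solve the same linear equation in X with constant term 1. The formal V
thereby supplies Taylor coefficients already known to be holomorphic in x. -/
theorem map_evalAt_eq_taylorSeries {V : L.holomorphicFun⟦X⟧}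
    (hV : derivative _ V = logDerivSeries L.derivation L.zetaFun L.coordFun L.zetaTaylor * V)
    (hV0 : constantCoeff V = 1) (x : ((L.lattice : Set ℂ)ᶜ : Set ℂ)) :
    map (L.evalAt x) V = taylorSeries (L.vReg x) := by
  have h1 : derivative ℂ (taylorSeries (L.vReg x)) =
      taylorSeries (L.vRegLogDeriv x) * taylorSeries (L.vReg x) := by
    rw [← taylorSeries.deriv, taylorSeries.congr (L.deriv_vReg x.2), taylorSeries.mul]
    · exact (L.analyticAt_weierstrassZeta_const_sub x.2).fun_neg.fun_add
        (analyticAt_const.fun_mul (L.analyticAt_weierstrassPExcept 0).fun_neg)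
    · exact L.analyticAt_vReg x
  rw [← sub_eq_zero]
  refine eq_zero_of_derivative_eq_mul (w := taylorSeries (L.vRegLogDeriv x)) ?_ ?_
  · rw [map_sub, h1, derivative_map_ringHom, hV, map_mul, ← taylorSeries_vRegLogDeriv]
    ring
  · rw [map_sub, taylorSeries.constantCoeff_eq, L.vReg_zero x.2,
      ← coeff_zero_eq_constantCoeff_apply, coeff_map, coeff_zero_eq_constantCoeff_apply, hV0,
      map_one, sub_self]

theorem eventually_cobounded_iff {p : ℂ → Prop} :
    (∀ᶠ lam in Bornology.cobounded ℂ, p lam⁻¹) ↔ ∀ᶠ μ in 𝓝[≠] (0 : ℂ), p μ := by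
  rw [← inv_cobounded₀]
  rfl

theorem isExpansionOfVHat_iff {V : L.holomorphicFun⟦X⟧}
    (hV : derivative _ V = logDerivSeries L.derivation L.zetaFun L.coordFun L.zetaTaylor * V)
    (hV0 : constantCoeff V = 1) (v : ℕ → L.holomorphicFun) :
    L.IsExpansionOfVHat v ↔ ∀ n, v n = PowerSeries.coeff n V := by
  have key : ∀ (x : ((L.lattice : Set ℂ)ᶜ : Set ℂ)) (n : ℕ),
      (PowerSeries.coeff n V).1 x = PowerSeries.coeff n (taylorSeries (L.vReg x)) := fun x n => by
    rw [← L.map_evalAt_eq_taylorSeries hV hV0, coeff_map, evalAt_apply]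
  simp only [IsExpansionOfVHat, vHat_eq_vReg]
  constructor
  · intro h n
    refine Subtype.ext <| funext fun x => ?_
    rw [key]
    exact taylorSeries.eq_coeff_of_eventually_hasSum (L.analyticAt_vReg x)
      (c := fun n => (v n).1 x) ((eventually_cobounded_iff (p := fun μ =>
        HasSum (fun n => (v n).1 x * μ ^ n) (L.vReg x μ))).mp (h x)) n
  · intro h x
    refine (eventually_cobounded_iff (p := fun μ =>
        HasSum (fun n => (v n).1 x * μ ^ n) (L.vReg x μ))).mpr ?_
    simp only [h, key]
    exact (taylorSeries.eventually_hasSum (L.analyticAt_vReg x)).filter_mono nhdsWithin_le_nhds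

end PeriodPair

end

theorem mainTheorem2 (L : PeriodPair) :
    (∃! v : ℕ → L.holomorphicFun, L.IsExpansionOfVHat v) ∧
    ∀ v : ℕ → L.holomorphicFun, L.IsExpansionOfVHat v →
      let V₀ : L.PDO := PseudoDiffOp.ofSymbol L.derivation v
      let L₀ : L.PDO := V₀ * PseudoDiffOp.del L.derivation * Ring.inverse V₀
      v 0 = 1 ∧ IsUnit V₀ ∧ L₀.IsStationaryKP ∧
      ∀ n : ℕ,
        (L₀ ^ (n + 2)).nonnegPart =
          L.tildeP (n + 2) - L.constOp (L.laurentCoeff n / ((n : ℂ) + 1)) ∧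
        (L₀ ^ (n + 2)).nonnegPart =
          V₀ * L.opU n * Ring.inverse V₀ - L.constOp (L.laurentCoeff n / ((n : ℂ) + 1)) := by
  -- The formal solution is built first; an expansion of the analytic function is then exactly its
  -- coefficient sequence.
  obtain ⟨V, hV, hV0⟩ := PseudoDiffOp.exists_derivative_eq_mul
    (PseudoDiffOp.logDerivSeries L.derivation L.zetaFun L.coordFun L.zetaTaylor)
  have hiff := L.isExpansionOfVHat_iff hV hV0
  refine ⟨⟨fun n => PowerSeries.coeff n V, (hiff _).mpr fun _ => rfl,
    fun v hv => funext ((hiff v).mp hv)⟩, fun v hv => ?_⟩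
  exact L.stationary_of_series L.derivation_zetaFun L.derivation_coordFun
    L.derivation_wp_sq L.derivation_derivation_wp L.constantCoeff_zetaTaylor L.zetaTaylor_relation
    (by rw [L.uSeries_laurentCoeff_zero, L.derivative_zetaTaylor, neg_neg]) hV hV0
    ((hiff v).mp hv)
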